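/- Let $n\ge 1$, let $\Omega\subset\mathbb R^n$ be a bounded open set (for instance a bounded connected Lipschitz domain), $s\in(0,1)$, $\alpha=1-2s$, and $d_s=2^{\alpha}\Gamma(1-s)/\Gamma(s)$. Let $A=(A^{ij})$ be a measurable, symmetric matrix field on $\Omega$ with $\Lambda_1|\xi|^2\le A(x)\xi\cdot\xi\le\Lambda_2|\xi|^2$ for all $\xi\in\mathbb R^n$ and a.e. $x\in\Omega$, where $0<\Lambda_1\le\Lambda_2$. Let $0\le c\in L^\infty(\Omega)$ and $0\le f\in L^\infty(\Omega)$. Let $\mathbb H^s(\Omega)$ be the space of all $u\in L^2(\Omega)$ with $\sum_k\lambda_k^s(u,\varphi_k)_{L^2(\Omega)}^2<\infty$, where $\lambda_k$ and $\varphi_k$ are the eigenvalues and the $L^2(\Omega)$-normalized eigenfunctions of $\mathcal L w=-\mathrm{div}(A\nabla w)+cw$ with homogeneous Dirichlet conditions. For every $u\in\mathbb H^s(\Omega)$ let $\Psi(u):\Omega\to\mathbb R$ be measurable and non-negative a.e. For $0<h\le\infty$ put $\mathcal C_h=\Omega\times(0,h)$ and $\mathcal C=\mathcal C_\infty$; points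 are written $(x,y)$. Let $H^1(y^\alpha,\mathcal C_h)$ be the space of functions in $L^2(y^\alpha,\mathcal C_h)$ with weak gradient in $L^2(y^\alpha,\mathcal C_h)$, and let $\mathring H^1_L(y^\alpha,\mathcal C_h)$ be its subspace of functions that vanish on $\partial\Omega\times[0,h)$ and, if $h<\infty$, on $\Omega\times\{h\}$, that is, the closure in $H^1(y^\alpha,\mathcal C_h)$ of the restrictions to $\mathcal C_h$ of functions in $C_c^\infty(\Omega\times(-\infty,h))$. Let $\mathrm{tr}$ be the trace on $\Omega\times\{0\}$, the continuous extension to $\mathring H^1_L(y^\alpha,\mathcal C_h)$ of the map $\varphi\mapsto\varphi(\cdot,0)$ on these functions, with values in $L^2(\Omega)$. Put $$a_h(w,v)=\frac1{d_s}\int_{\mathcal C_h}y^\alpha\,\big(\mathrm{diag}(A(x),1)\nabla w\cdot\nabla v+c(x)\,w\,v\big)\,dx\,dy,$$ $$\mathcal K_h(w)=\{v\in\mathring H^1_L(y^\alpha,\mathcal C_h):\ \mathrm{tr}\,v\le\Psi(\mathrm{tr}\,w)\ \text{a.e. in }\Omega\},\qquad a=a_\infty,\quad\mathcal K=\mathcal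 K_\infty .$$ Let $0<\tau<\infty$. A solution of $(\mathrm P_\tau)$ is a function $u\in\mathcal K_\tau(u)$ with $$a_\tau(u,u-v)\le\int_\Omega f\,\mathrm{tr}(u-v)\,dx\qquad\text{for all }v\in\mathcal K_\tau(u).$$ For $w\in\mathring H^1_L(y^\alpha,\mathcal C)$ let $$\mathcal K^\tau(w)=\{v\in\mathcal K(w):\ v\le 0\ \text{a.e. in }\Omega\times(\tau,\infty)\},$$ and let $S^\tau(w)$ be the solution $u$ of the variational inequality: $u\in\mathcal K^\tau(w)$ and $a(u,u-v)\le\int_\Omega f\,\mathrm{tr}(u-v)\,dx$ for all $v\in\mathcal K^\tau(w)$. Then this solution exists and is unique for every $w\in\mathring H^1_L(y^\alpha,\mathcal C)$, so that $S^\tau$ is a well-defined map of $\mathring H^1_L(y^\alpha,\mathcal C)$ into itself. The extension by zero operator $E$ maps $\mathring H^1_L(y^\alpha,\mathcal C_\tau)$ into $\mathring H^1_L(y^\alpha,\mathcal C)$, and the following holds. 1. If $u\in\mathring H^1_L(y^\alpha,\mathcal C_\tau)$ is a solution of $(\mathrm P_\tau)$, then $Eu$ is a fixed point of $S^\tau$.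 2. Conversely, if $u\in\mathring H^1_L(y^\alpha,\mathcal C)$ is a fixed point of $S^\tau$, then its restriction $u|_{\mathcal C_\tau}$ belongs to $\mathring H^1_L(y^\alpha,\mathcal C_\tau)$ and is a solution of $(\mathrm P_\tau)$. -/

import Mathlib

open MeasureTheory Filter Set
open scoped Topology ContDiff

noncomputable section

namespace FracQVI

/-! ### Weak derivatives and Sobolev spaces on open sets -/

section Sobolev

variable {X : Type*} [NormedAddCommGroup X] [NormedSpace ℝ X] [MeasureSpace X]

/-- Smooth functions with compact support contained in `U`. -/
def IsTest (U : Set X) (φ : X → ℝ) : Prop :=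
  ContDiff ℝ ∞ φ ∧ HasCompactSupport φ ∧ tsupport φ ⊆ U

/-- `G` is a weak (distributional) derivative of `w` on the open set `D`; `G x v` is the weak
derivative of `w` in the direction `v`. -/
def HasWeakFDeriv (D : Set X) (w : X → ℝ) (G : X → X →L[ℝ] ℝ) : Prop :=
  LocallyIntegrableOn w D ∧ LocallyIntegrableOn G D ∧
    ∀ φ : X → ℝ, IsTest D φ → ∀ v : X,
      ∫ x in D, w x * fderiv ℝ φ x v = - ∫ x in D, G x v * φ x

open Classical in
/-- The weak derivative of `w` on `D` (unique up to null sets; zero if there is none). -/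
def weakFDeriv (D : Set X) (w : X → ℝ) : X → X →L[ℝ] ℝ :=
  if h : ∃ G, HasWeakFDeriv D w G then h.choose else 0

/-- The (weighted) Sobolev space `H¹(D)` of those `w ∈ L²(μ)` that have a weak gradient on `D`
which lies in `L²(μ)`; `μ` is the (weighted) Lebesgue measure on `D`. -/
def H1 (μ : Measure X) (D : Set X) : Set (Lp ℝ 2 μ) :=
  {w | (∃ G, HasWeakFDeriv D w G) ∧ MemLp (weakFDeriv D w) 2 μ}

/-- Convergence `φ k → w` in the norm of `H¹(D)` for smooth functions `φ k`. -/
def H1Tendsto (μ : Measure X) (D : Set X) (φ : ℕ → X → ℝ) (w : X → ℝ) : Prop :=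
  Tendsto (fun k => eLpNorm (φ k - w) 2 μ) atTop (𝓝 0) ∧
    Tendsto (fun k => eLpNorm (fderiv ℝ (φ k) - weakFDeriv D w) 2 μ) atTop (𝓝 0)

/-- The closure in `H¹(D)` of the (restrictions to `D` of the) test functions supported in `U`:
the functions in `H¹(D)` that vanish on the part of the boundary of `D` outside `U`. -/
def H1Closure (μ : Measure X) (D U : Set X) : Set (Lp ℝ 2 μ) :=
  {w | w ∈ H1 μ D ∧ ∃ φ : ℕ → X → ℝ, (∀ k, IsTest U (φ k)) ∧ H1Tendsto μ D φ w}

end Sobolev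

/-! ### The elliptic operator and its spectral spaces -/

section Spectral

variable {n : ℕ}

/-- `L²(Ω)`. -/
abbrev L2 (Ω : Set (EuclideanSpace ℝ (Fin n))) : Type :=
  Lp ℝ 2 ((volume : Measure (EuclideanSpace ℝ (Fin n))).restrict Ω)

/-- `H¹₀(Ω)`, the closure of `C_c^∞(Ω)` in `H¹(Ω)`. -/
def H10 (Ω : Set (EuclideanSpace ℝ (Fin n))) : Set (L2 Ω) :=
  H1Closure (volume.restrict Ω) Ω Ω

/-- The weak partial derivative `∂u/∂xᵢ` on `Ω`. -/
def pderiv (Ω : Set (EuclideanSpace ℝ (Fin n))) (u : EuclideanSpace ℝ (Fin n) → ℝ) (i : Fin n)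
    (x : EuclideanSpace ℝ (Fin n)) : ℝ :=
  weakFDeriv Ω u x (EuclideanSpace.single i 1)

/-- The bilinear form `∫_Ω A ∇u · ∇v + c u v` of the operator `ℒ u = - div (A ∇u) + c u`. -/
def ellipticForm (Ω : Set (EuclideanSpace ℝ (Fin n)))
    (A : EuclideanSpace ℝ (Fin n) → Matrix (Fin n) (Fin n) ℝ)
    (c : EuclideanSpace ℝ (Fin n) → ℝ) (u v : L2 Ω) : ℝ :=
  ∫ x in Ω, ((∑ i, ∑ j, A x i j * pderiv Ω u j x * pderiv Ω v i x) + c x * u x * v x)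

/-- `φ` is a complete `L²(Ω)`-orthonormal system of eigenfunctions of `ℒ` (with homogeneous
Dirichlet conditions), with eigenvalues `ev`. -/
def IsEigenbasis (Ω : Set (EuclideanSpace ℝ (Fin n)))
    (A : EuclideanSpace ℝ (Fin n) → Matrix (Fin n) (Fin n) ℝ)
    (c : EuclideanSpace ℝ (Fin n) → ℝ) (φ : ℕ → L2 Ω) (ev : ℕ → ℝ) : Prop :=
  Orthonormal ℝ φ ∧ (Submodule.span ℝ (range φ)).topologicalClosure = ⊤ ∧
    ∀ k, φ k ∈ H10 Ω ∧
      ∀ v ∈ H10 Ω, ellipticForm Ω A c (φ k) v = ev k * ∫ x in Ω, φ k x * v x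

/-- The spectral space `ℍ^s(Ω)` of all `u ∈ L²(Ω)` with `∑ₖ λₖ^s (u, φₖ)² < ∞`, where `φₖ`, `λₖ`
are the normalized eigenfunctions and the eigenvalues of `ℒ`. The choice of the eigenbasis is
immaterial, since the eigenspaces are not affected by it. -/
def Hs (Ω : Set (EuclideanSpace ℝ (Fin n)))
    (A : EuclideanSpace ℝ (Fin n) → Matrix (Fin n) (Fin n) ℝ)
    (c : EuclideanSpace ℝ (Fin n) → ℝ) (s : ℝ) : Set (L2 Ω) :=
  {u | ∀ (φ : ℕ → L2 Ω) (ev : ℕ → ℝ), IsEigenbasis Ω A c φ ev →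
    Summable fun k => ev k ^ s * (∫ x in Ω, u x * φ k x) ^ 2}

end Spectral

/-! ### Cylinders, the spaces `H¹_L(y^α)` and the trace -/

section Cylinder

variable {n : ℕ}

/-- The cylinder `Ω × (0, h)`: `h = ⊤` is the semi-infinite cylinder `𝒞`, and `h = τ` is the
truncated cylinder `𝒞_τ`. -/
def cyl (Ω : Set (EuclideanSpace ℝ (Fin n))) (h : EReal) : Set (EuclideanSpace ℝ (Fin n) × ℝ) :=
  {p | p.1 ∈ Ω ∧ 0 < p.2 ∧ (p.2 : EReal) < h}

/-- The set `Ω × (-∞, h)`. A test function supported here vanishes near the lateral boundary of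
the cylinder `Ω × (0, h)` and near its top `Ω × {h}` (if `h` is finite), but is free on the
bottom `Ω × {0}`. -/
def cylLow (Ω : Set (EuclideanSpace ℝ (Fin n))) (h : EReal) :
    Set (EuclideanSpace ℝ (Fin n) × ℝ) :=
  {p | p.1 ∈ Ω ∧ (p.2 : EReal) < h}

/-- The measure `y^α dx dy` on the cylinder `Ω × (0, h)`, where `α = 1 - 2 s`. -/
def cylMeasure (Ω : Set (EuclideanSpace ℝ (Fin n))) (s : ℝ) (h : EReal) :
    Measure (EuclideanSpace ℝ (Fin n) × ℝ) :=
  (volume.withDensity fun p => ENNReal.ofReal (p.2 ^ (1 - 2 * s))).restrict (cyl Ω h)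

/-- The weighted space `L²(y^α, Ω × (0, h))`. -/
abbrev L2C (Ω : Set (EuclideanSpace ℝ (Fin n))) (s : ℝ) (h : EReal) : Type :=
  Lp ℝ 2 (cylMeasure Ω s h)

/-- The space `H¹_L(y^α, Ω × (0, h))` of the functions in `H¹(y^α, Ω × (0, h))` that vanish on the
lateral boundary `∂Ω × [0, h)` and, if `h` is finite, on the top `Ω × {h}`. -/
def HL (Ω : Set (EuclideanSpace ℝ (Fin n))) (s : ℝ) (h : EReal) : Set (L2C Ω s h) :=
  H1Closure (cylMeasure Ω s h) (cyl Ω h) (cylLow Ω h)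

/-- `g` is the trace of `w` on `Ω × {0}`: the trace is the continuous extension of the restriction
`φ ↦ φ(·, 0)` of smooth functions. -/
def IsTrace (Ω : Set (EuclideanSpace ℝ (Fin n))) (s : ℝ) (h : EReal) (w : L2C Ω s h)
    (g : L2 Ω) : Prop :=
  ∃ φ : ℕ → EuclideanSpace ℝ (Fin n) × ℝ → ℝ, (∀ k, IsTest (cylLow Ω h) (φ k)) ∧
    H1Tendsto (cylMeasure Ω s h) (cyl Ω h) φ w ∧
    Tendsto (fun k => eLpNorm (fun x => φ k (x, 0) - g x) 2 (volume.restrict Ω)) atTop (𝓝 0)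

open Classical in
/-- The trace `tr w` of `w ∈ H¹_L(y^α, Ω × (0, h))` on `Ω`. -/
def tr (Ω : Set (EuclideanSpace ℝ (Fin n))) (s : ℝ) (h : EReal) (w : L2C Ω s h) : L2 Ω :=
  if H : ∃ g, IsTrace Ω s h w g then H.choose else 0

/-- The weak partial derivative `∂w/∂xᵢ` on the cylinder. -/
def dx (Ω : Set (EuclideanSpace ℝ (Fin n))) (h : EReal)
    (w : EuclideanSpace ℝ (Fin n) × ℝ → ℝ) (i : Fin n) (p : EuclideanSpace ℝ (Fin n) × ℝ) : ℝ :=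
  weakFDeriv (cyl Ω h) w p (EuclideanSpace.single i 1, 0)

/-- The weak partial derivative `∂w/∂y` on the cylinder. -/
def dy (Ω : Set (EuclideanSpace ℝ (Fin n))) (h : EReal)
    (w : EuclideanSpace ℝ (Fin n) × ℝ → ℝ) (p : EuclideanSpace ℝ (Fin n) × ℝ) : ℝ :=
  weakFDeriv (cyl Ω h) w p (0, 1)

/-- The constant `d_s = 2^α Γ(1 - s) / Γ(s)`, `α = 1 - 2 s`. -/
def dConst (s : ℝ) : ℝ := 2 ^ (1 - 2 * s) * Real.Gamma (1 - s) / Real.Gamma s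

/-- The bilinear form
`(1 / d_s) ∫_{Ω × (0, h)} y^α (diag(A(x), 1) ∇w · ∇v + c(x) w v) dx dy`. -/
def form (Ω : Set (EuclideanSpace ℝ (Fin n))) (s : ℝ)
    (A : EuclideanSpace ℝ (Fin n) → Matrix (Fin n) (Fin n) ℝ)
    (c : EuclideanSpace ℝ (Fin n) → ℝ) (h : EReal) (w v : L2C Ω s h) : ℝ :=
  1 / dConst s * ∫ p, ((∑ i, ∑ j, A p.1 i j * dx Ω h w j p * dx Ω h v i p)
    + dy Ω h w p * dy Ω h v p + c p.1 * w p * v p) ∂(cylMeasure Ω s h)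

/-- `𝒦(w)` for `h = ⊤` and `𝒦_τ(w)` for `h = τ`: the set of all
`v ∈ H¹_L(y^α, Ω × (0, h))` with `tr v ≤ Ψ(tr w)` a.e. in `Ω`. -/
def K (Ω : Set (EuclideanSpace ℝ (Fin n))) (s : ℝ)
    (Ψ : L2 Ω → EuclideanSpace ℝ (Fin n) → ℝ) (h : EReal) (w : L2C Ω s h) : Set (L2C Ω s h) :=
  {v | v ∈ HL Ω s h ∧ ∀ᵐ x ∂(volume.restrict Ω), tr Ω s h v x ≤ Ψ (tr Ω s h w) x}

/-- `u` solves the variational inequality over the set `M`: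
`u ∈ M` and `a(u, u - v) ≤ ⟨f, tr (u - v)⟩` for all `v ∈ M`. -/
def SolvesVI (Ω : Set (EuclideanSpace ℝ (Fin n))) (s : ℝ)
    (A : EuclideanSpace ℝ (Fin n) → Matrix (Fin n) (Fin n) ℝ)
    (c f : EuclideanSpace ℝ (Fin n) → ℝ) (h : EReal) (M : Set (L2C Ω s h)) (u : L2C Ω s h) :
    Prop :=
  u ∈ M ∧ ∀ v ∈ M, form Ω s A c h u (u - v) ≤ ∫ x in Ω, f x * tr Ω s h (u - v) x

/-- `u` solves the quasi-variational inequality on `Ω × (0, h)`; for `h = τ` this is the truncated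
problem: `u ∈ 𝒦_τ(u)` and `a_τ(u, u - v) ≤ ⟨f, tr (u - v)⟩` for all `v ∈ 𝒦_τ(u)`. -/
def SolvesQVI (Ω : Set (EuclideanSpace ℝ (Fin n))) (s : ℝ)
    (A : EuclideanSpace ℝ (Fin n) → Matrix (Fin n) (Fin n) ℝ)
    (c f : EuclideanSpace ℝ (Fin n) → ℝ) (Ψ : L2 Ω → EuclideanSpace ℝ (Fin n) → ℝ) (h : EReal)
    (u : L2C Ω s h) : Prop :=
  SolvesVI Ω s A c f h (K Ω s Ψ h u) u

/-- `𝒦^τ(w)`: the set of all `v ∈ 𝒦(w)` with `v ≤ 0` a.e. in `Ω × (τ, ∞)`. -/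
def Ktau (Ω : Set (EuclideanSpace ℝ (Fin n))) (s : ℝ)
    (Ψ : L2 Ω → EuclideanSpace ℝ (Fin n) → ℝ) (τ : ℝ) (w : L2C Ω s ⊤) : Set (L2C Ω s ⊤) :=
  {v | v ∈ K Ω s Ψ ⊤ w ∧ ∀ᵐ p ∂(volume.restrict (Ω ×ˢ Ioi τ)), v p ≤ 0}

open Classical in
/-- The solution `S(M) = R(f, M)` of the variational inequality over `M` on the full cylinder. -/
def S (Ω : Set (EuclideanSpace ℝ (Fin n))) (s : ℝ)
    (A : EuclideanSpace ℝ (Fin n) → Matrix (Fin n) (Fin n) ℝ)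
    (c f : EuclideanSpace ℝ (Fin n) → ℝ) (M : Set (L2C Ω s ⊤)) : L2C Ω s ⊤ :=
  if H : ∃ u, SolvesVI Ω s A c f ⊤ M u then H.choose else 0

/-- The map `S^τ(w) = S(𝒦^τ(w))`. -/
def Stau (Ω : Set (EuclideanSpace ℝ (Fin n))) (s : ℝ)
    (A : EuclideanSpace ℝ (Fin n) → Matrix (Fin n) (Fin n) ℝ)
    (c f : EuclideanSpace ℝ (Fin n) → ℝ) (Ψ : L2 Ω → EuclideanSpace ℝ (Fin n) → ℝ) (τ : ℝ)
    (w : L2C Ω s ⊤) : L2C Ω s ⊤ :=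
  S Ω s A c f (Ktau Ω s Ψ τ w)

/-! ### Extension by zero and restriction -/

lemma cyl_subset (Ω : Set (EuclideanSpace ℝ (Fin n))) (h : EReal) : cyl Ω h ⊆ cyl Ω ⊤ :=
  fun p hp => ⟨hp.1, hp.2.1, EReal.coe_lt_top p.2⟩

lemma measurableSet_cyl {Ω : Set (EuclideanSpace ℝ (Fin n))} (hΩ : IsOpen Ω) (h : EReal) :
    MeasurableSet (cyl Ω h) := by
  have h1 : MeasurableSet {p : EuclideanSpace ℝ (Fin n) × ℝ | p.1 ∈ Ω} :=
    hΩ.measurableSet.preimage measurable_fst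
  have h2 : MeasurableSet {p : EuclideanSpace ℝ (Fin n) × ℝ | 0 < p.2} :=
    measurableSet_Ioi.preimage measurable_snd
  have h3 : MeasurableSet {p : EuclideanSpace ℝ (Fin n) × ℝ | (p.2 : EReal) < h} :=
    (measurableSet_Iio (a := h)).preimage (measurable_coe_real_ereal.comp measurable_snd)
  exact h1.inter (h2.inter h3)

lemma memLp_restrict {Ω : Set (EuclideanSpace ℝ (Fin n))} {s : ℝ} (h : EReal)
    (u : L2C Ω s ⊤) : MemLp u 2 (cylMeasure Ω s h) :=
  (Lp.memLp u).mono_measure (Measure.restrict_mono (cyl_subset Ω h) le_rfl)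

lemma memLp_extend {Ω : Set (EuclideanSpace ℝ (Fin n))} (hΩ : IsOpen Ω) {s : ℝ} {h : EReal}
    (u : L2C Ω s h) : MemLp ((cyl Ω h).indicator u) 2 (cylMeasure Ω s ⊤) := by
  have key : (cylMeasure Ω s ⊤).restrict (cyl Ω h) = cylMeasure Ω s h := by
    unfold cylMeasure
    rw [Measure.restrict_restrict (measurableSet_cyl hΩ h),
      inter_eq_self_of_subset_left (cyl_subset Ω h)]
  rw [memLp_indicator_iff_restrict (measurableSet_cyl hΩ h), key]
  exact Lp.memLp u

/-- The restriction `u|_{Ω × (0, h)}` of a function on the full cylinder. -/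
def restr {Ω : Set (EuclideanSpace ℝ (Fin n))} {s : ℝ} (h : EReal) (u : L2C Ω s ⊤) : L2C Ω s h :=
  (memLp_restrict h u).toLp u

/-- The extension by zero operator `E` from `Ω × (0, h)` to the full cylinder. -/
def E {Ω : Set (EuclideanSpace ℝ (Fin n))} (hΩ : IsOpen Ω) {s : ℝ} {h : EReal} (u : L2C Ω s h) :
    L2C Ω s ⊤ :=
  (memLp_extend hΩ u).toLp ((cyl Ω h).indicator u)

end Cylinder

end FracQVI

end

/-! The heart of the matter is that the solution `p` of the variational inequality over `Ktau w`
vanishes above `τ`. Its positive part is again admissible, because the obstacle is non-negative and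
`max p 0` is still `≤ 0` above `τ`. Passing to the positive part does not increase the energy
(`exists_posPart`) and, since `f ≥ 0`, does not decrease the load term. By coercivity `p` equals its
positive part, so `p ≥ 0`; being also `≤ 0` above `τ`, it is zero there (`exists_solution_vanish`).
A function that vanishes above `τ` is a limit of test functions supported below `τ`
(`mem_sobolevTriples_of_vanish`), so it is the zero extension of an element of `HL Ω s τ`.

Extension by zero preserves the form and the trace (`tripleForm_extend`, `exists_extend`), hence
also the obstacle. If `u` solves the truncated problem and `z` is the solution over `Ktau (E u)`,
then the restriction of `z` competes with `u` and `E u` competes with `z`. Adding the two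
inequalities and using coercivity gives `z = E u` (`solvesVI_E`). Conversely, a fixed point vanishes
above `τ`, and every competitor of the truncated problem becomes, after extension by zero, a
competitor of the fixed point (`solvesQVI_restr`).

Sobolev functions are handled as triples `(w, ∇w, tr w)` in a product of `L²` spaces, and the
function space is the closure of the triples of test functions. The weighted trace inequality and
the uniqueness of weak gradients show that a triple is determined by `w` (`sobolevTriples_ext`). The
spaces `HL`, the operator `tr` and the bilinear form are thereby read off from a closed subspace of
a Banach space, on which the form is coercive by a Poincaré inequality and the trace inequality
(`exists_coercive`).

Positive parts and cutoffs produce approximating sequences whose energies are bounded but whose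
gradients are not known to converge. The passage to the limit is `IsBddSymm.exists_weak_limit`:
elements of least energy in the closed convex hulls of the tails converge strongly.

The obstacle is known to be non-negative only for arguments in `Hs`. So traces must be shown to lie
there (`tr_mem_Hs`): the coefficients of a test function in the eigenbasis are functions of `y`
alone, each obeys a one-dimensional trace inequality that is sharp in its dependence on the
eigenvalue, and Bessel's inequality sums them. -/

noncomputable section

set_option linter.unusedSectionVars false

namespace FracQVI

/-! ### Coercive symmetric forms on closed subspaces -/

section Abstract

variable {P : Type*} [NormedAddCommGroup P] [NormedSpace ℝ P]

/-- A symmetric, nonnegative, bounded bilinear form. -/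
structure IsBddSymm (a : P →ₗ[ℝ] P →ₗ[ℝ] ℝ) (M : ℝ) : Prop where
  symm : ∀ p q, a p q = a q p
  nonneg : ∀ p, 0 ≤ a p p
  le : ∀ p, a p p ≤ M * ‖p‖ ^ 2

variable {a : P →ₗ[ℝ] P →ₗ[ℝ] ℝ} {M : ℝ}

/-- Cauchy–Schwarz: the quadratic polynomial `t ↦ a (t q + p) (t q + p)` is non-negative, so its
discriminant is not positive. This works for semidefinite forms. -/
lemma IsBddSymm.abs_le (ha : IsBddSymm a M) (p q : P) :
    |a p q| ≤ Real.sqrt (a p p) * Real.sqrt (a q q) := by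
  rw [← Real.sqrt_mul (ha.nonneg p)]
  apply Real.abs_le_sqrt
  have key : ∀ t : ℝ, 0 ≤ a q q * (t * t) + (2 * a p q) * t + a p p := by
    intro t
    have := ha.nonneg (t • q + p)
    simp only [map_add, LinearMap.add_apply, map_smul, LinearMap.smul_apply, smul_eq_mul] at this
    rw [ha.symm q p] at this
    nlinarith
  have := discrim_le_zero key
  unfold discrim at this
  nlinarith

/-- By Cauchy–Schwarz a bound on the diagonal bounds the whole form. The absolute value is taken
because the sign of `M` is not prescribed. -/
lemma IsBddSymm.norm_le (ha : IsBddSymm a M) (p q : P) : ‖a p q‖ ≤ |M| * ‖p‖ * ‖q‖ := by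
  have h1 : ∀ p, Real.sqrt (a p p) ≤ Real.sqrt |M| * ‖p‖ := by
    intro p
    apply Real.sqrt_le_iff.2 ⟨by positivity, ?_⟩
    rw [mul_pow, Real.sq_sqrt (abs_nonneg M)]
    exact (ha.le p).trans (by gcongr; exact le_abs_self M)
  refine (ha.abs_le p q).trans ?_
  calc _ ≤ (Real.sqrt |M| * ‖p‖) * (Real.sqrt |M| * ‖q‖) := by
        gcongr <;> apply h1
    _ = (Real.sqrt |M| * Real.sqrt |M|) * ‖p‖ * ‖q‖ := by ring
    _ = _ := by rw [Real.mul_self_sqrt (abs_nonneg M)]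

lemma IsBddSymm.continuous_diag (ha : IsBddSymm a M) : Continuous fun p => a p p := by
  let b := LinearMap.mkContinuous₂ a |M| ha.norm_le
  have hb : ∀ p, b p p = a p p := fun p => rfl
  simp_rw [← hb]
  fun_prop

lemma IsBddSymm.parallelogram (p q : P) :
    a ((2⁻¹ : ℝ) • (p + q)) ((2⁻¹ : ℝ) • (p + q))
      = 2⁻¹ * a p p + 2⁻¹ * a q q - 4⁻¹ * a (p - q) (p - q) := by
  simp only [map_add, map_sub, LinearMap.sub_apply, LinearMap.add_apply, map_smul,
    LinearMap.smul_apply, smul_eq_mul]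
  ring

variable [CompleteSpace P] {V : Submodule ℝ P} {κ : ℝ}

/-- The variational inequality for a coercive symmetric form over a closed convex set is
solvable. -/
lemma IsBddSymm.exists_solution (ha : IsBddSymm a M) (hκ : 0 < κ)
    (hco : ∀ p ∈ V, κ * ‖p‖ ^ 2 ≤ a p p) (F : P →L[ℝ] ℝ) {C : Set P} (hC : IsClosed C)
    (hconv : Convex ℝ C) (hne : C.Nonempty) (hCV : C ⊆ V) :
    ∃ u ∈ C, ∀ v ∈ C, a u (u - v) ≤ F (u - v) := by
  -- For a symmetric form the variational inequality is the first-order condition for a minimum of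
  -- `J` over `C`.
  let J : P → ℝ := fun p => 2⁻¹ * a p p - F p
  have hJc : Continuous J := (continuous_const.mul ha.continuous_diag).sub F.continuous
  have hbdd : BddBelow (J '' C) := by
    -- The least value of `κ t² / 2 - ‖F‖ t`, found by completing the square.
    refine ⟨-(‖F‖ ^ 2 / (2 * κ)), ?_⟩
    rintro _ ⟨p, hp, rfl⟩
    have h1 := hco p (hCV hp)
    have h2 : F p ≤ ‖F‖ * ‖p‖ := (le_abs_self _).trans (F.le_opNorm p)
    have h3 : 0 ≤ (κ * ‖p‖ - ‖F‖) ^ 2 / (2 * κ) := by positivity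
    have h4 : (κ * ‖p‖ - ‖F‖) ^ 2 / (2 * κ)
        = 2⁻¹ * (κ * ‖p‖ ^ 2) - ‖F‖ * ‖p‖ + ‖F‖ ^ 2 / (2 * κ) := by
      field_simp
      ring
    simp only [J]
    linarith
  set m := sInf (J '' C) with hm
  have hm_le : ∀ p ∈ C, m ≤ J p := fun p hp => csInf_le hbdd ⟨p, hp, rfl⟩
  have hex : ∀ k : ℕ, ∃ p ∈ C, J p < m + 1 / (k + 1) := by
    intro k
    obtain ⟨_, ⟨p, hp, rfl⟩, hlt⟩ := exists_lt_of_csInf_lt (hne.image J)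
      (show sInf (J '' C) < m + 1 / ((k : ℝ) + 1) by
        rw [← hm]; linarith [Nat.one_div_pos_of_nat (α := ℝ) (n := k)])
    exact ⟨p, hp, hlt⟩
  choose x hxC hx using hex
  -- The midpoint lies in `C`, so `J` there is at least `m`; the parallelogram identity turns this
  -- into a bound on the distance. The constant is `8⁻¹ = 2⁻¹ · 4⁻¹`. Minimising sequences are
  -- therefore Cauchy.
  have hdist : ∀ p ∈ C, ∀ q ∈ C, κ / 8 * ‖p - q‖ ^ 2 ≤ 2⁻¹ * (J p - m) + 2⁻¹ * (J q - m) := by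
    intro p hp q hq
    have hmid : (2⁻¹ : ℝ) • (p + q) ∈ C := by
      rw [smul_add]
      exact hconv hp hq (by norm_num) (by norm_num) (by norm_num)
    have h1 := hm_le _ hmid
    have h2 := hco (p - q) (V.sub_mem (hCV hp) (hCV hq))
    simp only [J] at h1 ⊢
    rw [IsBddSymm.parallelogram, map_smul, map_add, smul_eq_mul] at h1
    linarith
  have hcau : CauchySeq x := by
    rw [Metric.cauchySeq_iff']
    intro ε hε
    obtain ⟨N, hN⟩ := exists_nat_one_div_lt (show 0 < κ / 8 * ε ^ 2 by positivity)
    refine ⟨N, fun k hk => ?_⟩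
    have h1 := hdist _ (hxC k) _ (hxC N)
    have h2 := hx k
    have h3 := hx N
    have h4 : 1 / ((k : ℝ) + 1) ≤ 1 / ((N : ℝ) + 1) := Nat.one_div_le_one_div hk
    rw [dist_eq_norm]
    have h5 : κ / 8 * ‖x k - x N‖ ^ 2 < κ / 8 * ε ^ 2 := by linarith
    have h6 := lt_of_mul_lt_mul_left h5 (by positivity)
    exact lt_of_pow_lt_pow_left₀ 2 hε.le h6
  obtain ⟨u, hu⟩ := cauchySeq_tendsto_of_complete hcau
  have huC : u ∈ C := hC.mem_of_tendsto hu (Eventually.of_forall hxC)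
  have hJu : J u ≤ m := by
    have h1 : Tendsto (fun k => J (x k)) atTop (𝓝 (J u)) := (hJc.tendsto u).comp hu
    have h2 : Tendsto (fun k : ℕ => m + 1 / ((k : ℝ) + 1)) atTop (𝓝 (m + 0)) :=
      tendsto_one_div_add_atTop_nhds_zero_nat.const_add m
    rw [add_zero] at h2
    exact le_of_tendsto_of_tendsto' h1 h2 fun k => (hx k).le
  refine ⟨u, huC, fun v hv => ?_⟩
  -- Compare `u` with the point of the segment to `v` at parameter `t`, and divide by `t`. The right
  -- side then tends to zero with `t`.
  have hmain : ∀ t ∈ Ioo (0 : ℝ) 1, a u (u - v) - F (u - v) ≤ t * (2⁻¹ * a (u - v) (u - v)) := by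
    intro t ht
    have hmem : u - t • (u - v) ∈ C := by
      have := hconv huC hv (show 0 ≤ 1 - t by linarith [ht.2]) ht.1.le (by ring)
      convert this using 1
      module
    have h1 := hJu.trans (hm_le _ hmem)
    simp only [J] at h1
    set d := u - v
    simp only [map_sub, LinearMap.sub_apply, map_smul, LinearMap.smul_apply, smul_eq_mul] at h1
    rw [ha.symm d u] at h1
    have h2 : t * (a u d - F d) ≤ t * (t * (2⁻¹ * a d d)) := by linarith
    exact le_of_mul_le_mul_left h2 ht.1
  have hlim : Tendsto (fun t : ℝ => t * (2⁻¹ * a (u - v) (u - v))) (𝓝[>] 0)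
      (𝓝 (0 * (2⁻¹ * a (u - v) (u - v)))) :=
    (tendsto_id.mono_left nhdsWithin_le_nhds).mul_const _
  rw [zero_mul] at hlim
  have := ge_of_tendsto hlim (by
    filter_upwards [Ioo_mem_nhdsGT (show (0 : ℝ) < 1 by norm_num)] with t ht using hmain t ht)
  linarith

/-- Weak sequential compactness: bounded sequences whose images under a continuous linear map
converge have a weak limit point that lies over the limit of the images. -/
lemma IsBddSymm.exists_weak_limit (ha : IsBddSymm a M) (hκ : 0 < κ)
    (hV : IsClosed (V : Set P)) (hco : ∀ p ∈ V, κ * ‖p‖ ^ 2 ≤ a p p)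
    {Y : Type*} [NormedAddCommGroup Y] [NormedSpace ℝ Y] (T : P →L[ℝ] Y)
    {q : ℕ → P} (hq : ∀ k, q k ∈ V) {r : ℕ → ℝ} {R : ℝ} (hr : Tendsto r atTop (𝓝 R))
    (hqr : ∀ k, a (q k) (q k) ≤ r k) {y : Y} (hy : Tendsto (fun k => T (q k)) atTop (𝓝 y)) :
    ∃ p ∈ V, T p = y ∧ a p p ≤ R := by
  -- the sets of those points of `V` which are almost as good as the tail of the sequence
  let C : ℕ → Set P := fun m => closure (convexHull ℝ (q '' Ici m))
  have hCconv : ∀ m, Convex ℝ (C m) := fun m => (convex_convexHull ℝ _).closure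
  have hCV : ∀ m, C m ⊆ V := by
    intro m
    refine closure_minimal (convexHull_min ?_ V.convex) hV
    rintro _ ⟨k, -, rfl⟩
    exact hq k
  have hqC : ∀ m k, m ≤ k → q k ∈ C m := fun m k hk =>
    subset_closure (subset_convexHull ℝ _ ⟨k, hk, rfl⟩)
  have hanti : ∀ m k, m ≤ k → C k ⊆ C m := fun m k hk =>
    closure_mono (convexHull_mono (image_mono (Ici_subset_Ici.2 hk)))
  have hex : ∀ m, ∃ u ∈ C m, ∀ v ∈ C m, a u (u - v) ≤ 0 := by
    intro m
    exact ha.exists_solution hκ hco 0 isClosed_closure (hCconv m) ⟨q m, hqC m m le_rfl⟩ (hCV m)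
  choose x hxC hx using hex
  -- Minimality of `x m` over `C m` is a Pythagorean inequality. Since the sets `C m` decrease, the
  -- energies of the `x m` increase; they are bounded by `R`, hence converge, and the inequality
  -- then makes `x` a Cauchy sequence.
  have hpyth : ∀ m, ∀ v ∈ C m, a (x m - v) (x m - v) ≤ a v v - a (x m) (x m) := by
    intro m v hv
    have h1 := hx m v hv
    simp only [map_sub, LinearMap.sub_apply] at h1 ⊢
    rw [ha.symm v (x m)]
    linarith
  have hle : ∀ m, ∀ v ∈ C m, a (x m) (x m) ≤ a v v := fun m v hv => by
    linarith [hpyth m v hv, ha.nonneg (x m - v)]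
  have hmono : Monotone fun m => a (x m) (x m) := fun m k hk =>
    hle m _ (hanti m k hk (hxC k))
  have hxR : ∀ m, a (x m) (x m) ≤ R := fun m =>
    ge_of_tendsto hr (eventually_atTop.2 ⟨m, fun k hk => (hle m _ (hqC m k hk)).trans (hqr k)⟩)
  have hbdd : BddAbove (range fun m => a (x m) (x m)) := ⟨R, by rintro _ ⟨m, rfl⟩; exact hxR m⟩
  have hconv := tendsto_atTop_ciSup hmono hbdd
  have hcau : CauchySeq x := by
    rw [Metric.cauchySeq_iff']
    intro ε hε
    have hc := hconv.cauchySeq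
    rw [Metric.cauchySeq_iff'] at hc
    obtain ⟨N, hN⟩ := hc (κ * ε ^ 2) (by positivity)
    refine ⟨N, fun k hk => ?_⟩
    have h1 := hpyth N (x k) (hanti N k hk (hxC k))
    have h2 := hN k hk
    rw [Real.dist_eq] at h2
    have h3 := hco _ (V.sub_mem (hCV N (hxC N)) (hCV k (hxC k)))
    have h4 : κ * ‖x N - x k‖ ^ 2 < κ * ε ^ 2 := by
      linarith [le_abs_self (a (x k) (x k) - a (x N) (x N))]
    rw [dist_comm, dist_eq_norm]
    exact lt_of_pow_lt_pow_left₀ 2 hε.le (lt_of_mul_lt_mul_left h4 hκ.le)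
  obtain ⟨p, hp⟩ := cauchySeq_tendsto_of_complete hcau
  refine ⟨p, hV.mem_of_tendsto hp (Eventually.of_forall fun m => hCV m (hxC m)), ?_, ?_⟩
  · refine tendsto_nhds_unique ((T.continuous.tendsto p).comp hp) ?_
    rw [Metric.tendsto_atTop]
    intro ε hε
    obtain ⟨N, hN⟩ := (Metric.tendsto_atTop.1 hy) (ε / 2) (by positivity)
    refine ⟨N, fun m hm => ?_⟩
    -- The preimage of a closed ball is closed and convex, so it contains the closed convex hull of
    -- a tail once it contains the tail.
    have hsub : C m ⊆ T ⁻¹' Metric.closedBall y (ε / 2) := by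
      refine closure_minimal (convexHull_min ?_ ?_) (Metric.isClosed_closedBall.preimage T.continuous)
      · rintro _ ⟨k, hk, rfl⟩
        exact (hN k (hm.trans hk)).le
      · exact (convex_closedBall y (ε / 2)).linear_preimage T.toLinearMap
    have := hsub (hxC m)
    rw [mem_preimage, Metric.mem_closedBall] at this
    exact this.trans_lt (by linarith)
  · exact le_of_tendsto ((ha.continuous_diag.tendsto p).comp hp) (Eventually.of_forall hxR)

end Abstract

/-! ### Weak derivatives of limits of test functions -/

section Weak

open scoped ENNReal

variable {X : Type*} [NormedAddCommGroup X] [NormedSpace ℝ X] [MeasureSpace X]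

/-- The measure `μ` on the open set `D` is finite on compact sets and bounded below by Lebesgue
measure on compact subsets of `D`. -/
structure IsWeight (μ : Measure X) (D : Set X) : Prop where
  isOpen : IsOpen D
  le : ∀ K, IsCompact K → K ⊆ D → ∃ C : ℝ≥0∞, C ≠ ⊤ ∧ volume.restrict K ≤ C • μ
  ac : μ ≪ volume.restrict D
  fin : IsFiniteMeasureOnCompacts μ

lemma IsTest.add {U : Set X} {φ ψ : X → ℝ} (hφ : IsTest U φ) (hψ : IsTest U ψ) :
    IsTest U (φ + ψ) :=
  ⟨hφ.1.add hψ.1, hφ.2.1.add hψ.2.1,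
    (tsupport_add φ ψ).trans (union_subset hφ.2.2 hψ.2.2)⟩

lemma IsTest.smul {U : Set X} {φ : X → ℝ} (hφ : IsTest U φ) (r : ℝ) : IsTest U (r • φ) :=
  ⟨hφ.1.const_smul r, hφ.2.1.mono (Function.support_const_smul_subset r φ),
    (closure_mono (Function.support_const_smul_subset r φ)).trans hφ.2.2⟩

lemma IsTest.zero {U : Set X} : IsTest U (0 : X → ℝ) :=
  ⟨contDiff_const, HasCompactSupport.zero, by simp [tsupport]⟩

lemma IsTest.mono {U U' : Set X} (h : U ⊆ U') {φ : X → ℝ} (hφ : IsTest U φ) : IsTest U' φ :=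
  ⟨hφ.1, hφ.2.1, hφ.2.2.trans h⟩

lemma IsTest.continuous {U : Set X} {φ : X → ℝ} (hφ : IsTest U φ) : Continuous φ :=
  hφ.1.continuous

lemma IsTest.differentiable {U : Set X} {φ : X → ℝ} (hφ : IsTest U φ) : Differentiable ℝ φ :=
  hφ.1.differentiable (by simp)

lemma IsTest.continuous_fderiv {U : Set X} {φ : X → ℝ} (hφ : IsTest U φ) :
    Continuous (fderiv ℝ φ) :=
  hφ.1.continuous_fderiv (by simp)

lemma IsTest.eq_zero {U : Set X} {φ : X → ℝ} (hφ : IsTest U φ) {x : X} (hx : x ∉ U) : φ x = 0 :=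
  image_eq_zero_of_notMem_tsupport fun h => hx (hφ.2.2 h)

lemma IsTest.fderiv_eq_zero {U : Set X} {φ : X → ℝ} (hφ : IsTest U φ) {x : X} (hx : x ∉ U) :
    fderiv ℝ φ x = 0 :=
  image_eq_zero_of_notMem_tsupport fun h => hx (hφ.2.2 (tsupport_fderiv_subset ℝ h))

variable [FiniteDimensional ℝ X] [BorelSpace X]

lemma IsTest.memLp {U : Set X} {φ : X → ℝ} (hφ : IsTest U φ) {μ : Measure X}
    [IsFiniteMeasureOnCompacts μ] (p : ℝ≥0∞) : MemLp φ p μ :=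
  hφ.continuous.memLp_of_hasCompactSupport hφ.2.1

lemma IsTest.memLp_fderiv {U : Set X} {φ : X → ℝ} (hφ : IsTest U φ) {μ : Measure X}
    [IsFiniteMeasureOnCompacts μ] (p : ℝ≥0∞) : MemLp (fderiv ℝ φ) p μ :=
  hφ.continuous_fderiv.memLp_of_hasCompactSupport (hφ.2.1.fderiv ℝ)

variable {μ : Measure X} {D : Set X}

lemma IsWeight.memLp_restrict (hμ : IsWeight μ D) {F : Type*} [NormedAddCommGroup F] {f : X → F}
    (hf : MemLp f 2 μ) {K : Set X} (hK : IsCompact K) (hKD : K ⊆ D) :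
    MemLp f 2 (volume.restrict K) := by
  obtain ⟨C, hC, hle⟩ := hμ.le K hK hKD
  exact hf.of_measure_le_smul hC hle

lemma IsWeight.locallyIntegrableOn (hμ : IsWeight μ D) [(volume : Measure X).IsAddHaarMeasure]
    {F : Type*} [NormedAddCommGroup F] {f : X → F} (hf : MemLp f 2 μ) :
    LocallyIntegrableOn f D := by
  rw [locallyIntegrableOn_iff hμ.isOpen.isLocallyClosed]
  intro K hKD hK
  have : IsFiniteMeasure ((volume : Measure X).restrict K) := ⟨by
    rw [Measure.restrict_apply_univ]; exact hK.measure_lt_top⟩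
  exact (hμ.memLp_restrict hf hK hKD).integrable (by norm_num)

/-- Convergence is measured in `μ` while the integrals are taken with Lebesgue measure. On the
compact support of `b` the latter is dominated by a multiple of `μ`, and Hölder's inequality does
the rest. -/
lemma IsWeight.tendsto_integral_mul (hμ : IsWeight μ D)
    [(volume : Measure X).IsAddHaarMeasure] {f : ℕ → X → ℝ} {g : X → ℝ}
    (hf : ∀ k, MemLp (f k) 2 μ) (hg : MemLp g 2 μ)
    (hfg : Tendsto (fun k => eLpNorm (f k - g) 2 μ) atTop (𝓝 0)) {b : X → ℝ} (hb : Continuous b)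
    (hbc : HasCompactSupport b) (hbD : tsupport b ⊆ D) :
    Tendsto (fun k => ∫ x in D, f k x * b x) atTop (𝓝 (∫ x in D, g x * b x)) := by
  set K := tsupport b with hK
  have hKc : IsCompact K := hbc
  have hred : ∀ u : X → ℝ, ∫ x in D, u x * b x = ∫ x in K, u x * b x := by
    intro u
    rw [setIntegral_eq_of_subset_of_forall_sdiff_eq_zero hμ.isOpen.measurableSet hbD]
    intro x hx
    rw [image_eq_zero_of_notMem_tsupport hx.2, mul_zero]
  simp_rw [hred]
  obtain ⟨C, hC, hle⟩ := hμ.le K hKc hbD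
  have hbm : MemLp b 2 (volume.restrict K) := hb.memLp_of_hasCompactSupport hbc
  have hint : ∀ {u : X → ℝ}, MemLp u 2 μ → Integrable (fun x => u x * b x) (volume.restrict K) :=
    fun hu => (hμ.memLp_restrict hu hKc hbD).integrable_mul hbm
  refine tendsto_integral_of_L1' _ (hint hg).aestronglyMeasurable
    (Eventually.of_forall fun k => hint (hf k)) ?_
  have hbound : ∀ k, eLpNorm ((fun x => f k x * b x) - fun x => g x * b x) 1 (volume.restrict K)
      ≤ eLpNorm (f k - g) 2 μ * (C ^ (1 / (2 : ℝ≥0∞).toReal) * eLpNorm b 2 (volume.restrict K)) := by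
    intro k
    have h1 : ((fun x => f k x * b x) - fun x => g x * b x) = (f k - g) • b := by
      ext x; simp [sub_mul]
    rw [h1]
    refine (eLpNorm_smul_le_mul_eLpNorm (p := 2) (q := 2) hbm.1
      (hμ.memLp_restrict ((hf k).sub hg) hKc hbD).1).trans ?_
    rw [← mul_assoc]
    refine mul_le_mul_left ?_ _
    refine (eLpNorm_mono_measure _ hle).trans ?_
    rw [eLpNorm_smul_measure_of_ne_top (by norm_num), smul_eq_mul, mul_comm, ENNReal.toReal_div,
      ENNReal.toReal_one]
  have hlim := ENNReal.Tendsto.mul_const (b := C ^ (1 / (2 : ℝ≥0∞).toReal) *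
    eLpNorm b 2 (volume.restrict K)) hfg
    (Or.inr (ENNReal.mul_ne_top (ENNReal.rpow_ne_top_of_nonneg (by positivity) hC) hbm.2.ne))
  rw [zero_mul] at hlim
  exact tendsto_of_tendsto_of_tendsto_of_le_of_le tendsto_const_nhds hlim (fun _ => zero_le)
    hbound

variable [(volume : Measure X).IsAddHaarMeasure]

/-- Only `ψ` has to vanish near the boundary of `D`: the integrals extend to the whole space because
of `ψ`, whereas `φ` may be nonzero on `∂D`, as on the bottom of the cylinder. -/
lemma IsTest.hasWeakFDeriv {U : Set X} {φ ψ : X → ℝ} (hφ : IsTest U φ) (hψ : IsTest D ψ) (v : X) :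
    ∫ x in D, φ x * fderiv ℝ ψ x v = - ∫ x in D, fderiv ℝ φ x v * ψ x := by
  have h1 : ∫ x in D, φ x * fderiv ℝ ψ x v = ∫ x, φ x * fderiv ℝ ψ x v := by
    refine setIntegral_eq_integral_of_forall_compl_eq_zero fun x hx => ?_
    rw [hψ.fderiv_eq_zero hx]; simp
  have h2 : ∫ x in D, fderiv ℝ φ x v * ψ x = ∫ x, fderiv ℝ φ x v * ψ x := by
    refine setIntegral_eq_integral_of_forall_compl_eq_zero fun x hx => ?_
    rw [hψ.eq_zero hx, mul_zero]
  rw [h1, h2]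
  have c1 : Continuous fun x => fderiv ℝ φ x v := hφ.continuous_fderiv.clm_apply continuous_const
  have c2 : Continuous fun x => fderiv ℝ ψ x v := hψ.continuous_fderiv.clm_apply continuous_const
  refine integral_mul_fderiv_eq_neg_fderiv_mul_of_integrable ?_ ?_ ?_
    (fun x _ => hφ.differentiable x) (fun x _ => hψ.differentiable x)
  · exact (c1.mul hψ.continuous).integrable_of_hasCompactSupport hψ.2.1.mul_left
  · exact (hφ.continuous.mul c2).integrable_of_hasCompactSupport hφ.2.1.mul_right
  · exact (hφ.continuous.mul hψ.continuous).integrable_of_hasCompactSupport hψ.2.1.mul_left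

/-- Integration by parts against a fixed test function is stable under `L²(μ)` limits of the
functions and of their gradients. -/
lemma IsWeight.hasWeakFDeriv_of_tendsto (hμ : IsWeight μ D) {U : Set X} {φ : ℕ → X → ℝ}
    (hφ : ∀ k, IsTest U (φ k)) {w : X → ℝ} {G : X → X →L[ℝ] ℝ} (hw : MemLp w 2 μ)
    (hG : MemLp G 2 μ) (h1 : Tendsto (fun k => eLpNorm (φ k - w) 2 μ) atTop (𝓝 0))
    (h2 : Tendsto (fun k => eLpNorm (fderiv ℝ (φ k) - G) 2 μ) atTop (𝓝 0)) :
    HasWeakFDeriv D w G := by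
  have := hμ.fin
  refine ⟨hμ.locallyIntegrableOn hw, hμ.locallyIntegrableOn hG, fun ψ hψ v => ?_⟩
  have c2 : Continuous fun x => fderiv ℝ ψ x v := hψ.continuous_fderiv.clm_apply continuous_const
  have hc2 : HasCompactSupport fun x => fderiv ℝ ψ x v :=
    (hψ.2.1.fderiv ℝ).comp_left (g := fun L : X →L[ℝ] ℝ => L v) (by simp)
  have ht2 : tsupport (fun x => fderiv ℝ ψ x v) ⊆ D := by
    refine (closure_mono ?_).trans ((tsupport_fderiv_subset ℝ).trans hψ.2.2)
    intro x hx h0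
    exact hx (by simp [h0])
  have l1 := hμ.tendsto_integral_mul (fun k => (hφ k).memLp 2) hw h1 c2 hc2 ht2
  have ev : ∀ {u : X → X →L[ℝ] ℝ}, MemLp u 2 μ → MemLp (fun x => u x v) 2 μ := fun hu =>
    (ContinuousLinearMap.apply ℝ ℝ v).comp_memLp' hu
  have l2 := hμ.tendsto_integral_mul (f := fun k x => fderiv ℝ (φ k) x v) (g := fun x => G x v)
    (fun k => ev ((hφ k).memLp_fderiv 2)) (ev hG) (by
      have hlim := ENNReal.Tendsto.const_mul (a := ENNReal.ofReal ‖v‖) h2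
        (Or.inr ENNReal.ofReal_ne_top)
      rw [mul_zero] at hlim
      refine tendsto_of_tendsto_of_tendsto_of_le_of_le tendsto_const_nhds hlim
        (fun _ => zero_le) (fun k => eLpNorm_le_mul_eLpNorm_of_ae_le_mul (.of_forall fun x => ?_) 2)
      have := (fderiv ℝ (φ k) x - G x).le_opNorm v
      simpa [mul_comm] using this) hψ.continuous hψ.2.1 hψ.2.2
  refine tendsto_nhds_unique l1 ?_
  simp_rw [fun k => (hφ k).hasWeakFDeriv hψ v]
  exact l2.neg

/-- The fundamental lemma of the calculus of variations, applied to the difference in one direction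
at a time; finitely many basis directions suffice, so the null sets can be united. -/
lemma HasWeakFDeriv.ae_eq (hD : IsOpen D) {w : X → ℝ} {G G' : X → X →L[ℝ] ℝ}
    (h : HasWeakFDeriv D w G) (h' : HasWeakFDeriv D w G') : G =ᵐ[volume.restrict D] G' := by
  have key : ∀ v : X, ∀ᵐ x ∂(volume : Measure X), x ∈ D → G x v - G' x v = 0 := by
    intro v
    have loc : ∀ {u : X → X →L[ℝ] ℝ}, LocallyIntegrableOn u D →
        LocallyIntegrableOn (fun x => u x v) D := by
      intro u hu x hx
      obtain ⟨s, hs, hi⟩ := hu x hx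
      exact ⟨s, hs, (ContinuousLinearMap.apply ℝ ℝ v).integrable_comp hi⟩
    refine hD.ae_eq_zero_of_integral_contDiff_smul_eq_zero ((loc h.2.1).sub (loc h'.2.1)) ?_
    intro g hg hgc hgD
    have ht : IsTest D g := ⟨hg, hgc, hgD⟩
    have e1 := h.2.2 g ht v
    have e2 := h'.2.2 g ht v
    have hint : ∀ {u : X → X →L[ℝ] ℝ}, LocallyIntegrableOn u D →
        IntegrableOn (fun x => u x v * g x) D := by
      intro u hu
      have hK : IntegrableOn (fun x => u x v * g x) (tsupport g) :=
        ((locallyIntegrableOn_iff hD.isLocallyClosed).1 (loc hu) _ hgD hgc).mul_continuousOn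
          hg.continuous.continuousOn hgc
      refine hK.of_forall_sdiff_eq_zero hD.measurableSet fun x hx => ?_
      rw [image_eq_zero_of_notMem_tsupport hx.2, mul_zero]
    have e3 : ∫ x in D, (G x v * g x - G' x v * g x) = 0 := by
      rw [integral_sub (hint h.2.1) (hint h'.2.1)]
      linarith
    rw [← setIntegral_eq_integral_of_forall_compl_eq_zero (s := D)]
    · rw [← e3]
      congr 1
      ext x
      simp only [smul_eq_mul]
      ring
    · intro x hx
      rw [ht.eq_zero hx, zero_smul]
  let b := Module.finBasis ℝ X
  have hall : ∀ᵐ x ∂(volume : Measure X), ∀ i, x ∈ D → G x (b i) - G' x (b i) = 0 :=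
    ae_all_iff.2 fun i => key (b i)
  rw [EventuallyEq, ae_restrict_iff' hD.measurableSet]
  filter_upwards [hall] with x hx hxD
  have : (G x : X →ₗ[ℝ] ℝ) = G' x := b.ext fun i => sub_eq_zero.1 (hx i hxD)
  exact ContinuousLinearMap.coe_injective this

lemma HasWeakFDeriv.weakFDeriv_ae_eq (hD : IsOpen D) {w : X → ℝ} {G : X → X →L[ℝ] ℝ}
    (h : HasWeakFDeriv D w G) : weakFDeriv D w =ᵐ[volume.restrict D] G := by
  have hex : ∃ G, HasWeakFDeriv D w G := ⟨G, h⟩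
  unfold weakFDeriv
  rw [dif_pos hex]
  exact hex.choose_spec.ae_eq hD h

/-- The test functions `φ k` converge to `w` in `L²(μ)` and their gradients converge to `G`. -/
def TendstoPair (μ : Measure X) (φ : ℕ → X → ℝ) (w : Lp ℝ 2 μ) (G : Lp (X →L[ℝ] ℝ) 2 μ) : Prop :=
  Tendsto (fun k => eLpNorm (φ k - ⇑w) 2 μ) atTop (𝓝 0) ∧
    Tendsto (fun k => eLpNorm (fderiv ℝ (φ k) - ⇑G) 2 μ) atTop (𝓝 0)

lemma TendstoPair.weakFDeriv_ae_eq (hμ : IsWeight μ D) {U : Set X} {φ : ℕ → X → ℝ}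
    (hφ : ∀ k, IsTest U (φ k)) {w : Lp ℝ 2 μ} {G : Lp (X →L[ℝ] ℝ) 2 μ}
    (h : TendstoPair μ φ w G) : weakFDeriv D w =ᵐ[μ] G :=
  hμ.ac.ae_le ((hμ.hasWeakFDeriv_of_tendsto hφ (Lp.memLp w) (Lp.memLp G) h.1 h.2).weakFDeriv_ae_eq
    hμ.isOpen)

/-- `H1Tendsto` refers to the weak derivative picked by choice, whereas `TendstoPair` carries the
limit gradient as an element of `Lp`. They agree since the limit gradient is a weak gradient, which
is unique almost everywhere. -/
lemma TendstoPair.h1Tendsto (hμ : IsWeight μ D) {U : Set X} {φ : ℕ → X → ℝ}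
    (hφ : ∀ k, IsTest U (φ k)) {w : Lp ℝ 2 μ} {G : Lp (X →L[ℝ] ℝ) 2 μ}
    (h : TendstoPair μ φ w G) : H1Tendsto μ D φ w := by
  refine ⟨h.1, ?_⟩
  have h2 := h.2
  refine h2.congr fun k => eLpNorm_congr_ae ?_
  filter_upwards [h.weakFDeriv_ae_eq hμ hφ] with x hx
  simp [hx]

lemma TendstoPair.mem_h1Closure (hμ : IsWeight μ D) {U : Set X} {φ : ℕ → X → ℝ}
    (hφ : ∀ k, IsTest U (φ k)) {w : Lp ℝ 2 μ} {G : Lp (X →L[ℝ] ℝ) 2 μ}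
    (h : TendstoPair μ φ w G) : w ∈ H1Closure μ D U :=
  ⟨⟨⟨G, hμ.hasWeakFDeriv_of_tendsto hφ (Lp.memLp w) (Lp.memLp G) h.1 h.2⟩,
    (Lp.memLp G).ae_eq (h.weakFDeriv_ae_eq hμ hφ).symm⟩, φ, hφ, h.h1Tendsto hμ hφ⟩

lemma H1Tendsto.tendstoPair {φ : ℕ → X → ℝ} {w : Lp ℝ 2 μ} (hw : w ∈ H1 μ D)
    (h : H1Tendsto μ D φ w) : TendstoPair μ φ w (hw.2.toLp _) := by
  refine ⟨h.1, ?_⟩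
  have h2 := h.2
  refine h2.congr fun k => eLpNorm_congr_ae ?_
  filter_upwards [hw.2.coeFn_toLp] with x hx
  simp [hx]

lemma tendstoPair_iff {ι : Type*} {μ : Measure X} {p : ι → Lp ℝ 2 μ} {φ : ι → X → ℝ}
    {w : Lp ℝ 2 μ} (h : ∀ k, p k =ᵐ[μ] φ k) {l : Filter ι} :
    Tendsto p l (𝓝 w) ↔ Tendsto (fun k => eLpNorm (φ k - ⇑w) 2 μ) l (𝓝 0) := by
  rw [Lp.tendsto_Lp_iff_tendsto_eLpNorm']
  refine tendsto_congr fun k => eLpNorm_congr_ae ?_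
  exact (h k).sub (EventuallyEq.refl _ _)

end Weak

/-! ### The energy form on pairs `(w, ∇ w)` -/

section Energy

variable {X : Type*} [NormedAddCommGroup X] [NormedSpace ℝ X] [MeasurableSpace X]
  {n : ℕ}

/-- The coefficients of an energy: directions `b i`, `b₀`, a matrix field `m` and a potential `c`
on the space `X` with measure `μ`. -/
structure IsCoeff (μ : Measure X) (m : X → Matrix (Fin n) (Fin n) ℝ) (c : X → ℝ) (C : ℝ) :
    Prop where
  nonneg : 0 ≤ C
  meas : ∀ i j, AEStronglyMeasurable (fun x => m x i j) μ
  bound : ∀ᵐ x ∂μ, ∀ i j, ‖m x i j‖ ≤ C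
  symm : ∀ᵐ x ∂μ, ∀ i j, m x i j = m x j i
  pos : ∀ᵐ x ∂μ, ∀ ξ : Fin n → ℝ, 0 ≤ ∑ i, ∑ j, m x i j * ξ j * ξ i
  measc : AEStronglyMeasurable c μ
  boundc : ∀ᵐ x ∂μ, ‖c x‖ ≤ C
  posc : ∀ᵐ x ∂μ, 0 ≤ c x

/-- The integrand of the energy form. -/
def density (b : Fin n → X) (b₀ : X) (m : Matrix (Fin n) (Fin n) ℝ) (c : ℝ)
    (w : ℝ) (G : X →L[ℝ] ℝ) (w' : ℝ) (G' : X →L[ℝ] ℝ) : ℝ :=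
  (∑ i, ∑ j, m i j * G (b j) * G' (b i)) + G b₀ * G' b₀ + c * w * w'

lemma density_add_left (b : Fin n → X) (b₀ : X) (m : Matrix (Fin n) (Fin n) ℝ) (c : ℝ)
    (w v w' : ℝ) (G H G' : X →L[ℝ] ℝ) :
    density b b₀ m c (w + v) (G + H) w' G'
      = density b b₀ m c w G w' G' + density b b₀ m c v H w' G' := by
  simp only [density, add_apply, mul_add, add_mul, Finset.sum_add_distrib]
  ring

lemma density_smul_left (b : Fin n → X) (b₀ : X) (m : Matrix (Fin n) (Fin n) ℝ) (c : ℝ)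
    (r w w' : ℝ) (G G' : X →L[ℝ] ℝ) :
    density b b₀ m c (r • w) (r • G) w' G' = r • density b b₀ m c w G w' G' := by
  simp only [density, smul_apply, smul_eq_mul, mul_add, Finset.mul_sum]
  congr 1
  · congr 1
    · refine Finset.sum_congr rfl fun i _ => Finset.sum_congr rfl fun j _ => ?_
      ring
    · ring
  · ring

lemma density_symm (b : Fin n → X) (b₀ : X) {m : Matrix (Fin n) (Fin n) ℝ}
    (hm : ∀ i j, m i j = m j i) (c : ℝ) (w w' : ℝ) (G G' : X →L[ℝ] ℝ) :
    density b b₀ m c w G w' G' = density b b₀ m c w' G' w G := by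
  simp only [density]
  rw [Finset.sum_comm]
  congr 1
  · congr 1
    · refine Finset.sum_congr rfl fun i _ => Finset.sum_congr rfl fun j _ => ?_
      rw [hm j i]
      ring
    · ring
  · ring

lemma density_nonneg (b : Fin n → X) (b₀ : X) {m : Matrix (Fin n) (Fin n) ℝ} {c : ℝ}
    (hm : ∀ ξ : Fin n → ℝ, 0 ≤ ∑ i, ∑ j, m i j * ξ j * ξ i) (hc : 0 ≤ c) (w : ℝ)
    (G : X →L[ℝ] ℝ) : 0 ≤ density b b₀ m c w G w G := by
  unfold density
  have h1 : 0 ≤ ∑ i, ∑ j, m i j * G (b j) * G (b i) := hm fun i => G (b i)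
  have h2 := mul_self_nonneg (G b₀)
  have h3 := mul_nonneg hc (mul_self_nonneg w)
  rw [← mul_assoc] at h3
  linarith

/-- The `n²` matrix terms contribute `C B²` each, the extra direction `B²`, and the potential `C`.
-/
lemma abs_density_le (b : Fin n → X) (b₀ : X) {m : Matrix (Fin n) (Fin n) ℝ} {c C B : ℝ}
    (hC : 0 ≤ C) (hm : ∀ i j, ‖m i j‖ ≤ C) (hc : ‖c‖ ≤ C) (hb : ∀ i, ‖b i‖ ≤ B)
    (hb₀ : ‖b₀‖ ≤ B) (w w' : ℝ) (G G' : X →L[ℝ] ℝ) :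
    |density b b₀ m c w G w' G'|
      ≤ ((n ^ 2 * C + 1) * B ^ 2 + C) * (‖G‖ * ‖G'‖ + ‖w‖ * ‖w'‖) := by
  have hB : 0 ≤ B := (norm_nonneg _).trans hb₀
  have hG : ∀ (L : X →L[ℝ] ℝ) {v : X}, ‖v‖ ≤ B → ‖L v‖ ≤ ‖L‖ * B := fun L v hv =>
    (L.le_opNorm v).trans (by gcongr)
  have h1 : ∀ i j, ‖m i j * G (b j) * G' (b i)‖ ≤ C * (‖G‖ * B) * (‖G'‖ * B) := by
    intro i j
    rw [norm_mul, norm_mul]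
    gcongr
    · exact hm i j
    · exact hG _ (hb j)
    · exact hG _ (hb i)
  have h2 : ‖∑ i, ∑ j, m i j * G (b j) * G' (b i)‖ ≤ n ^ 2 * (C * (‖G‖ * B) * (‖G'‖ * B)) := by
    refine (norm_sum_le_of_le _ fun i _ => norm_sum_le_of_le _ fun j _ => h1 i j).trans ?_
    simp only [Finset.sum_const, Finset.card_univ, Fintype.card_fin, nsmul_eq_mul]
    rw [← mul_assoc]
    ring_nf
    rfl
  have h3 : ‖G b₀ * G' b₀‖ ≤ (‖G‖ * B) * (‖G'‖ * B) := by
    rw [norm_mul]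
    gcongr
    · exact hG _ hb₀
    · exact hG _ hb₀
  have h4 : ‖c * w * w'‖ ≤ C * ‖w‖ * ‖w'‖ := by
    rw [norm_mul, norm_mul]
    gcongr
  have h5 := norm_add₃_le (a := ∑ i, ∑ j, m i j * G (b j) * G' (b i)) (b := G b₀ * G' b₀)
    (c := c * w * w')
  rw [Real.norm_eq_abs] at h5
  unfold density
  have h6 : 0 ≤ C * (‖G‖ * ‖G'‖) := by positivity
  have h7 : 0 ≤ (n ^ 2 * C + 1) * B ^ 2 * (‖w‖ * ‖w'‖) := by positivity
  nlinarith

variable {μ : Measure X} {m : X → Matrix (Fin n) (Fin n) ℝ} {c : X → ℝ} {C : ℝ}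

lemma IsCoeff.integrable (h : IsCoeff μ m c C) (b : Fin n → X) (b₀ : X) {w w' : X → ℝ}
    {G G' : X → X →L[ℝ] ℝ} (hw : MemLp w 2 μ) (hG : MemLp G 2 μ) (hw' : MemLp w' 2 μ)
    (hG' : MemLp G' 2 μ) :
    Integrable (fun x => density b b₀ (m x) (c x) (w x) (G x) (w' x) (G' x)) μ := by
  have ev : ∀ {u : X → X →L[ℝ] ℝ} (v : X), MemLp u 2 μ → MemLp (fun x => u x v) 2 μ := fun v hu =>
    (ContinuousLinearMap.apply ℝ ℝ v).comp_memLp' hu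
  have mul3 : ∀ {k u v : X → ℝ}, AEStronglyMeasurable k μ → (∀ᵐ x ∂μ, ‖k x‖ ≤ C) →
      MemLp u 2 μ → MemLp v 2 μ → Integrable (fun x => k x * u x * v x) μ := by
    intro k u v hk hkC hu hv
    have := (hu.integrable_mul hv).bdd_mul hk hkC
    refine this.congr (.of_forall fun x => ?_)
    simp [mul_assoc]
  refine Integrable.add (Integrable.add ?_ ?_) ?_
  · refine integrable_finsetSum _ fun i _ => integrable_finsetSum _ fun j _ => ?_
    exact mul3 (h.meas i j) (h.bound.mono fun x hx => hx i j) (ev _ hG) (ev _ hG')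
  · exact (ev _ hG).integrable_mul (ev _ hG')
  · exact mul3 h.measc h.boundc hw hw'

/-- The energy form on pairs `(w, ∇ w)`. -/
def energy (h : IsCoeff μ m c C) (b : Fin n → X) (b₀ : X) :
    (Lp ℝ 2 μ × Lp (X →L[ℝ] ℝ) 2 μ) →ₗ[ℝ] (Lp ℝ 2 μ × Lp (X →L[ℝ] ℝ) 2 μ) →ₗ[ℝ] ℝ :=
  have hadd : ∀ p q r : Lp ℝ 2 μ × Lp (X →L[ℝ] ℝ) 2 μ,
      ∫ x, density b b₀ (m x) (c x) ((p + q).1 x) ((p + q).2 x) (r.1 x) (r.2 x) ∂μ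
        = ∫ x, density b b₀ (m x) (c x) (p.1 x) (p.2 x) (r.1 x) (r.2 x) ∂μ
          + ∫ x, density b b₀ (m x) (c x) (q.1 x) (q.2 x) (r.1 x) (r.2 x) ∂μ := by
    intro p q r
    rw [← integral_add (h.integrable b b₀ (Lp.memLp _) (Lp.memLp _) (Lp.memLp _) (Lp.memLp _))
      (h.integrable b b₀ (Lp.memLp _) (Lp.memLp _) (Lp.memLp _) (Lp.memLp _))]
    refine integral_congr_ae ?_
    filter_upwards [Lp.coeFn_add p.1 q.1, Lp.coeFn_add p.2 q.2] with x h1 h2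
    rw [← density_add_left, Prod.fst_add, Prod.snd_add, h1, h2]
    rfl
  have hsmul : ∀ (t : ℝ) (p r : Lp ℝ 2 μ × Lp (X →L[ℝ] ℝ) 2 μ),
      ∫ x, density b b₀ (m x) (c x) ((t • p).1 x) ((t • p).2 x) (r.1 x) (r.2 x) ∂μ
        = t • ∫ x, density b b₀ (m x) (c x) (p.1 x) (p.2 x) (r.1 x) (r.2 x) ∂μ := by
    intro t p r
    rw [← integral_smul]
    refine integral_congr_ae ?_
    filter_upwards [Lp.coeFn_smul t p.1, Lp.coeFn_smul t p.2] with x h1 h2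
    rw [← density_smul_left, Prod.smul_fst, Prod.smul_snd, h1, h2]
    rfl
  have hsymm : ∀ (p r : Lp ℝ 2 μ × Lp (X →L[ℝ] ℝ) 2 μ),
      ∫ x, density b b₀ (m x) (c x) (p.1 x) (p.2 x) (r.1 x) (r.2 x) ∂μ
        = ∫ x, density b b₀ (m x) (c x) (r.1 x) (r.2 x) (p.1 x) (p.2 x) ∂μ := by
    intro p r
    refine integral_congr_ae ?_
    filter_upwards [h.symm] with x hx
    exact density_symm b b₀ hx _ _ _ _ _
  LinearMap.mk₂ ℝ
    (fun p q => ∫ x, density b b₀ (m x) (c x) (p.1 x) (p.2 x) (q.1 x) (q.2 x) ∂μ)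
    hadd hsmul
    (fun p q r => by rw [hsymm, hadd, hsymm q, hsymm r])
    (fun t p q => by rw [hsymm, hsmul, hsymm q])

lemma energy_apply (h : IsCoeff μ m c C) (b : Fin n → X) (b₀ : X)
    (p q : Lp ℝ 2 μ × Lp (X →L[ℝ] ℝ) 2 μ) :
    energy h b b₀ p q
      = ∫ x, density b b₀ (m x) (c x) (p.1 x) (p.2 x) (q.1 x) (q.2 x) ∂μ := rfl

lemma energy_symm (h : IsCoeff μ m c C) (b : Fin n → X) (b₀ : X)
    (p q : Lp ℝ 2 μ × Lp (X →L[ℝ] ℝ) 2 μ) : energy h b b₀ p q = energy h b b₀ q p := by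
  refine integral_congr_ae ?_
  filter_upwards [h.symm] with x hx
  exact density_symm b b₀ hx _ _ _ _ _

lemma energy_nonneg (h : IsCoeff μ m c C) (b : Fin n → X) (b₀ : X)
    (p : Lp ℝ 2 μ × Lp (X →L[ℝ] ℝ) 2 μ) : 0 ≤ energy h b b₀ p p := by
  refine integral_nonneg_of_ae ?_
  filter_upwards [h.pos, h.posc] with x hx hx'
  exact density_nonneg b b₀ hx hx' _ _

lemma norm_sq_eq_integral {α F : Type*} [MeasurableSpace α] {μ : Measure α}
    [NormedAddCommGroup F] (u : Lp F 2 μ) :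
    ‖u‖ ^ 2 = ∫ x, ‖u x‖ ^ 2 ∂μ := by
  have h1 := (Lp.memLp u).eLpNorm_eq_integral_rpow_norm (by norm_num) (by norm_num)
  have h0 : 0 ≤ ∫ x, ‖u x‖ ^ 2 ∂μ := integral_nonneg fun x => by positivity
  rw [Lp.norm_def, h1, ENNReal.toReal_ofReal (by positivity)]
  simp only [ENNReal.toReal_ofNat, Real.rpow_ofNat]
  rw [← Real.rpow_natCast, ← Real.rpow_mul h0]
  norm_num

lemma integrable_norm_sq {α F : Type*} [MeasurableSpace α] {μ : Measure α}
    [NormedAddCommGroup F] {u : α → F} (hu : MemLp u 2 μ) :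
    Integrable (fun x => ‖u x‖ ^ 2) μ := by
  simpa using hu.integrable_norm_rpow (by norm_num) (by norm_num)

lemma energy_le (h : IsCoeff μ m c C) (b : Fin n → X) (b₀ : X) {B : ℝ} (hb : ∀ i, ‖b i‖ ≤ B)
    (hb₀ : ‖b₀‖ ≤ B) (p : Lp ℝ 2 μ × Lp (X →L[ℝ] ℝ) 2 μ) :
    energy h b b₀ p p ≤ ((n ^ 2 * C + 1) * B ^ 2 + C) * (‖p.1‖ ^ 2 + ‖p.2‖ ^ 2) := by
  rw [norm_sq_eq_integral, norm_sq_eq_integral, ← integral_add (integrable_norm_sq (Lp.memLp _))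
    (integrable_norm_sq (Lp.memLp _)), ← integral_const_mul, energy_apply]
  refine integral_mono_ae
    (h.integrable b b₀ (Lp.memLp _) (Lp.memLp _) (Lp.memLp _) (Lp.memLp _))
    (((integrable_norm_sq (Lp.memLp _)).add (integrable_norm_sq (Lp.memLp _))).const_mul _) ?_
  filter_upwards [h.bound, h.boundc] with x hx hx'
  refine (le_abs_self _).trans ((abs_density_le b b₀ h.nonneg hx hx' hb hb₀ _ _ _ _).trans ?_)
  rw [add_comm (‖p.1 x‖ ^ 2), pow_two ‖p.2 x‖, pow_two ‖p.1 x‖]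

end Energy

/-! ### One-dimensional inequalities -/

section OneDim

/-- Again the discriminant argument, now for `t ↦ ∫ (u + t v)²`. -/
lemma sq_integral_mul_le {α : Type*} [MeasurableSpace α] {μ : Measure α} {u v : α → ℝ}
    (hu : Integrable (fun x => u x ^ 2) μ) (hv : Integrable (fun x => v x ^ 2) μ)
    (huv : Integrable (fun x => u x * v x) μ) :
    (∫ x, u x * v x ∂μ) ^ 2 ≤ (∫ x, u x ^ 2 ∂μ) * ∫ x, v x ^ 2 ∂μ := by
  have key : ∀ t : ℝ, 0 ≤ (∫ x, v x ^ 2 ∂μ) * (t * t) + (2 * ∫ x, u x * v x ∂μ) * t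
      + ∫ x, u x ^ 2 ∂μ := by
    intro t
    have h1 : ∫ x, (u x + t * v x) ^ 2 ∂μ = (∫ x, v x ^ 2 ∂μ) * (t * t)
        + (2 * ∫ x, u x * v x ∂μ) * t + ∫ x, u x ^ 2 ∂μ := by
      have h2 : ∀ x, (u x + t * v x) ^ 2 = u x ^ 2 + ((2 * t) * (u x * v x) + t ^ 2 * v x ^ 2) :=
        fun x => by ring
      simp_rw [h2]
      have i1 := huv.const_mul (2 * t)
      have i2 := hv.const_mul (t ^ 2)
      have i3 : Integrable (fun x => (2 * t) * (u x * v x) + t ^ 2 * v x ^ 2) μ := i1.add i2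
      rw [integral_add hu i3, integral_add i1 i2, integral_const_mul, integral_const_mul]
      ring
    rw [← h1]
    exact integral_nonneg fun x => sq_nonneg _
  have := discrim_le_zero key
  unfold discrim at this
  nlinarith

/-- The weight is integrable at `0` because `1 - 2 s > -1`. -/
lemma integrableOn_rpow_mul {s : ℝ} (hs : s < 1) {g : ℝ → ℝ} (hg : Continuous g)
    (hgc : HasCompactSupport g) : IntegrableOn (fun y => y ^ (1 - 2 * s) * g y) (Ioi 0) := by
  obtain ⟨R, hR⟩ := hgc.isCompact.isBounded.subset_closedBall 0
  have h1 : IntegrableOn (fun y : ℝ => y ^ (1 - 2 * s) * g y) (Ioc 0 (max R 0)) := by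
    have h2 := intervalIntegral.intervalIntegrable_rpow' (a := 0) (b := max R 0)
      (show -1 < 1 - 2 * s by linarith)
    rw [intervalIntegrable_iff_integrableOn_Ioc_of_le (le_max_right _ _)] at h2
    obtain ⟨C, hC⟩ := hgc.exists_bound_of_continuous hg
    exact h2.mul_bdd hg.aestronglyMeasurable (.of_forall hC)
  refine h1.of_forall_sdiff_eq_zero measurableSet_Ioi fun y hy => ?_
  have hy2 : R < y := by
    by_contra hle
    exact hy.2 ⟨hy.1, (not_lt.1 hle).trans (le_max_left _ _)⟩
  rw [image_eq_zero_of_notMem_tsupport (f := g), mul_zero]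
  intro hmem
  have := hR hmem
  rw [mem_closedBall_zero_iff] at this
  linarith [le_abs_self y, Real.norm_eq_abs y]

/-- Write `g y - g 0 = ∫ t^(s - 1/2) · t^(1/2 - s) g'` over `(0, y)`. Cauchy–Schwarz gives `(g y - g
0)² ≤ y^(2s) / (2s) · D`, with `D` the weighted integral of `g'²`. Insert this into `g(0)² ≤ 2 g(y)²
+ 2 (g(y) - g(0))²`, multiply by the weight and integrate over `(0, R)`. The length `R` stays free
for a later optimisation. -/
lemma trace_sq_le {s : ℝ} (hs : s ∈ Ioo (0 : ℝ) 1) {g g' : ℝ → ℝ} (hg : ∀ t, HasDerivAt g (g' t) t)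
    (hg' : Continuous g') (hgc : HasCompactSupport g) (hgc' : HasCompactSupport g') {R : ℝ}
    (hR : 0 < R) :
    g 0 ^ 2 * (R ^ (2 - 2 * s) / (2 - 2 * s)) ≤ 2 * (∫ y in Ioi 0, y ^ (1 - 2 * s) * g y ^ 2)
      + R ^ 2 / (2 * s) * ∫ y in Ioi 0, y ^ (1 - 2 * s) * g' y ^ 2 := by
  obtain ⟨hs0, hs1⟩ := hs
  have hgcont : Continuous g := continuous_iff_continuousAt.2 fun t => (hg t).continuousAt
  set N := ∫ y in Ioi 0, y ^ (1 - 2 * s) * g y ^ 2 with hN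
  set D := ∫ y in Ioi 0, y ^ (1 - 2 * s) * g' y ^ 2 with hD
  have iN : IntegrableOn (fun y => y ^ (1 - 2 * s) * g y ^ 2) (Ioi 0) := by
    refine integrableOn_rpow_mul hs1 (hgcont.pow 2) ?_
    exact hgc.comp_left (g := fun x : ℝ => x ^ 2) (by simp)
  have iD : IntegrableOn (fun y => y ^ (1 - 2 * s) * g' y ^ 2) (Ioi 0) := by
    refine integrableOn_rpow_mul hs1 (hg'.pow 2) ?_
    exact hgc'.comp_left (g := fun x : ℝ => x ^ 2) (by simp)
  have hpt : ∀ y, 0 < y → (g y - g 0) ^ 2 ≤ y ^ (2 * s) / (2 * s) * D := by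
    intro y hy
    have h1 : ∫ t in (0 : ℝ)..y, g' t = g y - g 0 :=
      intervalIntegral.integral_eq_sub_of_hasDerivAt (fun t _ => hg t) (hg'.intervalIntegrable _ _)
    rw [intervalIntegral.integral_of_le hy.le] at h1
    have e1 : ∀ t ∈ Ioc 0 y, (t ^ (s - 1 / 2)) ^ 2 = t ^ (2 * s - 1) := by
      intro t ht
      rw [← Real.rpow_natCast, ← Real.rpow_mul ht.1.le]
      congr 1
      push_cast
      ring
    have e2 : ∀ t ∈ Ioc 0 y, (t ^ (1 / 2 - s) * g' t) ^ 2 = t ^ (1 - 2 * s) * g' t ^ 2 := by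
      intro t ht
      rw [mul_pow, ← Real.rpow_natCast, ← Real.rpow_mul ht.1.le]
      congr 2
      push_cast
      ring
    have e3 : ∀ t ∈ Ioc 0 y, t ^ (s - 1 / 2) * (t ^ (1 / 2 - s) * g' t) = g' t := by
      intro t ht
      rw [← mul_assoc, ← Real.rpow_add ht.1]
      simp
    have i1 : IntegrableOn (fun t : ℝ => t ^ (2 * s - 1)) (Ioc 0 y) := by
      have h2 := intervalIntegral.intervalIntegrable_rpow' (a := 0) (b := y)
        (show -1 < 2 * s - 1 by linarith)
      rwa [intervalIntegrable_iff_integrableOn_Ioc_of_le hy.le] at h2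
    have i2 : IntegrableOn (fun t : ℝ => t ^ (1 - 2 * s) * g' t ^ 2) (Ioc 0 y) :=
      iD.mono_set Ioc_subset_Ioi_self
    have i3 : IntegrableOn g' (Ioc 0 y) := hg'.integrableOn_Ioc
    have cs := sq_integral_mul_le (μ := volume.restrict (Ioc 0 y))
      (u := fun t => t ^ (s - 1 / 2)) (v := fun t => t ^ (1 / 2 - s) * g' t)
      ((integrableOn_congr_fun e1 measurableSet_Ioc).2 i1)
      ((integrableOn_congr_fun e2 measurableSet_Ioc).2 i2)
      ((integrableOn_congr_fun e3 measurableSet_Ioc).2 i3)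
    rw [setIntegral_congr_fun measurableSet_Ioc e1, setIntegral_congr_fun measurableSet_Ioc e2,
      setIntegral_congr_fun measurableSet_Ioc e3, h1, ← intervalIntegral.integral_of_le hy.le,
      integral_rpow (Or.inl (by linarith))] at cs
    have e4 : (2 * s - 1 + 1) = 2 * s := by ring
    rw [e4, Real.zero_rpow (by positivity), sub_zero] at cs
    refine cs.trans ?_
    gcongr
    exact setIntegral_mono_set iD (ae_restrict_of_forall_mem measurableSet_Ioi fun t (ht : 0 < t) =>
      by positivity) Ioc_subset_Ioi_self.eventuallyLE
  have hpt2 : ∀ y ∈ Ioc 0 R, y ^ (1 - 2 * s) * g 0 ^ 2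
      ≤ 2 * (y ^ (1 - 2 * s) * g y ^ 2) + y * (D / s) := by
    intro y hy
    have hy0 : 0 < y := hy.1
    have h1 := hpt y hy.1
    have h2 : g 0 ^ 2 ≤ 2 * g y ^ 2 + 2 * (g y - g 0) ^ 2 := by nlinarith [sq_nonneg (2 * g y - g 0)]
    have h3 : g 0 ^ 2 ≤ 2 * g y ^ 2 + 2 * (y ^ (2 * s) / (2 * s) * D) := by linarith
    calc _ ≤ y ^ (1 - 2 * s) * (2 * g y ^ 2 + 2 * (y ^ (2 * s) / (2 * s) * D)) := by gcongr
      _ = 2 * (y ^ (1 - 2 * s) * g y ^ 2) + (y ^ (1 - 2 * s) * y ^ (2 * s)) * (D / s) := by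
        field_simp
      _ = _ := by
        rw [← Real.rpow_add hy0]
        simp
  have i0 : IntegrableOn (fun y : ℝ => y ^ (1 - 2 * s)) (Ioc 0 R) := by
    have h2 := intervalIntegral.intervalIntegrable_rpow' (a := 0) (b := R)
      (show -1 < 1 - 2 * s by linarith)
    rwa [intervalIntegrable_iff_integrableOn_Ioc_of_le hR.le] at h2
  have iy : IntegrableOn (fun y : ℝ => y) (Ioc 0 R) := continuous_id.integrableOn_Ioc
  have iN' : IntegrableOn (fun y => y ^ (1 - 2 * s) * g y ^ 2) (Ioc 0 R) :=
    iN.mono_set Ioc_subset_Ioi_self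
  have hint := setIntegral_mono_on (i0.mul_const (g 0 ^ 2))
    ((iN'.const_mul 2).add (iy.mul_const (D / s))) measurableSet_Ioc hpt2
  simp only [Pi.add_apply] at hint
  rw [integral_add (iN'.const_mul 2) (iy.mul_const (D / s)), integral_mul_const, integral_mul_const,
    integral_const_mul, ← intervalIntegral.integral_of_le hR.le,
    ← intervalIntegral.integral_of_le (f := fun y : ℝ => y) hR.le,
    integral_rpow (Or.inl (by linarith)), integral_id] at hint
  have e4 : (1 - 2 * s + 1) = 2 - 2 * s := by ring
  rw [e4, Real.zero_rpow (by linarith), sub_zero] at hint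
  have hle : ∫ y in Ioc 0 R, y ^ (1 - 2 * s) * g y ^ 2 ≤ N :=
    setIntegral_mono_set iN (ae_restrict_of_forall_mem measurableSet_Ioi fun t (ht : 0 < t) =>
      by positivity) Ioc_subset_Ioi_self.eventuallyLE
  have e5 : (R ^ 2 - 0 ^ 2) / 2 * (D / s) = R ^ 2 / (2 * s) * D := by
    field_simp
    ring
  rw [e5] at hint
  linarith

/-- The weighted trace inequality in one dimension. -/
lemma rpow_mul_trace_sq_le {s : ℝ} (hs : s ∈ Ioo (0 : ℝ) 1) :
    ∃ C : ℝ, 0 ≤ C ∧ ∀ (g g' : ℝ → ℝ), (∀ t, HasDerivAt g (g' t) t) → Continuous g' →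
      HasCompactSupport g → HasCompactSupport g' → ∀ l : ℝ, 0 ≤ l →
        l ^ s * g 0 ^ 2 ≤ C * ∫ y in Ioi 0, y ^ (1 - 2 * s) * (l * g y ^ 2 + g' y ^ 2) := by
  have hs0 := hs.1
  have hs1 := hs.2
  have h2s : 0 < 2 - 2 * s := by linarith
  refine ⟨(2 - 2 * s) * (2 + 1 / (2 * s)), by positivity, ?_⟩
  intro g g' hg hg' hgc hgc' l hl
  have hgcont : Continuous g := continuous_iff_continuousAt.2 fun t => (hg t).continuousAt
  have iN : IntegrableOn (fun y => y ^ (1 - 2 * s) * g y ^ 2) (Ioi 0) := by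
    refine integrableOn_rpow_mul hs1 (hgcont.pow 2) ?_
    exact hgc.comp_left (g := fun x : ℝ => x ^ 2) (by simp)
  have iD : IntegrableOn (fun y => y ^ (1 - 2 * s) * g' y ^ 2) (Ioi 0) := by
    refine integrableOn_rpow_mul hs1 (hg'.pow 2) ?_
    exact hgc'.comp_left (g := fun x : ℝ => x ^ 2) (by simp)
  have hsplit : ∫ y in Ioi 0, y ^ (1 - 2 * s) * (l * g y ^ 2 + g' y ^ 2)
      = l * (∫ y in Ioi 0, y ^ (1 - 2 * s) * g y ^ 2)
        + ∫ y in Ioi 0, y ^ (1 - 2 * s) * g' y ^ 2 := by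
    rw [← integral_const_mul, ← integral_add (iN.const_mul l) iD]
    congr 1
    ext y
    ring
  rw [hsplit]
  have hN0 : 0 ≤ ∫ y in Ioi 0, y ^ (1 - 2 * s) * g y ^ 2 :=
    setIntegral_nonneg measurableSet_Ioi fun t (ht : 0 < t) => by positivity
  have hD0 : 0 ≤ ∫ y in Ioi 0, y ^ (1 - 2 * s) * g' y ^ 2 :=
    setIntegral_nonneg measurableSet_Ioi fun t (ht : 0 < t) => by positivity
  -- For `l = 0` the left side is zero since `s > 0`; the choice of `R` below needs `l > 0`.
  rcases hl.eq_or_lt with rfl | hl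
  · rw [Real.zero_rpow hs0.ne', zero_mul, zero_mul, zero_add]
    have : 0 ≤ (2 - 2 * s) * (2 + 1 / (2 * s)) := by positivity
    exact mul_nonneg this hD0
  -- With `R = l^(-1/2)` one has `R^(2 - 2s) = l^s / l` and `R² = 1 / l`; after multiplication by
  -- `(2 - 2s) l` the bound has the required form with a constant independent of `l`.
  have hR : 0 < l ^ (-(1 / 2) : ℝ) := by positivity
  have h1 := trace_sq_le hs hg hg' hgc hgc' hR
  set N := ∫ y in Ioi 0, y ^ (1 - 2 * s) * g y ^ 2
  set D := ∫ y in Ioi 0, y ^ (1 - 2 * s) * g' y ^ 2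
  have e1 : (l ^ (-(1 / 2) : ℝ)) ^ (2 - 2 * s) = l ^ s / l := by
    rw [← Real.rpow_mul hl.le, ← Real.rpow_sub_one hl.ne']
    congr 1
    ring
  have e2 : (l ^ (-(1 / 2) : ℝ)) ^ 2 = 1 / l := by
    rw [← Real.rpow_natCast, ← Real.rpow_mul hl.le, ← Real.rpow_neg_one l |>.trans (one_div l).symm]
    norm_num
  rw [e1, e2] at h1
  have h2 : l ^ s * g 0 ^ 2 = (2 - 2 * s) * l * (g 0 ^ 2 * (l ^ s / l / (2 - 2 * s))) := by
    field_simp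
  rw [h2]
  have h3 : (2 - 2 * s) * l * (g 0 ^ 2 * (l ^ s / l / (2 - 2 * s)))
      ≤ (2 - 2 * s) * l * (2 * N + 1 / l / (2 * s) * D) := by gcongr
  refine h3.trans ?_
  have h4 : (2 - 2 * s) * l * (2 * N + 1 / l / (2 * s) * D)
      = (2 - 2 * s) * (2 * (l * N) + 1 / (2 * s) * D) := by
    field_simp
  rw [h4, mul_assoc]
  gcongr
  have h5 : 0 ≤ 1 / (2 * s) * (l * N) := by positivity
  nlinarith

/-- A smooth approximation of the positive part. -/
lemma exists_smooth_posPart {ε : ℝ} (hε : 0 < ε) :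
    ∃ θ : ℝ → ℝ, ContDiff ℝ ∞ θ ∧ θ 0 = 0 ∧ (∀ t, |θ t - max t 0| ≤ ε) ∧ (∀ t, |θ t| ≤ |t|) ∧
      ∀ t, |deriv θ t| ≤ 1 := by
  have hpos : ∀ t : ℝ, 0 < t ^ 2 + ε ^ 2 := fun t => by positivity
  have hr1 : ∀ t : ℝ, |t| ≤ Real.sqrt (t ^ 2 + ε ^ 2) := fun t =>
    Real.abs_le_sqrt (by nlinarith)
  have hr2 : ∀ t : ℝ, Real.sqrt (t ^ 2 + ε ^ 2) ≤ |t| + ε := fun t => by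
    refine Real.sqrt_le_iff.2 ⟨by positivity, ?_⟩
    nlinarith [sq_abs t, abs_nonneg t]
  have hr3 : ∀ t : ℝ, ε ≤ Real.sqrt (t ^ 2 + ε ^ 2) := fun t =>
    Real.le_sqrt_of_sq_le (by nlinarith)
  -- Smooth the absolute value in `(|t| + t) / 2`. The term `-ε` makes the function vanish at `0`,
  -- so that composition with it preserves compact supports.
  refine ⟨fun t => (Real.sqrt (t ^ 2 + ε ^ 2) + t - ε) / 2, ?_, ?_, ?_, ?_, ?_⟩
  · exact ((((contDiff_id.pow 2).add contDiff_const).sqrt fun t => (hpos t).ne').add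
      contDiff_id |>.sub contDiff_const).div_const 2
  · simp [Real.sqrt_sq hε.le]
  · intro t
    have h1 : max t 0 = (|t| + t) / 2 := by
      rcases le_total 0 t with h | h
      · rw [max_eq_left h, abs_of_nonneg h]; ring
      · rw [max_eq_right h, abs_of_nonpos h]; ring
    rw [h1, abs_le]
    constructor <;> linarith [hr1 t, hr2 t]
  · intro t
    rw [abs_le]
    constructor <;> linarith [hr1 t, hr2 t, hr3 t, neg_abs_le t, le_abs_self t]
  · intro t
    have h1 : HasDerivAt (fun t => (Real.sqrt (t ^ 2 + ε ^ 2) + t - ε) / 2)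
        ((2 * t / (2 * Real.sqrt (t ^ 2 + ε ^ 2)) + 1) / 2) t := by
      have h2 : HasDerivAt (fun t : ℝ => t ^ 2 + ε ^ 2) (2 * t) t := by
        simpa using (hasDerivAt_pow 2 t).add_const (ε ^ 2)
      exact (((h2.sqrt (hpos t).ne').add (hasDerivAt_id t)).sub_const ε).div_const 2
    rw [h1.deriv]
    have h3 : 0 < Real.sqrt (t ^ 2 + ε ^ 2) := Real.sqrt_pos.2 (hpos t)
    have h4 : |2 * t / (2 * Real.sqrt (t ^ 2 + ε ^ 2))| ≤ 1 := by
      rw [mul_div_mul_left _ _ two_ne_zero, abs_div, abs_of_pos h3]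
      exact (div_le_one h3).2 (hr1 t)
    rw [abs_le] at h4 ⊢
    constructor <;> linarith [h4.1, h4.2]

/-- Smooth cutoff functions below a given height. -/
lemma exists_cutoff : ∃ C : ℝ, 0 ≤ C ∧ ∀ (τ δ : ℝ), 0 < δ → ∃ η : ℝ → ℝ, ContDiff ℝ ∞ η ∧
    (∀ y, |η y| ≤ 1) ∧ (∀ y, |1 - η y| ≤ 1) ∧ (∀ y ≤ τ - 2 * δ, η y = 1) ∧
    (∀ y, τ - δ ≤ y → η y = 0) ∧ ∀ y, |deriv η y| ≤ C / δ := by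
  have hc : Continuous (deriv Real.smoothTransition) :=
    (Real.smoothTransition.contDiff (n := 1)).continuous_deriv le_rfl
  obtain ⟨C, hC⟩ := isCompact_Icc.exists_bound_of_continuousOn (s := Icc (0 : ℝ) 1)
    hc.continuousOn
  have hC0 : 0 ≤ C := (norm_nonneg _).trans (hC 0 (by simp))
  -- The transition function is constant outside `[0, 1]`, so the bound on the compact interval is
  -- global. Rescaling by `δ` then costs exactly the factor `1 / δ`, with `C` independent of `τ` and
  -- `δ`.
  have hall : ∀ x, |deriv Real.smoothTransition x| ≤ C := by
    intro x
    by_cases h0 : x < 0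
    · have : Real.smoothTransition =ᶠ[𝓝 x] fun _ => 0 := by
        filter_upwards [Iio_mem_nhds h0] with y hy
        exact Real.smoothTransition.zero_of_nonpos (le_of_lt hy)
      rw [this.deriv_eq]
      simpa using hC0
    by_cases h1 : 1 < x
    · have : Real.smoothTransition =ᶠ[𝓝 x] fun _ => 1 := by
        filter_upwards [Ioi_mem_nhds h1] with y hy
        exact Real.smoothTransition.one_of_one_le (le_of_lt hy)
      rw [this.deriv_eq]
      simpa using hC0
    · exact hC x ⟨not_lt.1 h0, not_lt.1 h1⟩
  refine ⟨C, hC0, fun τ δ hδ => ⟨fun y => Real.smoothTransition ((τ - δ - y) / δ), ?_, ?_, ?_, ?_,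
    ?_, ?_⟩⟩
  · exact Real.smoothTransition.contDiff.comp
      ((contDiff_const.sub contDiff_id).div_const δ)
  · intro y
    rw [abs_of_nonneg (Real.smoothTransition.nonneg _)]
    exact Real.smoothTransition.le_one _
  · intro y
    have h1 := Real.smoothTransition.nonneg ((τ - δ - y) / δ)
    have h2 := Real.smoothTransition.le_one ((τ - δ - y) / δ)
    rw [abs_le]
    constructor <;> linarith
  · intro y hy
    refine Real.smoothTransition.one_of_one_le ?_
    rw [le_div_iff₀ hδ]
    linarith
  · intro y hy
    refine Real.smoothTransition.zero_of_nonpos ?_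
    exact div_nonpos_of_nonpos_of_nonneg (by linarith) hδ.le
  · intro y
    have h1 : HasDerivAt (fun y => (τ - δ - y) / δ) (-1 / δ) y := by
      simpa using ((hasDerivAt_id y).const_sub (τ - δ)).div_const δ
    have h2 : DifferentiableAt ℝ Real.smoothTransition ((τ - δ - y) / δ) :=
      (Real.smoothTransition.contDiff (n := 1)).differentiable (by simp) _
    have h3 := (h2.hasDerivAt.comp y h1).deriv
    change |deriv (Real.smoothTransition ∘ fun y => (τ - δ - y) / δ) y| ≤ _
    rw [h3, abs_mul, abs_div, abs_neg, abs_one, abs_of_pos hδ, mul_one_div]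
    gcongr
    exact hall _

end OneDim

/-! ### Translations -/

section Translation

variable {X : Type*} [NormedAddCommGroup X] [NormedSpace ℝ X] [MeasurableSpace X] [BorelSpace X]

/-- The fundamental theorem of calculus along the segment from `p` to `p + L v`, together with
Cauchy–Schwarz. -/
lemma sq_le_of_translate {φ : X → ℝ} (hφ : ContDiff ℝ 1 φ) (v p : X) {L : ℝ} (hL : 0 ≤ L) :
    φ p ^ 2 ≤ 2 * φ (p + L • v) ^ 2
      + 2 * L * ∫ t in Ioc 0 L, (fderiv ℝ φ (p + t • v) v) ^ 2 := by
  have hc : Continuous fun t : ℝ => fderiv ℝ φ (p + t • v) v :=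
    ((hφ.continuous_fderiv one_ne_zero).comp (by fun_prop)).clm_apply continuous_const
  have hd : ∀ t : ℝ, HasDerivAt (fun t : ℝ => φ (p + t • v)) (fderiv ℝ φ (p + t • v) v) t := by
    intro t
    have h1 : HasDerivAt (fun t : ℝ => p + t • v) v t := by
      simpa using ((hasDerivAt_id t).smul_const v).const_add p
    exact ((hφ.differentiable one_ne_zero _).hasFDerivAt).comp_hasDerivAt t h1
  have h1 := intervalIntegral.integral_eq_sub_of_hasDerivAt (a := 0) (b := L) (fun t _ => hd t)
    (hc.intervalIntegrable _ _)
  rw [intervalIntegral.integral_of_le hL, zero_smul, add_zero] at h1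
  have cs := sq_integral_mul_le (μ := volume.restrict (Ioc 0 L)) (u := fun _ => 1)
    (v := fun t => fderiv ℝ φ (p + t • v) v) (by simp)
    (hc.pow 2).integrableOn_Ioc (by simp only [one_mul]; exact hc.integrableOn_Ioc)
  simp only [one_mul, one_pow, integral_const, MeasurableSet.univ, measureReal_restrict_apply,
    univ_inter, smul_eq_mul, mul_one, Real.volume_real_Ioc_of_le hL, sub_zero, h1] at cs
  nlinarith [sq_nonneg (2 * φ (p + L • v) - φ p)]

/-- Integrate the pointwise bound over `S` and exchange the integrals. By translation invariance
each of the shifts contributes at most the integral over `S'`, and they have total length `L`. It is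
applied to horizontal shifts out of `Ω` (Poincaré) and to vertical shifts past the height `τ`. -/
lemma lintegral_sq_le_of_translate [SecondCountableTopology X] {ν : Measure X} [SFinite ν]
    {φ : X → ℝ} (hφ : ContDiff ℝ 1 φ)
    (v : X) {L : ℝ} (hL : 0 ≤ L) {S S' : Set X} (hS' : MeasurableSet S')
    (hSS' : ∀ p ∈ S, ∀ t ∈ Ioc 0 L, p + t • v ∈ S')
    (hν : ∀ t : ℝ, MeasurePreserving (fun p => p + t • v) ν ν) :
    ∫⁻ p in S, ‖φ p‖ₑ ^ 2 ∂ν ≤ 2 * ∫⁻ p in S, ‖φ (p + L • v)‖ₑ ^ 2 ∂ν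
      + 2 * ENNReal.ofReal (L ^ 2) * ∫⁻ p in S', ‖fderiv ℝ φ p v‖ₑ ^ 2 ∂ν := by
  have hsq : ∀ x : ℝ, ‖x‖ₑ ^ 2 = ENNReal.ofReal (x ^ 2) := fun x => by
    rw [← sq_abs, ENNReal.ofReal_pow (abs_nonneg x), ← Real.norm_eq_abs, ofReal_norm]
  have hDc : Continuous fun p => fderiv ℝ φ p v :=
    (hφ.continuous_fderiv one_ne_zero).clm_apply continuous_const
  have hDt : ∀ p, Continuous fun t : ℝ => fderiv ℝ φ (p + t • v) v := fun p =>
    hDc.comp (f := fun t : ℝ => p + t • v) (by fun_prop)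
  have hpt : ∀ p, ‖φ p‖ₑ ^ 2 ≤ 2 * ‖φ (p + L • v)‖ₑ ^ 2
      + 2 * ENNReal.ofReal L * ∫⁻ t in Ioc 0 L, ‖fderiv ℝ φ (p + t • v) v‖ₑ ^ 2 := by
    intro p
    simp_rw [hsq]
    have hi : IntegrableOn (fun t : ℝ => (fderiv ℝ φ (p + t • v) v) ^ 2) (Ioc 0 L) :=
      ((hDt p).pow 2).integrableOn_Ioc
    rw [← ofReal_integral_eq_lintegral_ofReal hi (.of_forall fun t => sq_nonneg _)]
    have h0 : 0 ≤ ∫ t in Ioc 0 L, (fderiv ℝ φ (p + t • v) v) ^ 2 :=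
      integral_nonneg fun t => sq_nonneg _
    refine (ENNReal.ofReal_le_ofReal (sq_le_of_translate hφ v p hL)).trans ?_
    rw [ENNReal.ofReal_add (by positivity) (by positivity), ENNReal.ofReal_mul (by norm_num),
      ENNReal.ofReal_mul (by positivity), ENNReal.ofReal_mul (by norm_num), ENNReal.ofReal_ofNat]
  have hm1 : Measurable fun p => ‖φ (p + L • v)‖ₑ ^ 2 :=
    ((hφ.continuous.comp (f := fun p => p + L • v) (by fun_prop)).measurable.enorm).pow_const 2
  have hm2 : Measurable fun p => ‖fderiv ℝ φ p v‖ₑ ^ 2 := hDc.measurable.enorm.pow_const 2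
  have hm3 : Measurable fun z : X × ℝ => ‖fderiv ℝ φ (z.1 + z.2 • v) v‖ₑ ^ 2 :=
    hm2.comp (g := fun p => ‖fderiv ℝ φ p v‖ₑ ^ 2) (f := fun z : X × ℝ => z.1 + z.2 • v)
      (by fun_prop)
  refine (lintegral_mono hpt).trans ?_
  rw [lintegral_add_left (hm1.const_mul 2), lintegral_const_mul _ hm1,
    lintegral_const_mul _ hm3.lintegral_prod_right']
  refine add_le_add le_rfl ?_
  rw [pow_two, ENNReal.ofReal_mul hL, mul_assoc, mul_assoc, mul_assoc]
  refine mul_le_mul_right (mul_le_mul_right ?_ _) _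
  rw [lintegral_lintegral_swap hm3.aemeasurable]
  calc _ ≤ ∫⁻ t in Ioc 0 L, ∫⁻ p in S', ‖fderiv ℝ φ p v‖ₑ ^ 2 ∂ν := by
        refine setLIntegral_mono' measurableSet_Ioc fun t ht => ?_
        rw [← (hν t).setLIntegral_comp_preimage hS' hm2]
        exact lintegral_mono_set fun p hp => hSS' p hp t ht
    _ = _ := by simp [mul_comm]

end Translation

/-! ### The weighted measure on cylinders -/

section CylMeasure

open scoped ENNReal

variable {n : ℕ} {Ω : Set (EuclideanSpace ℝ (Fin n))} {s : ℝ}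

/-- The measure `y^α dy` on `(0, ∞)`. -/
def yMeasure (s : ℝ) : Measure ℝ :=
  (volume.withDensity fun y => ENNReal.ofReal (y ^ (1 - 2 * s))).restrict (Ioi 0)

instance : SFinite (yMeasure s) := by
  unfold yMeasure
  infer_instance

lemma measurable_ofReal_rpow (s : ℝ) : Measurable fun y : ℝ => ENNReal.ofReal (y ^ (1 - 2 * s)) :=
  (measurable_id.pow_const _).ennreal_ofReal

lemma cyl_top : cyl Ω ⊤ = Ω ×ˢ Ioi 0 := by
  ext p
  simp [cyl, EReal.coe_lt_top]

lemma cylMeasure_top : cylMeasure Ω s ⊤ = (volume.restrict Ω).prod (yMeasure s) := by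
  unfold cylMeasure yMeasure
  rw [Measure.prod_restrict, cyl_top, prod_withDensity_right (measurable_ofReal_rpow s)]
  rfl

lemma cylMeasure_eq_restrict (hΩ : IsOpen Ω) (h : EReal) :
    cylMeasure Ω s h = (cylMeasure Ω s ⊤).restrict (cyl Ω h) := by
  unfold cylMeasure
  rw [Measure.restrict_restrict (measurableSet_cyl hΩ h),
    inter_eq_self_of_subset_left (cyl_subset Ω h)]

lemma cylMeasure_mono (h : EReal) : cylMeasure Ω s h ≤ cylMeasure Ω s ⊤ :=
  Measure.restrict_mono (cyl_subset Ω h) le_rfl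

lemma isOpen_cyl (hΩ : IsOpen Ω) (h : EReal) : IsOpen (cyl Ω h) := by
  have h1 : IsOpen {p : EuclideanSpace ℝ (Fin n) × ℝ | p.1 ∈ Ω} := hΩ.preimage continuous_fst
  have h2 : IsOpen {p : EuclideanSpace ℝ (Fin n) × ℝ | 0 < p.2} := isOpen_Ioi.preimage continuous_snd
  have h3 : IsOpen {p : EuclideanSpace ℝ (Fin n) × ℝ | (p.2 : EReal) < h} :=
    (isOpen_Iio (a := h)).preimage (continuous_coe_real_ereal.comp continuous_snd)
  exact h1.inter (h2.inter h3)

lemma isFiniteMeasureOnCompacts_yMeasure (hs : s < 1) :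
    IsFiniteMeasureOnCompacts (yMeasure s) := by
  refine ⟨fun K hK => ?_⟩
  obtain ⟨R, hR⟩ := hK.isBounded.subset_closedBall 0
  have h2 := intervalIntegral.intervalIntegrable_rpow' (a := 0) (b := max R 0)
    (show -1 < 1 - 2 * s by linarith)
  rw [intervalIntegrable_iff_integrableOn_Ioc_of_le (le_max_right _ _)] at h2
  have hsub : K ∩ Ioi 0 ⊆ Ioc 0 (max R 0) := by
    intro y hy
    have := hR hy.1
    rw [mem_closedBall_zero_iff] at this
    exact ⟨hy.2, ((le_abs_self y).trans this).trans (le_max_left _ _)⟩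
  unfold yMeasure
  rw [Measure.restrict_apply hK.measurableSet, withDensity_apply _
    (hK.measurableSet.inter measurableSet_Ioi)]
  refine (lintegral_mono_set hsub).trans_lt ?_
  exact h2.lintegral_lt_top

/-- On a compact subset of the open cylinder the weight is continuous and positive, hence bounded
below. Compact sets that reach `y = 0` still have finite measure because the exponent exceeds `-1`.
-/
lemma isWeight_cyl (hΩ : IsOpen Ω) (hs : s < 1) (h : EReal) :
    IsWeight (cylMeasure Ω s h) (cyl Ω h) where
  isOpen := isOpen_cyl hΩ h
  le := by
    intro K hK hKD
    rcases K.eq_empty_or_nonempty with rfl | hne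
    · exact ⟨0, by simp, by simp⟩
    have hpos : ∀ p ∈ K, 0 < p.2 := fun p hp => (hKD hp).2.1
    have hcont : ContinuousOn (fun p : EuclideanSpace ℝ (Fin n) × ℝ => p.2 ^ (1 - 2 * s)) K :=
      fun p hp => (continuousAt_snd.rpow_const (Or.inl (hpos p hp).ne')).continuousWithinAt
    obtain ⟨q, hq, hmin⟩ := hK.exists_isMinOn hne hcont
    set m := q.2 ^ (1 - 2 * s) with hm
    have hm0 : 0 < m := Real.rpow_pos_of_pos (hpos q hq) _
    refine ⟨(ENNReal.ofReal m)⁻¹, by simp [hm0], Measure.le_iff.2 fun T hT => ?_⟩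
    rw [Measure.restrict_apply hT, Measure.smul_apply, smul_eq_mul, mul_comm, ← div_eq_mul_inv,
      ENNReal.le_div_iff_mul_le (Or.inl (by simp [hm0])) (Or.inl ENNReal.ofReal_ne_top), mul_comm]
    unfold cylMeasure
    rw [Measure.restrict_apply hT, withDensity_apply _ (hT.inter (measurableSet_cyl hΩ h)),
      ← setLIntegral_const]
    refine (setLIntegral_mono' (hT.inter hK.measurableSet) fun p hp => ?_).trans
      (lintegral_mono_set (inter_subset_inter_right T hKD))
    exact ENNReal.ofReal_le_ofReal (hmin hp.2)
  ac := (withDensity_absolutelyContinuous _ _).restrict _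
  fin := by
    have := isFiniteMeasureOnCompacts_yMeasure hs
    refine ⟨fun K hK => lt_of_le_of_lt ?_
      (hK.measure_lt_top (μ := (volume : Measure (EuclideanSpace ℝ (Fin n))).prod (yMeasure s)))⟩
    refine (cylMeasure_mono h K).trans ?_
    rw [cylMeasure_top]
    exact Measure.prod_mono Measure.restrict_le_self le_rfl K

lemma isWeight_restrict (hΩ : IsOpen Ω) : IsWeight (volume.restrict Ω) Ω where
  isOpen := hΩ
  le := fun K _ hKD => ⟨1, by simp, by rw [one_smul]; exact Measure.restrict_mono hKD le_rfl⟩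
  ac := Measure.AbsolutelyContinuous.rfl
  fin := ⟨fun K hK => (Measure.restrict_le_self K).trans_lt hK.measure_lt_top⟩

lemma quasiMeasurePreserving_fst_cyl (h : EReal) :
    Measure.QuasiMeasurePreserving (Prod.fst : EuclideanSpace ℝ (Fin n) × ℝ → _)
      (cylMeasure Ω s h) (volume.restrict Ω) := by
  have h1 := Measure.quasiMeasurePreserving_fst (μ := volume.restrict Ω) (ν := yMeasure s)
  rw [← cylMeasure_top] at h1
  exact h1.mono_left (cylMeasure_mono h).absolutelyContinuous

lemma integral_yMeasure (u : ℝ → ℝ) :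
    ∫ y, u y ∂(yMeasure s) = ∫ y in Ioi 0, y ^ (1 - 2 * s) * u y := by
  unfold yMeasure
  rw [setIntegral_withDensity_eq_setIntegral_toReal_smul (measurable_ofReal_rpow s)
    (.of_forall fun _ => ENNReal.ofReal_lt_top) _ measurableSet_Ioi]
  refine setIntegral_congr_fun measurableSet_Ioi fun y hy => ?_
  rw [ENNReal.toReal_ofReal (Real.rpow_nonneg (le_of_lt hy) _), smul_eq_mul]

lemma ae_cyl_of_ae {P : EuclideanSpace ℝ (Fin n) → Prop}
    (hP : ∀ᵐ x ∂(volume.restrict Ω), P x) (h : EReal) :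
    ∀ᵐ p ∂(cylMeasure Ω s h), P p.1 :=
  (quasiMeasurePreserving_fst_cyl h).ae hP

lemma ae_mem_cyl (hΩ : IsOpen Ω) (h : EReal) : ∀ᵐ p ∂(cylMeasure Ω s h), p ∈ cyl Ω h :=
  ae_restrict_mem (measurableSet_cyl hΩ h)

/-- A function vanishing above the height `h` has the same norm on both cylinders. -/
lemma eLpNorm_cyl_eq (hΩ : IsOpen Ω) (h : EReal) {F : Type*} [NormedAddCommGroup F]
    {u : EuclideanSpace ℝ (Fin n) × ℝ → F} (hu : ∀ p ∈ cyl Ω ⊤, p ∉ cyl Ω h → u p = 0) :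
    eLpNorm u 2 (cylMeasure Ω s h) = eLpNorm u 2 (cylMeasure Ω s ⊤) := by
  rw [cylMeasure_eq_restrict hΩ, ← eLpNorm_indicator_eq_eLpNorm_restrict (measurableSet_cyl hΩ h)]
  refine eLpNorm_congr_ae ?_
  filter_upwards [ae_mem_cyl hΩ ⊤] with p hp
  by_cases hph : p ∈ cyl Ω h
  · rw [indicator_of_mem hph]
  · rw [indicator_of_notMem hph, hu p hp hph]

lemma mem_cyl_of_mem_cylLow {h : EReal} {p : EuclideanSpace ℝ (Fin n) × ℝ} (hp : p ∈ cyl Ω ⊤)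
    (hp' : p ∈ cylLow Ω h) : p ∈ cyl Ω h := ⟨hp.1, hp.2.1, hp'.2⟩

lemma cylLow_mono {h h' : EReal} (hh : h ≤ h') : cylLow Ω h ⊆ cylLow Ω h' :=
  fun _ hp => ⟨hp.1, hp.2.trans_le hh⟩

end CylMeasure

/-! ### Triples `(w, ∇ w, tr w)` -/

section Triples

open scoped ENNReal

variable {n : ℕ} {Ω : Set (EuclideanSpace ℝ (Fin n))} {s : ℝ}

instance : (volume : Measure (EuclideanSpace ℝ (Fin n) × ℝ)).IsAddHaarMeasure :=
  inferInstanceAs ((volume : Measure (EuclideanSpace ℝ (Fin n))).prod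
    (volume : Measure ℝ)).IsAddHaarMeasure

/-- The space of the triples `(w, ∇ w, tr w)`. -/
abbrev Triple (Ω : Set (EuclideanSpace ℝ (Fin n))) (s : ℝ) (h : EReal) : Type :=
  L2C Ω s h × Lp (EuclideanSpace ℝ (Fin n) × ℝ →L[ℝ] ℝ) 2 (cylMeasure Ω s h) × L2 Ω

/-- `p` is the triple of the test function `φ`. -/
def IsTriple {h : EReal} (p : Triple Ω s h) (φ : EuclideanSpace ℝ (Fin n) × ℝ → ℝ) : Prop :=
  p.1 =ᵐ[cylMeasure Ω s h] φ ∧ p.2.1 =ᵐ[cylMeasure Ω s h] fderiv ℝ φ ∧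
    p.2.2 =ᵐ[volume.restrict Ω] fun x => φ (x, 0)

/-- The triples of test functions supported in `U`. -/
def testTriples (s : ℝ) (Ω : Set (EuclideanSpace ℝ (Fin n)))
    (U : Set (EuclideanSpace ℝ (Fin n) × ℝ)) (h : EReal) : Submodule ℝ (Triple Ω s h) where
  carrier := {p | ∃ φ, IsTest U φ ∧ IsTriple p φ}
  zero_mem' := ⟨0, .zero, Lp.coeFn_zero _ _ _, by
    refine (Lp.coeFn_zero _ _ _).trans (.of_forall fun x => ?_)
    simp, Lp.coeFn_zero _ _ _⟩
  add_mem' := by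
    rintro p q ⟨φ, hφ, h1, h2, h3⟩ ⟨ψ, hψ, h4, h5, h6⟩
    refine ⟨φ + ψ, hφ.add hψ, (Lp.coeFn_add _ _).trans (h1.add h4), ?_,
      (Lp.coeFn_add _ _).trans (h3.add h6)⟩
    refine (Lp.coeFn_add _ _).trans ((h2.add h5).trans (.of_forall fun x => ?_))
    simp [fderiv_add (hφ.differentiable x) (hψ.differentiable x)]
  smul_mem' := by
    rintro r p ⟨φ, hφ, h1, h2, h3⟩
    refine ⟨r • φ, hφ.smul r, (Lp.coeFn_smul _ _).trans (h1.const_smul r), ?_,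
      (Lp.coeFn_smul _ _).trans (h3.const_smul r)⟩
    refine (Lp.coeFn_smul _ _).trans ((h2.const_smul r).trans (.of_forall fun x => ?_))
    simp [fderiv_const_smul (hφ.differentiable x)]

/-- The triples `(w, ∇ w, tr w)` for `w` in the closure of the test functions supported in `U`. -/
def sobolevTriples (s : ℝ) (Ω : Set (EuclideanSpace ℝ (Fin n)))
    (U : Set (EuclideanSpace ℝ (Fin n) × ℝ)) (h : EReal) : Submodule ℝ (Triple Ω s h) :=
  (testTriples s Ω U h).topologicalClosure

lemma continuous_slice_zero {φ : EuclideanSpace ℝ (Fin n) × ℝ → ℝ} (hφ : Continuous φ) (y : ℝ) :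
    Continuous fun x => φ (x, y) := hφ.comp (by fun_prop)

lemma hasCompactSupport_slice {F : Type*} [NormedAddCommGroup F]
    {φ : EuclideanSpace ℝ (Fin n) × ℝ → F} (hφ : HasCompactSupport φ) (y : ℝ) :
    HasCompactSupport fun x => φ (x, y) :=
  hφ.comp_isClosedEmbedding (g := fun x : EuclideanSpace ℝ (Fin n) => (x, y))
    (Topology.IsClosedEmbedding.of_continuous_injective_isClosedMap (by fun_prop)
      (fun a b hab => congrArg Prod.fst hab) (fun K hK => by
        have : (fun x : EuclideanSpace ℝ (Fin n) => (x, y)) '' K = K ×ˢ {y} := by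
          ext ⟨a, b⟩
          simp only [mem_image, Prod.mk.injEq, mem_prod, mem_singleton_iff]
          constructor
          · rintro ⟨x, hx, rfl, rfl⟩; exact ⟨hx, rfl⟩
          · rintro ⟨ha, rfl⟩; exact ⟨a, ha, rfl, rfl⟩
        rw [this]
        exact hK.prod isClosed_singleton))

lemma memLp_slice {φ : EuclideanSpace ℝ (Fin n) × ℝ → ℝ} (hφ : Continuous φ)
    (hφc : HasCompactSupport φ) (y : ℝ) (p : ℝ≥0∞) :
    MemLp (fun x => φ (x, y)) p (volume.restrict Ω) :=
  ((continuous_slice_zero hφ y).memLp_of_hasCompactSupport (hasCompactSupport_slice hφc y)).restrict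
    Ω

lemma exists_isTriple (hΩ : IsOpen Ω) (hs : s < 1) (h : EReal) {U}
    {φ : EuclideanSpace ℝ (Fin n) × ℝ → ℝ} (hφ : IsTest U φ) :
    ∃ p ∈ testTriples s Ω U h, IsTriple p φ := by
  have := (isWeight_cyl hΩ hs h).fin
  have h1 : MemLp φ 2 (cylMeasure Ω s h) := hφ.memLp 2
  have h2 : MemLp (fderiv ℝ φ) 2 (cylMeasure Ω s h) := hφ.memLp_fderiv 2
  have h3 := memLp_slice (Ω := Ω) hφ.continuous hφ.2.1 0 2
  have h4 : IsTriple (s := s) (h := h) (h1.toLp φ, h2.toLp _, h3.toLp _) φ :=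
    ⟨h1.coeFn_toLp, h2.coeFn_toLp, h3.coeFn_toLp⟩
  exact ⟨_, ⟨φ, hφ, h4⟩, h4⟩

lemma isClosed_sobolevTriples {U} {h : EReal} :
    IsClosed (sobolevTriples s Ω U h : Set (Triple (n := n) Ω s h)) :=
  Submodule.isClosed_topologicalClosure _

/-- A closed condition that holds for test functions holds for all Sobolev functions. -/
lemma sobolevTriples_induction {U} {h : EReal} {Q : Triple (n := n) Ω s h → Prop}
    (hQ : IsClosed {p | Q p}) (htest : ∀ p, ∀ φ, IsTest U φ → IsTriple p φ → Q p)
    {p : Triple Ω s h} (hp : p ∈ sobolevTriples s Ω U h) : Q p := by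
  have : (sobolevTriples s Ω U h : Set (Triple Ω s h)) ⊆ {p | Q p} := by
    refine closure_minimal ?_ hQ
    rintro q ⟨φ, hφ, hq⟩
    exact htest q φ hφ hq
  exact this hp

lemma exists_seq_of_mem {U} {h : EReal} {p : Triple (n := n) Ω s h}
    (hp : p ∈ sobolevTriples s Ω U h) :
    ∃ (q : ℕ → Triple Ω s h) (φ : ℕ → EuclideanSpace ℝ (Fin n) × ℝ → ℝ),
      (∀ k, IsTest U (φ k)) ∧ (∀ k, IsTriple (q k) (φ k)) ∧ Tendsto q atTop (𝓝 p) := by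
  obtain ⟨q, hq, hlim⟩ := mem_closure_iff_seq_limit.1 hp
  choose φ hφ hqφ using hq
  exact ⟨q, φ, hφ, hqφ, hlim⟩

lemma mem_sobolevTriples_of_tendsto {U} {h : EReal} {p : Triple (n := n) Ω s h}
    {q : ℕ → Triple Ω s h} {φ : ℕ → EuclideanSpace ℝ (Fin n) × ℝ → ℝ}
    (hφ : ∀ k, IsTest U (φ k)) (hq : ∀ k, IsTriple (q k) (φ k)) (hlim : Tendsto q atTop (𝓝 p)) :
    p ∈ sobolevTriples s Ω U h :=
  mem_closure_of_tendsto hlim (.of_forall fun k => ⟨φ k, hφ k, hq k⟩)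

lemma tendsto_triple_iff {h : EReal} {p : Triple (n := n) Ω s h}
    {q : ℕ → Triple Ω s h} {φ : ℕ → EuclideanSpace ℝ (Fin n) × ℝ → ℝ}
    (hq : ∀ k, IsTriple (q k) (φ k)) :
    Tendsto q atTop (𝓝 p) ↔ TendstoPair (cylMeasure Ω s h) φ p.1 p.2.1 ∧
      Tendsto (fun k => eLpNorm (fun x => φ k (x, 0) - p.2.2 x) 2 (volume.restrict Ω)) atTop
        (𝓝 0) := by
  rw [Prod.tendsto_iff, Prod.tendsto_iff, Lp.tendsto_Lp_iff_tendsto_eLpNorm',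
    Lp.tendsto_Lp_iff_tendsto_eLpNorm', Lp.tendsto_Lp_iff_tendsto_eLpNorm', TendstoPair, and_assoc]
  refine and_congr (tendsto_congr fun k => eLpNorm_congr_ae ((hq k).1.sub (EventuallyEq.refl _ _)))
    (and_congr
      (tendsto_congr fun k => eLpNorm_congr_ae ((hq k).2.1.sub (EventuallyEq.refl _ _)))
      (tendsto_congr fun k => eLpNorm_congr_ae ((hq k).2.2.sub (EventuallyEq.refl _ _))))

lemma IsTriple.norm_fst {h : EReal} {p : Triple (n := n) Ω s h} {φ} (hp : IsTriple p φ) :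
    ‖p.1‖ = (eLpNorm φ 2 (cylMeasure Ω s h)).toReal := by
  rw [Lp.norm_def, eLpNorm_congr_ae hp.1]

lemma IsTriple.norm_snd {h : EReal} {p : Triple (n := n) Ω s h} {φ} (hp : IsTriple p φ) :
    ‖p.2.1‖ = (eLpNorm (fderiv ℝ φ) 2 (cylMeasure Ω s h)).toReal := by
  rw [Lp.norm_def, eLpNorm_congr_ae hp.2.1]

lemma IsTriple.norm_trace {h : EReal} {p : Triple (n := n) Ω s h} {φ} (hp : IsTriple p φ) :
    ‖p.2.2‖ = (eLpNorm (fun x => φ (x, 0)) 2 (volume.restrict Ω)).toReal := by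
  rw [Lp.norm_def, eLpNorm_congr_ae hp.2.2]

lemma hasDerivAt_vertical {U} {φ : EuclideanSpace ℝ (Fin n) × ℝ → ℝ} (hφ : IsTest U φ)
    (x : EuclideanSpace ℝ (Fin n)) (y : ℝ) :
    HasDerivAt (fun t => φ (x, t)) (fderiv ℝ φ (x, y) (0, 1)) y := by
  have h1 : HasDerivAt (fun t : ℝ => (x, t)) ((0 : EuclideanSpace ℝ (Fin n)), (1 : ℝ)) y :=
    (hasDerivAt_const y x).prodMk (hasDerivAt_id y)
  exact (hφ.differentiable (x, y)).hasFDerivAt.comp_hasDerivAt y h1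

lemma hasCompactSupport_vertical {F : Type*} [NormedAddCommGroup F]
    {φ : EuclideanSpace ℝ (Fin n) × ℝ → F} (hφ : HasCompactSupport φ)
    (x : EuclideanSpace ℝ (Fin n)) : HasCompactSupport fun y => φ (x, y) := by
  refine hφ.comp_isClosedEmbedding (g := fun y : ℝ => (x, y))
    (Topology.IsClosedEmbedding.of_continuous_injective_isClosedMap (by fun_prop)
      (fun a b hab => congrArg Prod.snd hab) (fun K hK => ?_))
  have : (fun y : ℝ => (x, y)) '' K = {x} ×ˢ K := by
    ext ⟨a, b⟩
    simp only [mem_image, Prod.mk.injEq, mem_prod, mem_singleton_iff]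
    constructor
    · rintro ⟨y, hy, rfl, rfl⟩; exact ⟨rfl, hy⟩
    · rintro ⟨rfl, hb⟩; exact ⟨b, hb, rfl, rfl⟩
  rw [this]
  exact isClosed_singleton.prod hK

lemma norm_vertical : ‖((0 : EuclideanSpace ℝ (Fin n)), (1 : ℝ))‖ = 1 := by
  simp [Prod.norm_def]

lemma integral_cyl_top {u : EuclideanSpace ℝ (Fin n) × ℝ → ℝ}
    (hu : Integrable u (cylMeasure Ω s ⊤)) :
    ∫ p, u p ∂(cylMeasure Ω s ⊤)
      = ∫ x in Ω, ∫ y in Ioi 0, y ^ (1 - 2 * s) * u (x, y) := by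
  rw [cylMeasure_top] at hu ⊢
  rw [integral_prod _ hu]
  simp_rw [integral_yMeasure]

lemma integrable_cyl (hΩ : IsOpen Ω) (hs : s < 1) (h : EReal)
    {u : EuclideanSpace ℝ (Fin n) × ℝ → ℝ} (hu : Continuous u) (huc : HasCompactSupport u) :
    Integrable u (cylMeasure Ω s h) := by
  have := (isWeight_cyl hΩ hs h).fin
  exact hu.integrable_of_hasCompactSupport huc

/-- The trace inequality for test functions on the full cylinder. -/
lemma exists_trace_bound_top (hΩ : IsOpen Ω) (hs : s ∈ Ioo (0 : ℝ) 1) :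
    ∃ C : ℝ, 0 ≤ C ∧ ∀ (U) (φ : EuclideanSpace ℝ (Fin n) × ℝ → ℝ), IsTest U φ →
      ∀ p : Triple Ω s ⊤, IsTriple p φ → ‖p.2.2‖ ^ 2 ≤ C * (‖p.1‖ ^ 2 + ‖p.2.1‖ ^ 2) := by
  obtain ⟨C, hC, hbound⟩ := rpow_mul_trace_sq_le hs
  refine ⟨C, hC, fun U φ hφ p hp => ?_⟩
  have hcd : Continuous fun q => fderiv ℝ φ q (0, 1) :=
    hφ.continuous_fderiv.clm_apply continuous_const
  have hcdc : HasCompactSupport fun q => fderiv ℝ φ q (0, 1) :=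
    (hφ.2.1.fderiv ℝ).comp_left
      (g := fun L : EuclideanSpace ℝ (Fin n) × ℝ →L[ℝ] ℝ => L (0, 1)) (by simp)
  have hx : ∀ x, φ (x, 0) ^ 2
      ≤ C * ∫ y in Ioi 0, y ^ (1 - 2 * s) * (φ (x, y) ^ 2 + fderiv ℝ φ (x, y) (0, 1) ^ 2) := by
    intro x
    -- The one-dimensional trace inequality on a vertical line, with parameter `l = 1`.
    have := hbound (fun y => φ (x, y)) (fun y => fderiv ℝ φ (x, y) (0, 1))
      (fun t => hasDerivAt_vertical hφ x t) (hcd.comp (by fun_prop))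
      (hasCompactSupport_vertical hφ.2.1 x) (hasCompactSupport_vertical hcdc x) 1 zero_le_one
    simpa using this
  have hi2 : Integrable (fun q => φ q ^ 2 + fderiv ℝ φ q (0, 1) ^ 2) (cylMeasure Ω s ⊤) := by
    refine integrable_cyl hΩ hs.2 ⊤ ((hφ.continuous.pow 2).add (hcd.pow 2)) ?_
    exact (hφ.2.1.comp_left (g := fun x : ℝ => x ^ 2) (by simp)).add
      (hcdc.comp_left (g := fun x : ℝ => x ^ 2) (by simp))
  have h1 : ‖p.2.2‖ ^ 2 = ∫ x in Ω, φ (x, 0) ^ 2 := by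
    rw [norm_sq_eq_integral]
    refine integral_congr_ae ?_
    filter_upwards [hp.2.2] with x hx
    rw [hx, Real.norm_eq_abs, sq_abs]
  have h2 : ∫ x in Ω, φ (x, 0) ^ 2
      ≤ C * ∫ q, (φ q ^ 2 + fderiv ℝ φ q (0, 1) ^ 2) ∂(cylMeasure Ω s ⊤) := by
    rw [integral_cyl_top hi2, ← integral_const_mul]
    have hi2' := hi2
    rw [cylMeasure_top] at hi2'
    have hi3 := hi2'.integral_prod_left
    simp_rw [integral_yMeasure] at hi3
    refine integral_mono_of_nonneg (.of_forall fun x => sq_nonneg _) (hi3.const_mul C)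
      (.of_forall hx)
  rw [h1]
  refine h2.trans (mul_le_mul_of_nonneg_left ?_ hC)
  rw [norm_sq_eq_integral, norm_sq_eq_integral, ← integral_add (integrable_norm_sq (Lp.memLp _))
    (integrable_norm_sq (Lp.memLp _))]
  refine integral_mono_ae hi2
    ((integrable_norm_sq (Lp.memLp _)).add (integrable_norm_sq (Lp.memLp _))) ?_
  filter_upwards [hp.1, hp.2.1] with q h3 h4
  rw [h3, h4, Real.norm_eq_abs, sq_abs]
  have h5 := (fderiv ℝ φ q).le_opNorm (0, 1)
  rw [norm_vertical, mul_one, Real.norm_eq_abs] at h5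
  have h6 := sq_le_sq' (by linarith [norm_nonneg (fderiv ℝ φ q), abs_nonneg (fderiv ℝ φ q (0, 1))])
    h5
  rw [sq_abs] at h6
  linarith

/-- The norm of the triple of a test function does not change if the cylinder is extended. -/
lemma IsTriple.norm_eq (hΩ : IsOpen Ω) {h : EReal} {φ} (hφ : IsTest (cylLow Ω h) φ)
    {p : Triple (n := n) Ω s h} (hp : IsTriple p φ) {p' : Triple Ω s ⊤} (hp' : IsTriple p' φ) :
    ‖p.1‖ = ‖p'.1‖ ∧ ‖p.2.1‖ = ‖p'.2.1‖ ∧ ‖p.2.2‖ = ‖p'.2.2‖ := by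
  rw [hp.norm_fst, hp'.norm_fst, hp.norm_snd, hp'.norm_snd, hp.norm_trace, hp'.norm_trace]
  refine ⟨?_, ?_, rfl⟩
  · rw [eLpNorm_cyl_eq hΩ h]
    exact fun q hq hq' => hφ.eq_zero fun hmem => hq' (mem_cyl_of_mem_cylLow hq hmem)
  · rw [eLpNorm_cyl_eq hΩ h]
    exact fun q hq hq' => hφ.fderiv_eq_zero fun hmem => hq' (mem_cyl_of_mem_cylLow hq hmem)

/-- A test function supported below `h` has the same norms on both cylinders, so the inequality on
the full cylinder applies, with one constant for all `h`. It passes to the closure because both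
sides are continuous. -/
lemma exists_trace_bound (hΩ : IsOpen Ω) (hs : s ∈ Ioo (0 : ℝ) 1) :
    ∃ C : ℝ, 0 ≤ C ∧ ∀ (h : EReal), ∀ p ∈ sobolevTriples (n := n) s Ω (cylLow Ω h) h,
      ‖p.2.2‖ ^ 2 ≤ C * (‖p.1‖ ^ 2 + ‖p.2.1‖ ^ 2) := by
  obtain ⟨C, hC, hbound⟩ := exists_trace_bound_top hΩ hs
  refine ⟨C, hC, fun h p hp => ?_⟩
  refine sobolevTriples_induction
    (Q := fun p => ‖p.2.2‖ ^ 2 ≤ C * (‖p.1‖ ^ 2 + ‖p.2.1‖ ^ 2))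
    (isClosed_le (by fun_prop) (by fun_prop)) ?_ hp
  intro q φ hφ hq
  obtain ⟨p', -, hp'⟩ := exists_isTriple hΩ hs.2 ⊤ hφ
  obtain ⟨e1, e2, e3⟩ := hq.norm_eq hΩ hφ hp'
  rw [e1, e2, e3]
  exact hbound _ φ hφ p' hp'

/-! ### Triples versus weak gradients, `HL` and `tr`. -/

lemma weakFDeriv_ae_eq_of_mem (hΩ : IsOpen Ω) (hs : s < 1) {U} {h : EReal}
    {p : Triple (n := n) Ω s h} (hp : p ∈ sobolevTriples s Ω U h) :
    weakFDeriv (cyl Ω h) p.1 =ᵐ[cylMeasure Ω s h] p.2.1 := by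
  obtain ⟨q, φ, hφ, hq, hlim⟩ := exists_seq_of_mem hp
  exact ((tendsto_triple_iff hq).1 hlim).1.weakFDeriv_ae_eq (isWeight_cyl hΩ hs h) hφ

/-- A Sobolev triple is determined by its first entry. -/
lemma sobolevTriples_ext (hΩ : IsOpen Ω) (hs : s ∈ Ioo (0 : ℝ) 1) {h : EReal}
    {p q : Triple (n := n) Ω s h} (hp : p ∈ sobolevTriples s Ω (cylLow Ω h) h)
    (hq : q ∈ sobolevTriples s Ω (cylLow Ω h) h) (hpq : p.1 = q.1) : p = q := by
  have h1 := weakFDeriv_ae_eq_of_mem hΩ hs.2 hp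
  have h2 := weakFDeriv_ae_eq_of_mem hΩ hs.2 hq
  rw [hpq] at h1
  have h3 : p.2.1 = q.2.1 := Lp.ext (h1.symm.trans h2)
  obtain ⟨C, -, hC⟩ := exists_trace_bound (n := n) hΩ hs
  -- The first two entries of `p - q` vanish, so the trace inequality forces the third to vanish
  -- too.
  have h4 := hC h _ (Submodule.sub_mem _ hp hq)
  simp only [Prod.fst_sub, Prod.snd_sub, hpq, h3, sub_self, norm_zero] at h4
  have h5 : ‖p.2.2 - q.2.2‖ = 0 := by
    have : ‖p.2.2 - q.2.2‖ ^ 2 ≤ 0 := by simpa using h4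
    exact pow_eq_zero_iff two_ne_zero |>.1 (le_antisymm this (sq_nonneg _))
  exact Prod.ext hpq (Prod.ext h3 (sub_eq_zero.1 (norm_eq_zero.1 h5)))

lemma mem_HL_of_mem (hΩ : IsOpen Ω) (hs : s < 1) {h : EReal} {p : Triple (n := n) Ω s h}
    (hp : p ∈ sobolevTriples s Ω (cylLow Ω h) h) : p.1 ∈ HL Ω s h := by
  obtain ⟨q, φ, hφ, hq, hlim⟩ := exists_seq_of_mem hp
  exact ((tendsto_triple_iff hq).1 hlim).1.mem_h1Closure (isWeight_cyl hΩ hs h) hφ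

/-- The trace picked by choice comes from some approximating sequence, so it completes `p.1` to
another Sobolev triple. Triples with equal first entries coincide. -/
lemma tr_eq_of_mem (hΩ : IsOpen Ω) (hs : s ∈ Ioo (0 : ℝ) 1) {h : EReal}
    {p : Triple (n := n) Ω s h}
    (hp : p ∈ sobolevTriples s Ω (cylLow Ω h) h) : tr Ω s h p.1 = p.2.2 := by
  have hex : ∃ g, IsTrace Ω s h p.1 g := by
    obtain ⟨q, φ, hφ, hq, hlim⟩ := exists_seq_of_mem hp
    have h1 := (tendsto_triple_iff hq).1 hlim
    exact ⟨p.2.2, φ, hφ, h1.1.h1Tendsto (isWeight_cyl hΩ hs.2 h) hφ, h1.2⟩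
  unfold tr
  rw [dif_pos hex]
  obtain ⟨φ, hφ, h1, h2⟩ := hex.choose_spec
  have h3 := h1.tendstoPair (mem_HL_of_mem hΩ hs.2 hp).1
  choose q hqm hq using fun k => exists_isTriple hΩ hs.2 h (hφ k)
  have h4 : (p.1, _, hex.choose) ∈ sobolevTriples s Ω (cylLow Ω h) h :=
    mem_sobolevTriples_of_tendsto hφ hq ((tendsto_triple_iff hq).2 ⟨h3, h2⟩)
  exact congrArg (fun p => p.2.2) (sobolevTriples_ext hΩ hs h4 hp rfl)

/-- Membership in `HL` yields convergence of functions and gradients only; the trace inequality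
applied to differences makes the traces a Cauchy sequence. -/
lemma exists_triple_of_mem_HL (hΩ : IsOpen Ω) (hs : s ∈ Ioo (0 : ℝ) 1) {h : EReal}
    {w : L2C Ω s h} (hw : w ∈ HL Ω s h) :
    ∃ p ∈ sobolevTriples s Ω (cylLow Ω h) h, p.1 = w := by
  obtain ⟨φ, hφ, h1⟩ := hw.2
  have h2 := h1.tendstoPair hw.1
  obtain ⟨C, hC0, hC⟩ := exists_trace_bound (n := n) hΩ hs
  choose q hqm hq using fun k => exists_isTriple hΩ hs.2 h (hφ k)
  have t1 : Tendsto (fun k => (q k).1) atTop (𝓝 w) :=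
    (tendstoPair_iff fun k => (hq k).1).2 h2.1
  have t2 : Tendsto (fun k => (q k).2.1) atTop (𝓝 (hw.1.2.toLp _)) := by
    rw [Lp.tendsto_Lp_iff_tendsto_eLpNorm']
    refine h2.2.congr fun k => eLpNorm_congr_ae ?_
    exact ((hq k).2.1.sub (EventuallyEq.refl _ _)).symm
  have hcau : CauchySeq fun k => (q k).2.2 := by
    rw [Metric.cauchySeq_iff']
    intro ε hε
    -- Two differences below `δ` give a trace difference of at most `√(2C) δ`. The added `1` makes
    -- this smaller than `ε` and covers `C = 0`.
    have hδ : 0 < ε / (Real.sqrt (2 * C) + 1) := by positivity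
    obtain ⟨N₁, hN₁⟩ := Metric.cauchySeq_iff.1 t1.cauchySeq _ hδ
    obtain ⟨N₂, hN₂⟩ := Metric.cauchySeq_iff.1 t2.cauchySeq _ hδ
    refine ⟨max N₁ N₂, fun k hk => ?_⟩
    have e1 := hN₁ k ((le_max_left _ _).trans hk) _ (le_max_left N₁ N₂)
    have e2 := hN₂ k ((le_max_right _ _).trans hk) _ (le_max_right N₁ N₂)
    have e3 := hC h _ (Submodule.sub_mem _ (Submodule.le_topologicalClosure _ (hqm k))
      (Submodule.le_topologicalClosure _ (hqm (max N₁ N₂))))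
    rw [dist_eq_norm] at e1 e2 ⊢
    simp only [Prod.fst_sub, Prod.snd_sub] at e3
    set δ := ε / (Real.sqrt (2 * C) + 1) with hδdef
    have e4 : ‖(q k).2.2 - (q (max N₁ N₂)).2.2‖ ^ 2 ≤ (Real.sqrt (2 * C) * δ) ^ 2 := by
      refine e3.trans ?_
      rw [mul_pow, Real.sq_sqrt (by positivity), mul_assoc 2 C, mul_left_comm, two_mul]
      gcongr
    have e5 := (sq_le_sq₀ (norm_nonneg _) (by positivity)).1 e4
    have e6 : (Real.sqrt (2 * C) + 1) * δ = ε := by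
      rw [hδdef]
      field_simp
    linarith
  obtain ⟨g, hg⟩ := cauchySeq_tendsto_of_complete hcau
  exact ⟨(w, hw.1.2.toLp _, g), mem_sobolevTriples_of_tendsto hφ hq
    ((Prod.tendsto_iff _ _).2 ⟨t1, (Prod.tendsto_iff _ _).2 ⟨t2, hg⟩⟩), rfl⟩

end Triples

/-! ### The energy form on the cylinder -/

section CylForm

open scoped ENNReal

variable {n : ℕ} {Ω : Set (EuclideanSpace ℝ (Fin n))} {s : ℝ}

lemma ofReal_norm_sq_eq_lintegral {α F : Type*} [MeasurableSpace α] {μ : Measure α}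
    [NormedAddCommGroup F] (u : Lp F 2 μ) :
    ENNReal.ofReal (‖u‖ ^ 2) = ∫⁻ x, ‖u x‖ₑ ^ 2 ∂μ := by
  rw [norm_sq_eq_integral,
    ofReal_integral_eq_lintegral_ofReal (integrable_norm_sq (Lp.memLp u))
      (.of_forall fun x => sq_nonneg _)]
  refine lintegral_congr fun x => ?_
  rw [ENNReal.ofReal_pow (norm_nonneg _), ofReal_norm]

/-- The Poincaré inequality on the cylinder over a bounded set. -/
lemma exists_poincare (hn : 1 ≤ n) (hΩ : IsOpen Ω) (hΩb : Bornology.IsBounded Ω) :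
    ∃ C : ℝ, 0 ≤ C ∧ ∀ p ∈ sobolevTriples s Ω (cylLow Ω ⊤) ⊤,
      ‖p.1‖ ^ 2 ≤ C * ‖p.2.1‖ ^ 2 := by
  obtain ⟨ρ, hρ⟩ := hΩb.subset_closedBall 0
  set e : EuclideanSpace ℝ (Fin n) := EuclideanSpace.single ⟨0, hn⟩ 1 with he
  have hnorm : ‖e‖ = 1 := by simp [he]
  -- More than the diameter of `Ω`, so that a shift by `L` in the direction `e` leaves `Ω`, where
  -- the test function is zero.
  set L : ℝ := 2 * |ρ| + 1 with hLdef
  have hL : 0 ≤ L := by positivity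
  refine ⟨2 * L ^ 2, by positivity, fun p hp => ?_⟩
  refine sobolevTriples_induction (Q := fun p => ‖p.1‖ ^ 2 ≤ 2 * L ^ 2 * ‖p.2.1‖ ^ 2)
    (isClosed_le (by fun_prop) (by fun_prop)) ?_ hp
  intro q φ hφ hq
  have hν : ∀ t : ℝ, MeasurePreserving
      (fun p : EuclideanSpace ℝ (Fin n) × ℝ => p + t • ((e, 0) : EuclideanSpace ℝ (Fin n) × ℝ))
      ((volume : Measure (EuclideanSpace ℝ (Fin n))).prod (yMeasure s))
      ((volume : Measure (EuclideanSpace ℝ (Fin n))).prod (yMeasure s)) := by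
    intro t
    have h1 := (measurePreserving_add_right (volume : Measure (EuclideanSpace ℝ (Fin n)))
      (t • e)).prod (MeasurePreserving.id (yMeasure s))
    convert h1 using 1
    ext p <;> simp
  have hS : MeasurableSet (Ω ×ˢ (univ : Set ℝ)) := hΩ.measurableSet.prod MeasurableSet.univ
  have key := lintegral_sq_le_of_translate (S := Ω ×ˢ univ) (S' := univ)
    (hφ.1.of_le (by norm_num)) (e, 0) hL
    MeasurableSet.univ (fun _ _ _ _ => mem_univ _) hν
  have h0 : ∫⁻ p in Ω ×ˢ univ, ‖φ (p + L • ((e, 0) : EuclideanSpace ℝ (Fin n) × ℝ))‖ₑ ^ 2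
      ∂((volume : Measure (EuclideanSpace ℝ (Fin n))).prod (yMeasure s)) = 0 := by
    rw [setLIntegral_congr_fun hS (g := fun _ => 0), lintegral_zero]
    intro p hp
    have : p + L • ((e, 0) : EuclideanSpace ℝ (Fin n) × ℝ) ∉ cylLow Ω ⊤ := by
      intro hmem
      have h1 := hρ hp.1
      have h2 := hρ hmem.1
      rw [mem_closedBall_zero_iff] at h1 h2
      have h3 : ‖L • e‖ ≤ ‖p.1 + L • e‖ + ‖p.1‖ := by
        have := norm_sub_le (p.1 + L • e) p.1
        rwa [add_sub_cancel_left] at this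
      rw [norm_smul, hnorm, mul_one, Real.norm_of_nonneg hL] at h3
      have h2' : ‖p.1 + L • e‖ ≤ ρ := h2
      linarith [le_abs_self ρ]
    change ‖φ (p + L • ((e, 0) : EuclideanSpace ℝ (Fin n) × ℝ))‖ₑ ^ 2 = 0
    rw [hφ.eq_zero this]
    simp
  rw [h0, mul_zero, zero_add, Measure.restrict_univ] at key
  have hset : ((volume : Measure (EuclideanSpace ℝ (Fin n))).prod (yMeasure s)).restrict
      (Ω ×ˢ univ) = cylMeasure Ω s ⊤ := by
    rw [cylMeasure_top, ← Measure.prod_restrict, Measure.restrict_univ]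
  have h1 : ∫⁻ p, ‖fderiv ℝ φ p (e, 0)‖ₑ ^ 2
      ∂((volume : Measure (EuclideanSpace ℝ (Fin n))).prod (yMeasure s))
      ≤ ∫⁻ p, ‖fderiv ℝ φ p‖ₑ ^ 2 ∂(cylMeasure Ω s ⊤) := by
    rw [← hset, ← lintegral_indicator hS]
    refine lintegral_mono fun p => ?_
    by_cases hp : p.1 ∈ Ω
    · rw [indicator_of_mem (show p ∈ Ω ×ˢ univ from ⟨hp, mem_univ _⟩)]
      gcongr
      rw [← ofReal_norm, ← ofReal_norm]
      refine ENNReal.ofReal_le_ofReal (((fderiv ℝ φ p).le_opNorm _).trans ?_)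
      have : ‖((e, 0) : EuclideanSpace ℝ (Fin n) × ℝ)‖ = 1 := by simp [Prod.norm_def, hnorm]
      rw [this, mul_one]
    · have : p ∉ cylLow Ω ⊤ := fun h => hp h.1
      simp [hφ.fderiv_eq_zero this]
  rw [hset] at key
  have e1 : ∫⁻ p, ‖φ p‖ₑ ^ 2 ∂(cylMeasure Ω s ⊤) = ENNReal.ofReal (‖q.1‖ ^ 2) := by
    rw [ofReal_norm_sq_eq_lintegral]
    refine lintegral_congr_ae ?_
    filter_upwards [hq.1] with x hx
    rw [hx]
  have e2 : ∫⁻ p, ‖fderiv ℝ φ p‖ₑ ^ 2 ∂(cylMeasure Ω s ⊤) = ENNReal.ofReal (‖q.2.1‖ ^ 2) := by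
    rw [ofReal_norm_sq_eq_lintegral]
    refine lintegral_congr_ae ?_
    filter_upwards [hq.2.1] with x hx
    rw [hx]
  rw [e1] at key
  rw [e2] at h1
  have h2 := key.trans (mul_le_mul_right h1 _)
  have e3 : 2 * ENNReal.ofReal (L ^ 2) * ENNReal.ofReal (‖q.2.1‖ ^ 2)
      = ENNReal.ofReal (2 * L ^ 2 * ‖q.2.1‖ ^ 2) := by
    rw [ENNReal.ofReal_mul (by positivity), ENNReal.ofReal_mul (by norm_num),
      ENNReal.ofReal_ofNat]
  rw [e3] at h2
  exact (ENNReal.ofReal_le_ofReal_iff (by positivity)).1 h2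

/-- The horizontal unit vectors. -/
def horiz (i : Fin n) : EuclideanSpace ℝ (Fin n) × ℝ := (EuclideanSpace.single i 1, 0)

lemma norm_horiz_le (i : Fin n) : ‖horiz i‖ ≤ 1 := by
  simp [horiz, Prod.norm_def]

variable {A : EuclideanSpace ℝ (Fin n) → Matrix (Fin n) (Fin n) ℝ}
  {c : EuclideanSpace ℝ (Fin n) → ℝ} {C : ℝ}

lemma IsCoeff.cyl (hA : IsCoeff (volume.restrict Ω) A c C) (s : ℝ) (h : EReal) :
    IsCoeff (cylMeasure Ω s h) (fun p => A p.1) (fun p => c p.1) C where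
  nonneg := hA.nonneg
  meas := fun i j => (hA.meas i j).comp_quasiMeasurePreserving (quasiMeasurePreserving_fst_cyl h)
  bound := ae_cyl_of_ae hA.bound h
  symm := ae_cyl_of_ae hA.symm h
  pos := ae_cyl_of_ae hA.pos h
  measc := hA.measc.comp_quasiMeasurePreserving (quasiMeasurePreserving_fst_cyl h)
  boundc := ae_cyl_of_ae hA.boundc h
  posc := ae_cyl_of_ae hA.posc h

lemma dConst_pos (hs : s ∈ Ioo (0 : ℝ) 1) : 0 < dConst s := by
  unfold dConst
  have h1 := Real.Gamma_pos_of_pos hs.1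
  have h2 := Real.Gamma_pos_of_pos (show 0 < 1 - s by linarith [hs.2])
  positivity

/-- The pair `(w, ∇ w)` of a triple `(w, ∇ w, tr w)`. -/
def gradPair (Ω : Set (EuclideanSpace ℝ (Fin n))) (s : ℝ) (h : EReal) : Triple Ω s h →ₗ[ℝ]
    L2C Ω s h × Lp (EuclideanSpace ℝ (Fin n) × ℝ →L[ℝ] ℝ) 2 (cylMeasure Ω s h) :=
  (LinearMap.fst ℝ _ _).prod (LinearMap.fst ℝ _ _ ∘ₗ LinearMap.snd ℝ _ _)

/-- The bilinear form of the extended problem, on triples `(w, ∇ w, tr w)`. -/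
def tripleForm (hA : IsCoeff (volume.restrict Ω) A c C) (s : ℝ) (h : EReal) :
    Triple Ω s h →ₗ[ℝ] Triple Ω s h →ₗ[ℝ] ℝ :=
  (1 / dConst s) • (energy (hA.cyl s h) horiz (0, 1)).compl₁₂ (gradPair Ω s h) (gradPair Ω s h)

lemma tripleForm_apply (hA : IsCoeff (volume.restrict Ω) A c C) (h : EReal) (p q : Triple Ω s h) :
    tripleForm hA s h p q = 1 / dConst s *
      energy (hA.cyl s h) horiz (0, 1) (p.1, p.2.1) (q.1, q.2.1) := rfl

/-- On Sobolev triples the weak derivatives in `form` may be replaced by the gradient entries, which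
makes the form bilinear in elements of `Lp`. -/
lemma form_eq_tripleForm (hA : IsCoeff (volume.restrict Ω) A c C) (hΩ : IsOpen Ω) (hs : s < 1)
    {h : EReal} {U} {p q : Triple Ω s h} (hp : p ∈ sobolevTriples s Ω U h)
    (hq : q ∈ sobolevTriples s Ω U h) :
    form Ω s A c h p.1 q.1 = tripleForm hA s h p q := by
  rw [tripleForm_apply, energy_apply]
  unfold form
  congr 1
  refine integral_congr_ae ?_
  filter_upwards [weakFDeriv_ae_eq_of_mem hΩ hs hp, weakFDeriv_ae_eq_of_mem hΩ hs hq] with x h1 h2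
  simp only [dx, dy, density, horiz, h1, h2]

/-- The last factor `2` appears because the norm of a triple is a maximum, while the energy is
bounded by a sum of two squares. -/
lemma isBddSymm_tripleForm (hA : IsCoeff (volume.restrict Ω) A c C) (hs : s ∈ Ioo (0 : ℝ) 1)
    (h : EReal) :
    IsBddSymm (tripleForm hA s h) (1 / dConst s * (((n ^ 2 * C + 1) * 1 ^ 2 + C) * 2)) := by
  have hd := dConst_pos hs
  have hC := hA.nonneg
  refine ⟨fun p q => ?_, fun p => ?_, fun p => ?_⟩
  · rw [tripleForm_apply, tripleForm_apply, energy_symm]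
  · rw [tripleForm_apply]
    exact mul_nonneg (by positivity) (energy_nonneg _ _ _ _)
  · rw [tripleForm_apply, mul_assoc (1 / dConst s), mul_assoc _ (2 : ℝ)]
    gcongr
    refine (energy_le (hA.cyl s h) horiz (0, 1) norm_horiz_le norm_vertical.le (p.1, p.2.1)).trans ?_
    have h1 : ‖p.1‖ ≤ ‖p‖ := norm_fst_le p
    have h2 : ‖p.2.1‖ ≤ ‖p‖ := (norm_fst_le p.2).trans (norm_snd_le p)
    have h3 : ‖p.1‖ ^ 2 ≤ ‖p‖ ^ 2 := by gcongr
    have h4 : ‖p.2.1‖ ^ 2 ≤ ‖p‖ ^ 2 := by gcongr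
    gcongr
    linarith

/-- The product carries the maximum norm, so the norm of `G` is at most the sum of its horizontal
and vertical parts; squaring the sum costs the factor `2`. -/
lemma norm_sq_le_of_horiz (G : EuclideanSpace ℝ (Fin n) × ℝ →L[ℝ] ℝ) :
    ‖G‖ ^ 2 ≤ 2 * (∑ i, G (horiz i) ^ 2 + G (0, 1) ^ 2) := by
  have hS : 0 ≤ ∑ i, G (horiz i) ^ 2 := Finset.sum_nonneg fun i _ => sq_nonneg _
  have h1 : ‖G‖ ≤ Real.sqrt (∑ i, G (horiz i) ^ 2) + |G (0, 1)| := by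
    refine G.opNorm_le_bound (by positivity) fun v => ?_
    have h2 : v = (∑ i, v.1 i • horiz i) + v.2 • ((0 : EuclideanSpace ℝ (Fin n)), (1 : ℝ)) := by
      have h3 : v.1 = ∑ i, v.1 i • EuclideanSpace.single i (1 : ℝ) := by
        ext j
        simp [Pi.single_apply]
      refine Prod.ext ?_ ?_
      · simp only [horiz, Prod.fst_add, Prod.fst_sum, Prod.smul_fst, smul_zero, add_zero]
        exact h3
      · simp [horiz, Prod.snd_sum]
    have h3 : G v = ∑ i, v.1 i * G (horiz i) + v.2 * G (0, 1) := by
      conv_lhs => rw [h2]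
      simp only [map_add, map_sum, map_smul, smul_eq_mul]
    have h4 : |∑ i, v.1 i * G (horiz i)| ≤ ‖v.1‖ * Real.sqrt (∑ i, G (horiz i) ^ 2) := by
      rw [EuclideanSpace.norm_eq, ← Real.sqrt_mul (Finset.sum_nonneg fun i _ => sq_nonneg _)]
      refine Real.abs_le_sqrt ?_
      simpa using Finset.sum_mul_sq_le_sq_mul_sq Finset.univ (fun i => v.1 i)
        (fun i => G (horiz i))
    rw [h3, Real.norm_eq_abs]
    refine (abs_add_le _ _).trans ?_
    rw [abs_mul, add_mul]
    have h5 : ‖v.1‖ ≤ ‖v‖ := norm_fst_le v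
    have h6 : |v.2| ≤ ‖v‖ := norm_snd_le v
    refine add_le_add (h4.trans ?_) ?_
    · rw [mul_comm]
      gcongr
    · rw [mul_comm]
      gcongr
  have h2 : ‖G‖ ^ 2 ≤ (Real.sqrt (∑ i, G (horiz i) ^ 2) + |G (0, 1)|) ^ 2 := by gcongr
  refine h2.trans ?_
  have h3 := Real.sq_sqrt hS
  have h4 := sq_abs (G (0, 1))
  nlinarith [sq_nonneg (Real.sqrt (∑ i, G (horiz i) ^ 2) - |G (0, 1)|)]

/-- The form controls the gradient. -/
lemma exists_grad_bound (hA : IsCoeff (volume.restrict Ω) A c C) {l : ℝ} (hl : 0 < l)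
    (hell : ∀ᵐ x ∂(volume.restrict Ω), ∀ ξ : Fin n → ℝ,
      l * ∑ i, ξ i ^ 2 ≤ ∑ i, ∑ j, A x i j * ξ j * ξ i) (hs : s ∈ Ioo (0 : ℝ) 1) (h : EReal) :
    ∃ κ : ℝ, 0 < κ ∧ ∀ p : Triple Ω s h, κ * ‖p.2.1‖ ^ 2 ≤ tripleForm hA s h p p := by
  have hd := dConst_pos hs
  have hm : 0 < min l 1 := lt_min hl one_pos
  -- Ellipticity gives `l` in the horizontal directions, the vertical coefficient is `1`, and the
  -- factor `1 / 2` comes from `norm_sq_le_of_horiz`.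
  refine ⟨1 / dConst s * (min l 1 / 2), by positivity, fun p => ?_⟩
  rw [tripleForm_apply, mul_assoc]
  gcongr
  rw [norm_sq_eq_integral, energy_apply, ← integral_const_mul]
  refine integral_mono_ae ((integrable_norm_sq (Lp.memLp _)).const_mul _)
    ((hA.cyl s h).integrable _ _ (Lp.memLp _) (Lp.memLp _) (Lp.memLp _) (Lp.memLp _)) ?_
  filter_upwards [ae_cyl_of_ae hell h, ae_cyl_of_ae hA.posc h] with x h1 h2
  set G := p.2.1 x
  have h3 := norm_sq_le_of_horiz G
  have h4 : l * ∑ i, G (horiz i) ^ 2 ≤ ∑ i, ∑ j, A x.1 i j * G (horiz j) * G (horiz i) :=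
    h1 fun i => G (horiz i)
  have h5 := mul_nonneg h2 (mul_self_nonneg (p.1 x))
  rw [← mul_assoc] at h5
  have hS : 0 ≤ ∑ i, G (horiz i) ^ 2 := Finset.sum_nonneg fun i _ => sq_nonneg _
  have h6 : min l 1 * ∑ i, G (horiz i) ^ 2 ≤ l * ∑ i, G (horiz i) ^ 2 := by
    gcongr
    exact min_le_left _ _
  have h7 : min l 1 * G (0, 1) ^ 2 ≤ 1 * G (0, 1) ^ 2 := by
    gcongr
    exact min_le_right _ _
  have h8 : min l 1 / 2 * ‖G‖ ^ 2
      ≤ min l 1 / 2 * (2 * (∑ i, G (horiz i) ^ 2 + G (0, 1) ^ 2)) := by gcongr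
  unfold density
  linarith

/-- The form is coercive. -/
lemma exists_coercive (hA : IsCoeff (volume.restrict Ω) A c C) {l : ℝ} (hl : 0 < l)
    (hell : ∀ᵐ x ∂(volume.restrict Ω), ∀ ξ : Fin n → ℝ,
      l * ∑ i, ξ i ^ 2 ≤ ∑ i, ∑ j, A x i j * ξ j * ξ i) (hs : s ∈ Ioo (0 : ℝ) 1)
    (hn : 1 ≤ n) (hΩ : IsOpen Ω) (hΩb : Bornology.IsBounded Ω) :
    ∃ κ : ℝ, 0 < κ ∧ ∀ p ∈ sobolevTriples s Ω (cylLow Ω ⊤) ⊤,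
      κ * ‖p‖ ^ 2 ≤ tripleForm hA s ⊤ p p := by
  obtain ⟨κ, hκ, hgrad⟩ := exists_grad_bound hA hl hell hs ⊤
  obtain ⟨C₁, hC₁, hpoin⟩ := exists_poincare (s := s) hn hΩ hΩb
  obtain ⟨C₂, hC₂, htr⟩ := exists_trace_bound (n := n) hΩ hs
  -- `K` dominates the three constants `C₁`, `1` and `C₂ (C₁ + 1)` by which the gradient controls
  -- the function, itself and the trace.
  set K := 1 + C₁ + C₂ * (C₁ + 1) with hK
  have hKpos : 0 < K := by positivity
  refine ⟨κ / K, by positivity, fun p hp => ?_⟩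
  have h1 := hpoin p hp
  have h2 := htr ⊤ p hp
  have h3 : ‖p‖ ^ 2 ≤ K * ‖p.2.1‖ ^ 2 := by
    have e2 : ‖p.2.1‖ ^ 2 ≤ K * ‖p.2.1‖ ^ 2 := le_mul_of_one_le_left (sq_nonneg _) (by
      have : 0 ≤ C₂ * (C₁ + 1) := by positivity
      linarith)
    have e1 : ‖p.1‖ ^ 2 ≤ K * ‖p.2.1‖ ^ 2 := h1.trans (by
      have : 0 ≤ C₂ * (C₁ + 1) := by positivity
      gcongr
      linarith)
    have e3 : ‖p.2.2‖ ^ 2 ≤ K * ‖p.2.1‖ ^ 2 := h2.trans (by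
      calc C₂ * (‖p.1‖ ^ 2 + ‖p.2.1‖ ^ 2) ≤ C₂ * (C₁ * ‖p.2.1‖ ^ 2 + ‖p.2.1‖ ^ 2) := by gcongr
        _ = C₂ * (C₁ + 1) * ‖p.2.1‖ ^ 2 := by ring
        _ ≤ _ := by gcongr; linarith)
    rw [Prod.norm_def, Prod.norm_def]
    rcases max_choice ‖p.1‖ (max ‖p.2.1‖ ‖p.2.2‖) with h | h <;> rw [h]
    · exact e1
    · rcases max_choice ‖p.2.1‖ ‖p.2.2‖ with h | h <;> rw [h]
      · exact e2
      · exact e3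
  calc κ / K * ‖p‖ ^ 2 ≤ κ / K * (K * ‖p.2.1‖ ^ 2) := by gcongr
    _ = κ * ‖p.2.1‖ ^ 2 := by field_simp
    _ ≤ _ := hgrad p

end CylForm

/-! ### Extension by zero and restriction of Sobolev functions -/

section Extension

open scoped ENNReal

variable {n : ℕ} {Ω : Set (EuclideanSpace ℝ (Fin n))} {s : ℝ}
  {A : EuclideanSpace ℝ (Fin n) → Matrix (Fin n) (Fin n) ℝ}
  {c : EuclideanSpace ℝ (Fin n) → ℝ} {C : ℝ}

lemma sobolevTriples_mono {U U' : Set (EuclideanSpace ℝ (Fin n) × ℝ)} (hU : U ⊆ U') (h : EReal) :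
    sobolevTriples s Ω U h ≤ sobolevTriples s Ω U' h :=
  closure_mono fun _ ⟨φ, hφ, hp⟩ => ⟨φ, hφ.mono hU, hp⟩

lemma sobolevTriples_le_top {h h' : EReal} :
    sobolevTriples (n := n) s Ω (cylLow Ω h) h' ≤ sobolevTriples s Ω (cylLow Ω ⊤) h' :=
  sobolevTriples_mono (cylLow_mono le_top) h'

lemma memLp_indicator_cyl (hΩ : IsOpen Ω) {h : EReal} {F : Type*} [NormedAddCommGroup F]
    {u : EuclideanSpace ℝ (Fin n) × ℝ → F} (hu : MemLp u 2 (cylMeasure Ω s h)) :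
    MemLp ((cyl Ω h).indicator u) 2 (cylMeasure Ω s ⊤) := by
  rwa [memLp_indicator_iff_restrict (measurableSet_cyl hΩ h), ← cylMeasure_eq_restrict hΩ]

lemma eLpNorm_sub_indicator (hΩ : IsOpen Ω) {h : EReal} {F : Type*} [NormedAddCommGroup F]
    {φ u : EuclideanSpace ℝ (Fin n) × ℝ → F} (hφ : ∀ p ∉ cylLow Ω h, φ p = 0) :
    eLpNorm (φ - (cyl Ω h).indicator u) 2 (cylMeasure Ω s ⊤)
      = eLpNorm (φ - u) 2 (cylMeasure Ω s h) := by
  rw [← eLpNorm_cyl_eq hΩ h]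
  · refine eLpNorm_congr_ae ?_
    filter_upwards [ae_mem_cyl hΩ h] with p hp
    simp [indicator_of_mem hp]
  · intro p hp hp'
    rw [Pi.sub_apply, indicator_of_notMem hp', hφ p fun h => hp' (mem_cyl_of_mem_cylLow hp h),
      sub_zero]

lemma ae_cyl_iff (hΩ : IsOpen Ω) {h : EReal} {Q : EuclideanSpace ℝ (Fin n) × ℝ → Prop} :
    (∀ᵐ x ∂(cylMeasure Ω s h), Q x) ↔ ∀ᵐ x ∂(cylMeasure Ω s ⊤), x ∈ cyl Ω h → Q x := by
  rw [cylMeasure_eq_restrict hΩ, ae_restrict_iff' (measurableSet_cyl hΩ h)]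

lemma integral_cyl_eq (hΩ : IsOpen Ω) {h : EReal} (u : EuclideanSpace ℝ (Fin n) × ℝ → ℝ) :
    ∫ x, u x ∂(cylMeasure Ω s h) = ∫ x, (cyl Ω h).indicator u x ∂(cylMeasure Ω s ⊤) := by
  rw [cylMeasure_eq_restrict hΩ, integral_indicator (measurableSet_cyl hΩ h)]

/-- The same test functions serve on both cylinders: they vanish above `h`, so their distances to
the extensions by zero are unchanged. -/
lemma mem_sobolevTriples_of_extend (hΩ : IsOpen Ω) (hs : s < 1) {h : EReal} {p : Triple Ω s h}
    (hp : p ∈ sobolevTriples s Ω (cylLow Ω h) h) {q : Triple Ω s ⊤}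
    (h1 : q.1 =ᵐ[cylMeasure Ω s ⊤] (cyl Ω h).indicator p.1)
    (h2 : q.2.1 =ᵐ[cylMeasure Ω s ⊤] (cyl Ω h).indicator p.2.1) (h3 : q.2.2 = p.2.2) :
    q ∈ sobolevTriples s Ω (cylLow Ω h) ⊤ := by
  obtain ⟨r, φ, hφ, hr, hlim⟩ := exists_seq_of_mem hp
  have hl := (tendsto_triple_iff hr).1 hlim
  choose r' hrm' hr' using fun k => exists_isTriple (Ω := Ω) hΩ hs ⊤ (hφ k)
  refine mem_sobolevTriples_of_tendsto hφ hr' ((tendsto_triple_iff hr').2 ⟨⟨?_, ?_⟩, ?_⟩)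
  · refine hl.1.1.congr fun k => ?_
    rw [← eLpNorm_sub_indicator hΩ (fun p hp => (hφ k).eq_zero hp)]
    exact eLpNorm_congr_ae ((EventuallyEq.refl _ _).sub h1.symm)
  · refine hl.1.2.congr fun k => ?_
    rw [← eLpNorm_sub_indicator hΩ (fun p hp => (hφ k).fderiv_eq_zero hp)]
    exact eLpNorm_congr_ae ((EventuallyEq.refl _ _).sub h2.symm)
  · rw [h3]
    exact hl.2

lemma exists_extend (hΩ : IsOpen Ω) (hs : s < 1) {h : EReal} {p : Triple Ω s h}
    (hp : p ∈ sobolevTriples s Ω (cylLow Ω h) h) :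
    ∃ p' ∈ sobolevTriples s Ω (cylLow Ω h) ⊤, p'.1 = E hΩ p.1 ∧
      p'.2.1 =ᵐ[cylMeasure Ω s ⊤] (cyl Ω h).indicator p.2.1 ∧ p'.2.2 = p.2.2 := by
  have hw : ∃ w, w = E hΩ p.1 ∧ w =ᵐ[cylMeasure Ω s ⊤] (cyl Ω h).indicator p.1 :=
    ⟨_, rfl, (memLp_extend hΩ p.1).coeFn_toLp⟩
  have hG : ∃ G : Lp (EuclideanSpace ℝ (Fin n) × ℝ →L[ℝ] ℝ) 2 (cylMeasure Ω s ⊤),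
      G =ᵐ[cylMeasure Ω s ⊤] (cyl Ω h).indicator p.2.1 :=
    ⟨_, (memLp_indicator_cyl hΩ (Lp.memLp p.2.1)).coeFn_toLp⟩
  obtain ⟨w, hw1, hw2⟩ := hw
  have hg : ∃ g, g = p.2.2 := ⟨_, rfl⟩
  obtain ⟨G, hG⟩ := hG
  obtain ⟨g, hg⟩ := hg
  exact ⟨(w, G, g), mem_sobolevTriples_of_extend hΩ hs hp hw2 hG hg, hw1, hG, hg⟩

lemma coeFn_E (hΩ : IsOpen Ω) {h : EReal} (u : L2C Ω s h) :
    E hΩ u =ᵐ[cylMeasure Ω s ⊤] (cyl Ω h).indicator u := (memLp_extend hΩ u).coeFn_toLp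

lemma density_zero (b : Fin n → EuclideanSpace ℝ (Fin n) × ℝ) (b₀ : EuclideanSpace ℝ (Fin n) × ℝ)
    (m : Matrix (Fin n) (Fin n) ℝ) (c : ℝ) (w : ℝ) (G : EuclideanSpace ℝ (Fin n) × ℝ →L[ℝ] ℝ) :
    density b b₀ m c 0 0 w G = 0 := by
  simp [density]

lemma tripleForm_extend (hA : IsCoeff (volume.restrict Ω) A c C) (hΩ : IsOpen Ω) {h : EReal}
    {p q : Triple Ω s h} {p' q' : Triple Ω s ⊤} (hp : p'.1 = E hΩ p.1)
    (hp' : p'.2.1 =ᵐ[cylMeasure Ω s ⊤] (cyl Ω h).indicator p.2.1) (hq : q'.1 = E hΩ q.1)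
    (hq' : q'.2.1 =ᵐ[cylMeasure Ω s ⊤] (cyl Ω h).indicator q.2.1) :
    tripleForm hA s ⊤ p' q' = tripleForm hA s h p q := by
  rw [tripleForm_apply, tripleForm_apply, energy_apply, energy_apply, integral_cyl_eq hΩ (h := h)]
  congr 1
  refine integral_congr_ae ?_
  filter_upwards [hp', hq', coeFn_E hΩ p.1, coeFn_E hΩ q.1] with x h1 h2 h3 h4
  simp only [hp, hq, h1, h2, h3, h4]
  by_cases hx : x ∈ cyl Ω h
  · simp only [indicator_of_mem hx]
  · simp only [indicator_of_notMem hx, density_zero]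

lemma coeFn_restr (h : EReal) (u : L2C Ω s ⊤) : restr h u =ᵐ[cylMeasure Ω s h] u :=
  (memLp_restrict h u).coeFn_toLp

/-- Restriction does not increase norms. The approximating functions must be supported below `h`;
otherwise the restriction need not vanish on the top. -/
lemma mem_sobolevTriples_of_restrict (hΩ : IsOpen Ω) (hs : s < 1) {h : EReal} {p : Triple Ω s ⊤}
    (hp : p ∈ sobolevTriples s Ω (cylLow Ω h) ⊤) {q : Triple Ω s h}
    (h1 : q.1 =ᵐ[cylMeasure Ω s h] p.1) (h2 : q.2.1 =ᵐ[cylMeasure Ω s h] p.2.1)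
    (h3 : q.2.2 = p.2.2) : q ∈ sobolevTriples s Ω (cylLow Ω h) h := by
  obtain ⟨r, φ, hφ, hr, hlim⟩ := exists_seq_of_mem hp
  have hl := (tendsto_triple_iff hr).1 hlim
  choose r' hrm' hr' using fun k => exists_isTriple (Ω := Ω) hΩ hs h (hφ k)
  refine mem_sobolevTriples_of_tendsto hφ hr' ((tendsto_triple_iff hr').2 ⟨⟨?_, ?_⟩, ?_⟩)
  · refine tendsto_of_tendsto_of_tendsto_of_le_of_le tendsto_const_nhds hl.1.1 (fun _ => zero_le)
      fun k => ?_
    refine (eLpNorm_congr_ae ((EventuallyEq.refl _ _).sub h1)).trans_le ?_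
    exact eLpNorm_mono_measure _ (cylMeasure_mono h)
  · refine tendsto_of_tendsto_of_tendsto_of_le_of_le tendsto_const_nhds hl.1.2 (fun _ => zero_le)
      fun k => ?_
    refine (eLpNorm_congr_ae ((EventuallyEq.refl _ _).sub h2)).trans_le ?_
    exact eLpNorm_mono_measure _ (cylMeasure_mono h)
  · rw [h3]
    exact hl.2

lemma exists_restrict (hΩ : IsOpen Ω) (hs : s < 1) {h : EReal} {p : Triple Ω s ⊤}
    (hp : p ∈ sobolevTriples s Ω (cylLow Ω h) ⊤) :
    ∃ p' ∈ sobolevTriples s Ω (cylLow Ω h) h, p'.1 = restr h p.1 ∧ p'.2.2 = p.2.2 := by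
  have hG : ∃ G : Lp (EuclideanSpace ℝ (Fin n) × ℝ →L[ℝ] ℝ) 2 (cylMeasure Ω s h),
      G =ᵐ[cylMeasure Ω s h] p.2.1 :=
    ⟨_, ((Lp.memLp p.2.1).mono_measure (cylMeasure_mono h)).coeFn_toLp⟩
  have hw : ∃ w, w = restr h p.1 ∧ w =ᵐ[cylMeasure Ω s h] p.1 := ⟨_, rfl, coeFn_restr h p.1⟩
  have hg : ∃ g, g = p.2.2 := ⟨_, rfl⟩
  obtain ⟨w, hw1, hw2⟩ := hw
  obtain ⟨G, hG⟩ := hG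
  obtain ⟨g, hg⟩ := hg
  exact ⟨(w, G, g), mem_sobolevTriples_of_restrict hΩ hs hp hw2 hG hg, hw1, hg⟩

lemma E_restr (hΩ : IsOpen Ω) {h : EReal} {u : L2C Ω s ⊤}
    (hu : ∀ᵐ p ∂(cylMeasure Ω s ⊤), p ∉ cyl Ω h → u p = 0) : E hΩ (restr h u) = u := by
  refine Lp.ext ((coeFn_E hΩ _).trans ?_)
  have h1 := coeFn_restr h u
  rw [EventuallyEq, ae_cyl_iff hΩ] at h1
  filter_upwards [h1, hu] with x h2 h3
  by_cases hx : x ∈ cyl Ω h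
  · rw [indicator_of_mem hx, h2 hx]
  · rw [indicator_of_notMem hx, h3 hx]

/-- On `y > 0` the weighted and the Lebesgue measure have the same null sets, and `Ω × (τ, ∞)`
differs from the complement of the truncated cylinder by a piece of the plane `y = τ`, which is
null. -/
lemma ae_above_iff (hΩ : IsOpen Ω) {τ : ℝ} (hτ : 0 < τ)
    {Q : EuclideanSpace ℝ (Fin n) × ℝ → Prop} :
    (∀ᵐ p ∂(volume.restrict (Ω ×ˢ Ioi τ)), Q p) ↔
      ∀ᵐ p ∂(cylMeasure Ω s ⊤), p ∉ cyl Ω τ → Q p := by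
  have hplane : ∀ᵐ p ∂(volume : Measure (EuclideanSpace ℝ (Fin n) × ℝ)), p.2 ≠ τ := by
    have h1 : ∀ᵐ y ∂(volume : Measure ℝ), y ≠ τ := by
      simp [ae_iff]
    exact Measure.quasiMeasurePreserving_snd (μ := (volume : Measure (EuclideanSpace ℝ (Fin n))))
      (ν := (volume : Measure ℝ)) |>.ae h1
  have hac : (volume.restrict (cyl Ω ⊤)) ≪ cylMeasure Ω s ⊤ := by
    unfold cylMeasure
    rw [restrict_withDensity (measurableSet_cyl hΩ ⊤)]
    refine withDensity_absolutelyContinuous'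
      ((measurable_ofReal_rpow s).comp measurable_snd).aemeasurable ?_
    refine (ae_restrict_mem (measurableSet_cyl hΩ ⊤)).mono fun p hp => ?_
    have : 0 < p.2 ^ (1 - 2 * s) := Real.rpow_pos_of_pos hp.2.1 _
    simpa using this
  have hac' : cylMeasure Ω s ⊤ ≪ volume.restrict (cyl Ω ⊤) :=
    (withDensity_absolutelyContinuous _ _).restrict _
  have hiff : (∀ᵐ p ∂(cylMeasure Ω s ⊤), p ∉ cyl Ω τ → Q p) ↔
      ∀ᵐ p ∂(volume.restrict (cyl Ω ⊤)), p ∉ cyl Ω τ → Q p :=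
    ⟨fun h => hac.ae_le h, fun h => hac'.ae_le h⟩
  rw [hiff, ae_restrict_iff' (hΩ.measurableSet.prod measurableSet_Ioi),
    ae_restrict_iff' (measurableSet_cyl hΩ ⊤)]
  constructor
  · intro h
    filter_upwards [h, hplane] with p h1 h2 h3 h4
    refine h1 ⟨h3.1, ?_⟩
    refine lt_of_le_of_ne ?_ (Ne.symm h2)
    by_contra hlt
    exact h4 ⟨h3.1, h3.2.1, by exact_mod_cast not_le.1 hlt⟩
  · intro h
    filter_upwards [h] with p h1 h2
    refine h1 ⟨h2.1, hτ.trans h2.2, EReal.coe_lt_top _⟩ fun h3 => ?_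
    have h4 : p.2 < τ := by exact_mod_cast h3.2.2
    exact absurd h2.2 (not_lt.2 h4.le)

end Extension

/-! ### The positive part -/

section PosPart

variable {n : ℕ} {Ω : Set (EuclideanSpace ℝ (Fin n))} {s : ℝ}
  {A : EuclideanSpace ℝ (Fin n) → Matrix (Fin n) (Fin n) ℝ}
  {c : EuclideanSpace ℝ (Fin n) → ℝ} {C : ℝ}

/-- By the chain rule a contraction that fixes `0` multiplies the gradient by some `t` with `|t| ≤
1` and shrinks the values; each of the non-negative terms of the density decreases. -/
lemma density_contract_le {X : Type*} [NormedAddCommGroup X] [NormedSpace ℝ X] (b : Fin n → X)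
    (b₀ : X) {m : Matrix (Fin n) (Fin n) ℝ} {c : ℝ}
    (hm : ∀ ξ : Fin n → ℝ, 0 ≤ ∑ i, ∑ j, m i j * ξ j * ξ i) (hc : 0 ≤ c) {w w' t : ℝ}
    (G : X →L[ℝ] ℝ) (ht : |t| ≤ 1) (hw : |w'| ≤ |w|) :
    density b b₀ m c w' (t • G) w' (t • G) ≤ density b b₀ m c w G w G := by
  have h1 : 0 ≤ ∑ i, ∑ j, m i j * G (b j) * G (b i) := hm fun i => G (b i)
  have h2 : ∑ i, ∑ j, m i j * (t • G) (b j) * (t • G) (b i)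
      = t ^ 2 * ∑ i, ∑ j, m i j * G (b j) * G (b i) := by
    simp only [smul_apply, smul_eq_mul, Finset.mul_sum]
    refine Finset.sum_congr rfl fun i _ => Finset.sum_congr rfl fun j _ => ?_
    ring
  have h3 : t ^ 2 ≤ 1 := (sq_le_one_iff_abs_le_one t).2 ht
  have h4 : w' ^ 2 ≤ w ^ 2 := sq_le_sq.2 hw
  have h5 : c * w' ^ 2 ≤ c * w ^ 2 := by gcongr
  have h6 : t ^ 2 * ∑ i, ∑ j, m i j * G (b j) * G (b i)
      ≤ 1 * ∑ i, ∑ j, m i j * G (b j) * G (b i) := by gcongr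
  have h7 : t ^ 2 * G b₀ ^ 2 ≤ 1 * G b₀ ^ 2 := by gcongr
  unfold density
  rw [h2]
  simp only [smul_apply, smul_eq_mul]
  nlinarith

/-- A uniform error `ε` on a set of finite measure is an `L²` error, and off that set there is none.
-/
lemma norm_sub_sup_le {α : Type*} [MeasurableSpace α] {μ : Measure α} {p q : Lp ℝ 2 μ}
    {φ ψ : α → ℝ} (hp : p =ᵐ[μ] φ) (hq : q =ᵐ[μ] ψ) {K : Set α} (hK : MeasurableSet K)
    (hμK : μ K ≠ ⊤) {ε : ℝ} (h : ∀ x, |ψ x - max (φ x) 0| ≤ ε)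
    (h0 : ∀ x ∉ K, φ x = 0 ∧ ψ x = 0) :
    ‖q - p ⊔ 0‖ ≤ ε * ‖indicatorConstLp 2 hK hμK (1 : ℝ)‖ := by
  refine Lp.norm_le_mul_norm_of_ae_le_mul ?_
  filter_upwards [hp, hq, Lp.coeFn_sub q (p ⊔ 0), Lp.coeFn_sup p 0, Lp.coeFn_zero ℝ 2 μ,
    indicatorConstLp_coeFn (p := 2) (hs := hK) (hμs := hμK) (c := (1 : ℝ))] with x h1 h2 h3 h4 h5 h6
  rw [h3, Pi.sub_apply, h4, Pi.sup_apply, h5, h1, h2, h6, Pi.zero_apply]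
  by_cases hx : x ∈ K
  · rw [indicator_of_mem hx, norm_one, mul_one]
    exact h x
  · rw [indicator_of_notMem hx, (h0 x hx).1, (h0 x hx).2]
    simp

/-- Compose `φ` with the smoothed positive part. The result is again a test function in `U`, with
pointwise smaller energy density. -/
lemma exists_test_posPart (hA : IsCoeff (volume.restrict Ω) A c C) (hs : s ∈ Ioo (0 : ℝ) 1)
    (hΩ : IsOpen Ω) {h : EReal} {U} {φ : EuclideanSpace ℝ (Fin n) × ℝ → ℝ} (hφ : IsTest U φ)
    {p : Triple Ω s h} (hp : IsTriple p φ) {ε : ℝ} (hε : 0 < ε) :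
    ∃ q ∈ testTriples s Ω U h, tripleForm hA s h q q ≤ tripleForm hA s h p p ∧
      ‖q.1 - p.1 ⊔ 0‖ ≤ ε ∧ ‖q.2.2 - p.2.2 ⊔ 0‖ ≤ ε := by
  have hfin := (isWeight_cyl hΩ hs.2 h).fin
  have hK : IsCompact (tsupport φ) := hφ.2.1
  have hμK : cylMeasure Ω s h (tsupport φ) ≠ ⊤ := hK.measure_lt_top.ne
  have hK' : IsCompact (tsupport fun x => φ (x, 0)) := hasCompactSupport_slice hφ.2.1 0
  have hμK' : volume.restrict Ω (tsupport fun x => φ (x, 0)) ≠ ⊤ :=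
    ((Measure.restrict_le_self _).trans_lt hK'.measure_lt_top).ne
  set N₁ := ‖indicatorConstLp 2 hK.measurableSet hμK (1 : ℝ)‖ with hN₁
  set N₂ := ‖indicatorConstLp 2 hK'.measurableSet hμK' (1 : ℝ)‖ with hN₂
  have hN₁' : N₁ ≤ N₁ + N₂ := le_add_of_nonneg_right (norm_nonneg _)
  have hN₂' : N₂ ≤ N₁ + N₂ := le_add_of_nonneg_left (norm_nonneg _)
  -- The uniform error is divided by the `L²` norms of the indicators of the two supports, so that
  -- both `L²` errors stay below `ε`.
  have hε' : 0 < ε / (N₁ + N₂ + 1) := by positivity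
  obtain ⟨θ, hθ, hθ0, hθ1, hθ2, hθ3⟩ := exists_smooth_posPart hε'
  have hψ : IsTest U (θ ∘ φ) := ⟨hθ.comp hφ.1, hφ.2.1.comp_left hθ0,
    (closure_mono (Function.support_comp_subset hθ0 φ)).trans hφ.2.2⟩
  obtain ⟨q, hqm, hq⟩ := exists_isTriple (Ω := Ω) hΩ hs.2 h hψ
  have hsmall : ∀ N, 0 ≤ N → N ≤ N₁ + N₂ → ε / (N₁ + N₂ + 1) * N ≤ ε := by
    intro N hN0 hN
    rw [div_mul_eq_mul_div, div_le_iff₀ (by positivity)]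
    gcongr
    linarith
  refine ⟨q, hqm, ?_, ?_, ?_⟩
  · have hd := dConst_pos hs
    rw [tripleForm_apply, tripleForm_apply, energy_apply, energy_apply]
    refine mul_le_mul_of_nonneg_left ?_ (by positivity)
    refine integral_mono_ae
      ((hA.cyl s h).integrable _ _ (Lp.memLp _) (Lp.memLp _) (Lp.memLp _) (Lp.memLp _))
      ((hA.cyl s h).integrable _ _ (Lp.memLp _) (Lp.memLp _) (Lp.memLp _) (Lp.memLp _)) ?_
    filter_upwards [hp.1, hp.2.1, hq.1, hq.2.1, (hA.cyl s h).pos, (hA.cyl s h).posc]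
      with x h1 h2 h3 h4 h5 h6
    have hd : fderiv ℝ (θ ∘ φ) x = deriv θ (φ x) • fderiv ℝ φ x :=
      (((hθ.differentiable (by simp) (φ x)).hasDerivAt).comp_hasFDerivAt x
        (hφ.differentiable x).hasFDerivAt).fderiv
    simp only [h1, h2, h3, h4, hd]
    exact density_contract_le _ _ h5 h6 _ (hθ3 _) (hθ2 _)
  · refine (norm_sub_sup_le hp.1 hq.1 hK.measurableSet hμK (fun x => hθ1 (φ x)) ?_).trans
      (hsmall _ (norm_nonneg _) hN₁')
    intro x hx
    have h0 := image_eq_zero_of_notMem_tsupport hx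
    exact ⟨h0, by simp [h0, hθ0]⟩
  · refine (norm_sub_sup_le hp.2.2 hq.2.2 hK'.measurableSet hμK' (fun x => hθ1 (φ (x, 0)))
      ?_).trans (hsmall _ (norm_nonneg _) hN₂')
    intro x hx
    have h0 : φ (x, 0) = 0 := image_eq_zero_of_notMem_tsupport (f := fun x => φ (x, 0)) hx
    exact ⟨h0, by simp [h0, hθ0]⟩

/-- Positive parts of Sobolev functions are Sobolev functions with smaller energy. -/
lemma exists_posPart (hA : IsCoeff (volume.restrict Ω) A c C) (hs : s ∈ Ioo (0 : ℝ) 1)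
    (hΩ : IsOpen Ω) {U} {κ : ℝ} (hκ : 0 < κ)
    (hco : ∀ p ∈ sobolevTriples s Ω U ⊤, κ * ‖p‖ ^ 2 ≤ tripleForm hA s ⊤ p p)
    {p : Triple Ω s ⊤} (hp : p ∈ sobolevTriples s Ω U ⊤) :
    ∃ q ∈ sobolevTriples s Ω U ⊤, q.1 = p.1 ⊔ 0 ∧ q.2.2 = p.2.2 ⊔ 0 ∧
      tripleForm hA s ⊤ q q ≤ tripleForm hA s ⊤ p p := by
  obtain ⟨q, φ, hφ, hq, hlim⟩ := exists_seq_of_mem hp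
  have hpos : ∀ k : ℕ, (0 : ℝ) < 1 / ((k : ℝ) + 1) := fun k => Nat.one_div_pos_of_nat
  choose r hrm hra hr1 hr2 using fun k => exists_test_posPart hA hs hΩ (hφ k) (hq k) (hpos k)
  have hb := isBddSymm_tripleForm hA hs ⊤
  let T : Triple Ω s ⊤ →L[ℝ] L2C Ω s ⊤ × L2 Ω :=
    (ContinuousLinearMap.fst ℝ _ _).prod
      (ContinuousLinearMap.snd ℝ _ _ ∘L ContinuousLinearMap.snd ℝ _ _)
  have hT : ∀ p, T p = (p.1, p.2.2) := fun p => rfl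
  have hz := tendsto_one_div_add_atTop_nhds_zero_nat (𝕜 := ℝ)
  have hl1 : Tendsto (fun k => (q k).1) atTop (𝓝 p.1) := (continuous_fst.tendsto _).comp hlim
  have hl2 : Tendsto (fun k => (q k).2.2) atTop (𝓝 p.2.2) :=
    ((continuous_snd.comp continuous_snd).tendsto _).comp hlim
  have t1 : Tendsto (fun k => (r k).1) atTop (𝓝 (p.1 ⊔ 0)) := by
    have h1 : Tendsto (fun k => (q k).1 ⊔ 0) atTop (𝓝 (p.1 ⊔ 0)) :=
      hl1.sup_nhds tendsto_const_nhds
    have h2 : Tendsto (fun k => (r k).1 - (q k).1 ⊔ 0) atTop (𝓝 0) :=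
      squeeze_zero_norm hr1 hz
    simpa using h2.add h1
  have t2 : Tendsto (fun k => (r k).2.2) atTop (𝓝 (p.2.2 ⊔ 0)) := by
    have h1 : Tendsto (fun k => (q k).2.2 ⊔ 0) atTop (𝓝 (p.2.2 ⊔ 0)) :=
      hl2.sup_nhds tendsto_const_nhds
    have h2 : Tendsto (fun k => (r k).2.2 - (q k).2.2 ⊔ 0) atTop (𝓝 0) :=
      squeeze_zero_norm hr2 hz
    simpa using h2.add h1
  -- Functions and traces converge to the positive parts, but for the gradients only the energy
  -- bound is available. The weak limit keeps the first and third entries and inherits the bound.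
  obtain ⟨z, hz, hTz, haz⟩ := hb.exists_weak_limit hκ isClosed_sobolevTriples hco T
    (fun k => Submodule.le_topologicalClosure _ (hrm k))
    ((hb.continuous_diag.tendsto p).comp hlim) hra (t1.prodMk_nhds t2)
  rw [hT] at hTz
  exact ⟨z, hz, congrArg Prod.fst hTz, congrArg Prod.snd hTz, haz⟩

end PosPart

/-! ### Functions vanishing above a given height -/

section Strip

open scoped ENNReal

variable {n : ℕ} {Ω : Set (EuclideanSpace ℝ (Fin n))} {s : ℝ}
  {A : EuclideanSpace ℝ (Fin n) → Matrix (Fin n) (Fin n) ℝ}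
  {c : EuclideanSpace ℝ (Fin n) → ℝ} {C : ℝ}

lemma setLIntegral_cyl (hΩ : IsOpen Ω) {I : Set ℝ} (hI : MeasurableSet I) (hI0 : I ⊆ Ioi 0)
    {g : EuclideanSpace ℝ (Fin n) × ℝ → ℝ≥0∞} (hg : Measurable g) :
    ∫⁻ p in Ω ×ˢ I, g p ∂(cylMeasure Ω s ⊤)
      = ∫⁻ p in Ω ×ˢ I, ENNReal.ofReal (p.2 ^ (1 - 2 * s)) * g p := by
  have hsub : Ω ×ˢ I ⊆ cyl Ω ⊤ := by
    rw [cyl_top]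
    exact prod_mono le_rfl hI0
  have hm : Measurable fun p : EuclideanSpace ℝ (Fin n) × ℝ =>
      ENNReal.ofReal (p.2 ^ (1 - 2 * s)) := (measurable_ofReal_rpow s).comp measurable_snd
  unfold cylMeasure
  rw [Measure.restrict_restrict (hΩ.measurableSet.prod hI), inter_eq_self_of_subset_left hsub,
    setLIntegral_withDensity_eq_setLIntegral_mul _ hm hg (hΩ.measurableSet.prod hI)]
  rfl

/-- Comparison of the weight with Lebesgue measure away from `y = 0`. -/
lemma exists_weight_bounds {a b : ℝ} (ha : 0 < a) (hab : a ≤ b) (s : ℝ) :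
    ∃ m M : ℝ, 0 < m ∧ 0 < M ∧ ∀ y ∈ Icc a b, m ≤ y ^ (1 - 2 * s) ∧ y ^ (1 - 2 * s) ≤ M := by
  have hc : ContinuousOn (fun y : ℝ => y ^ (1 - 2 * s)) (Icc a b) := fun y hy =>
    (Real.continuousAt_rpow_const _ _ (Or.inl (ha.trans_le hy.1).ne')).continuousWithinAt
  obtain ⟨y₁, h₁, hmin⟩ := isCompact_Icc.exists_isMinOn (nonempty_Icc.2 hab) hc
  obtain ⟨y₂, h₂, hmax⟩ := isCompact_Icc.exists_isMaxOn (nonempty_Icc.2 hab) hc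
  exact ⟨_, _, Real.rpow_pos_of_pos (ha.trans_le h₁.1) _, Real.rpow_pos_of_pos (ha.trans_le h₂.1) _,
    fun y hy => ⟨hmin hy, hmax hy⟩⟩

/-- The mass of a smooth function in a strip is controlled by its mass in the next strip and by its
vertical derivative. -/
lemma strip_bound (hΩ : IsOpen Ω) {τ δ m M : ℝ} (hδ : 0 < δ) (hδτ : 4 * δ ≤ τ)
    (hm : 0 < m) (hM : 0 < M)
    (hw : ∀ y ∈ Icc (τ / 2) (3 * τ / 2), m ≤ y ^ (1 - 2 * s) ∧ y ^ (1 - 2 * s) ≤ M)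
    {φ : EuclideanSpace ℝ (Fin n) × ℝ → ℝ} (hφ : ContDiff ℝ 1 φ) :
    ∫⁻ p in Ω ×ˢ Ico (τ - 2 * δ) τ, ‖φ p‖ₑ ^ 2 ∂(cylMeasure Ω s ⊤)
      ≤ ENNReal.ofReal (M / m) *
        (2 * ∫⁻ p in Ω ×ˢ Ici τ, ‖φ p‖ₑ ^ 2 ∂(cylMeasure Ω s ⊤)
          + 2 * ENNReal.ofReal ((2 * δ) ^ 2) * ∫⁻ p, ‖fderiv ℝ φ p‖ₑ ^ 2 ∂(cylMeasure Ω s ⊤)) := by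
  have hmeas : Measurable fun p => ‖φ p‖ₑ ^ 2 := hφ.continuous.measurable.enorm.pow_const 2
  have hmeas' : Measurable fun p => ‖fderiv ℝ φ p (0, 1)‖ₑ ^ 2 :=
    (((hφ.continuous_fderiv one_ne_zero).clm_apply continuous_const).measurable.enorm).pow_const 2
  have hν : ∀ t : ℝ, MeasurePreserving (fun p : EuclideanSpace ℝ (Fin n) × ℝ =>
      p + t • ((0, 1) : EuclideanSpace ℝ (Fin n) × ℝ)) volume volume := fun t =>
    measurePreserving_add_right _ _
  -- A vertical shift by `2 δ` moves the strip into heights `≥ τ`. Since `4 δ ≤ τ`, the whole path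
  -- stays in `[τ / 2, 3 τ / 2]`, where the weight is comparable to a constant. Lebesgue measure is
  -- used because the weighted one is not invariant under vertical shifts.
  have key := lintegral_sq_le_of_translate (ν := volume) (S := Ω ×ˢ Ico (τ - 2 * δ) τ)
    (S' := Ω ×ˢ Icc (τ / 2) (3 * τ / 2)) hφ ((0, 1) : EuclideanSpace ℝ (Fin n) × ℝ)
    (show 0 ≤ 2 * δ by positivity) (hΩ.measurableSet.prod measurableSet_Icc) (by
      rintro ⟨x, y⟩ ⟨hx, hy⟩ t ht
      refine ⟨by simpa using hx, ?_⟩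
      simp only [Prod.snd_add, Prod.smul_snd, smul_eq_mul, mul_one, mem_Icc]
      simp only [mem_Ico, mem_Ioc] at hy ht
      constructor <;> linarith [hy.1, hy.2, ht.1, ht.2]) hν
  -- the translated term
  have h1 : ∫⁻ p in Ω ×ˢ Ico (τ - 2 * δ) τ,
      ‖φ (p + (2 * δ) • ((0, 1) : EuclideanSpace ℝ (Fin n) × ℝ))‖ₑ ^ 2
      ≤ ∫⁻ p in Ω ×ˢ Icc τ (3 * τ / 2), ‖φ p‖ₑ ^ 2 := by
    rw [← (hν (2 * δ)).setLIntegral_comp_preimage (hΩ.measurableSet.prod measurableSet_Icc) hmeas]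
    refine lintegral_mono_set ?_
    rintro ⟨x, y⟩ ⟨hx, hy⟩
    refine ⟨by simpa using hx, ?_⟩
    simp only [Prod.snd_add, Prod.smul_snd, smul_eq_mul, mul_one, mem_Icc]
    simp only [mem_Ico] at hy
    constructor <;> linarith [hy.1, hy.2]
  -- from Lebesgue measure to the weight and back
  have hup : ∀ {I : Set ℝ}, MeasurableSet I → I ⊆ Icc (τ / 2) (3 * τ / 2) →
      ∀ {g : EuclideanSpace ℝ (Fin n) × ℝ → ℝ≥0∞}, Measurable g →
      ∫⁻ p in Ω ×ˢ I, g p ∂(cylMeasure Ω s ⊤) ≤ ENNReal.ofReal M * ∫⁻ p in Ω ×ˢ I, g p := by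
    intro I hI hsub g hg
    rw [setLIntegral_cyl hΩ hI (fun y hy => lt_of_lt_of_le (by linarith) (hsub hy).1) hg,
      ← lintegral_const_mul _ hg]
    refine setLIntegral_mono' (hΩ.measurableSet.prod hI) fun p hp => ?_
    gcongr
    exact (hw _ (hsub hp.2)).2
  have hdown : ∀ {I : Set ℝ}, MeasurableSet I → I ⊆ Icc (τ / 2) (3 * τ / 2) →
      ∀ {g : EuclideanSpace ℝ (Fin n) × ℝ → ℝ≥0∞}, Measurable g →
      ∫⁻ p in Ω ×ˢ I, g p ≤ ENNReal.ofReal m⁻¹ *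
        ∫⁻ p in Ω ×ˢ I, g p ∂(cylMeasure Ω s ⊤) := by
    intro I hI hsub g hg
    have hmeasw : Measurable fun p : EuclideanSpace ℝ (Fin n) × ℝ =>
        ENNReal.ofReal (p.2 ^ (1 - 2 * s)) * g p :=
      ((measurable_ofReal_rpow s).comp measurable_snd).mul hg
    rw [setLIntegral_cyl hΩ hI (fun y hy => lt_of_lt_of_le (by linarith) (hsub hy).1) hg,
      ← lintegral_const_mul _ hmeasw]
    refine setLIntegral_mono' (hΩ.measurableSet.prod hI) fun p hp => ?_
    rw [← mul_assoc, ← ENNReal.ofReal_mul (by positivity)]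
    refine le_mul_of_one_le_left zero_le ?_
    rw [← ENNReal.ofReal_one]
    refine ENNReal.ofReal_le_ofReal ?_
    rw [inv_mul_eq_div, one_le_div hm]
    exact (hw _ (hsub hp.2)).1
  have h2 := hdown (I := Icc τ (3 * τ / 2)) measurableSet_Icc
    (Icc_subset_Icc (by linarith) le_rfl) hmeas
  have h3 := hdown (I := Icc (τ / 2) (3 * τ / 2)) measurableSet_Icc le_rfl hmeas'
  have h4 : ∫⁻ p in Ω ×ˢ Icc τ (3 * τ / 2), ‖φ p‖ₑ ^ 2 ∂(cylMeasure Ω s ⊤)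
      ≤ ∫⁻ p in Ω ×ˢ Ici τ, ‖φ p‖ₑ ^ 2 ∂(cylMeasure Ω s ⊤) :=
    lintegral_mono_set (prod_mono le_rfl Icc_subset_Ici_self)
  have h5 : ∫⁻ p in Ω ×ˢ Icc (τ / 2) (3 * τ / 2), ‖fderiv ℝ φ p (0, 1)‖ₑ ^ 2 ∂(cylMeasure Ω s ⊤)
      ≤ ∫⁻ p, ‖fderiv ℝ φ p‖ₑ ^ 2 ∂(cylMeasure Ω s ⊤) := by
    refine (setLIntegral_le_lintegral _ _).trans (lintegral_mono fun p => ?_)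
    gcongr
    rw [← ofReal_norm, ← ofReal_norm]
    refine ENNReal.ofReal_le_ofReal (((fderiv ℝ φ p).le_opNorm _).trans ?_)
    rw [norm_vertical, mul_one]
  have h6 := hup (I := Ico (τ - 2 * δ) τ) measurableSet_Ico
    (fun y hy => ⟨by linarith [hy.1], by linarith [hy.2]⟩) hmeas
  set X := ∫⁻ p in Ω ×ˢ Ici τ, ‖φ p‖ₑ ^ 2 ∂(cylMeasure Ω s ⊤)
  set Y := ∫⁻ p, ‖fderiv ℝ φ p‖ₑ ^ 2 ∂(cylMeasure Ω s ⊤)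
  calc _ ≤ ENNReal.ofReal M * (2 * (ENNReal.ofReal m⁻¹ * X)
        + 2 * ENNReal.ofReal ((2 * δ) ^ 2) * (ENNReal.ofReal m⁻¹ * Y)) := by
        refine h6.trans (mul_le_mul_right (key.trans ?_) _)
        refine add_le_add (mul_le_mul_right ?_ _) (mul_le_mul_right ?_ _)
        · exact h1.trans (h2.trans (mul_le_mul_right h4 _))
        · exact h3.trans (mul_le_mul_right h5 _)
    _ = _ := by
        rw [div_eq_mul_inv, ENNReal.ofReal_mul hM.le]
        ring

lemma norm_sq_le_ofReal {α F : Type*} [MeasurableSpace α] {μ : Measure α}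
    [NormedAddCommGroup F] (u : Lp F 2 μ) {B : ℝ} (hB : 0 ≤ B)
    (h : ∫⁻ x, ‖u x‖ₑ ^ 2 ∂μ ≤ ENNReal.ofReal B) : ‖u‖ ^ 2 ≤ B := by
  rw [← ofReal_norm_sq_eq_lintegral] at h
  exact (ENNReal.ofReal_le_ofReal_iff hB).1 h

/-- Approximation by test functions supported below the height above which a function vanishes. -/
lemma exists_cutoff_approx (hΩ : IsOpen Ω) (hs : s ∈ Ioo (0 : ℝ) 1) {τ : ℝ} (hτ : 0 < τ)
    {p : Triple Ω s ⊤} (hp : p ∈ sobolevTriples s Ω (cylLow Ω ⊤) ⊤)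
    (h0 : ∀ᵐ x ∂(cylMeasure Ω s ⊤), x ∉ cyl Ω τ → p.1 x = 0) :
    ∃ B : ℝ, 0 ≤ B ∧ ∀ δ : ℝ, 0 < δ → 4 * δ ≤ τ → δ ≤ 1 → ∃ r ∈ testTriples s Ω (cylLow Ω τ) ⊤,
      ‖r.1 - p.1‖ ≤ B * δ ∧ ‖r.2.1‖ ^ 2 ≤ B := by
  obtain ⟨Cη, hCη, hcut⟩ := exists_cutoff
  obtain ⟨m, M, hm, hM, hw⟩ := exists_weight_bounds (a := τ / 2) (b := 3 * τ / 2) (by positivity)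
    (by linarith) s
  set N := (‖p‖ + 1) ^ 2 with hN
  -- `B₀ δ²` bounds the mass of `φ` above `τ - 2 δ`: the first summand is the strip below `τ`, the
  -- `1` is the part above `τ`.
  set B₀ := M / m * (2 + 8 * N) + 1 with hB₀
  have hB₀pos : 0 ≤ B₀ := by positivity
  set B := 1 + Real.sqrt B₀ + (2 * N + 2 * Cη ^ 2 * B₀) with hB
  refine ⟨B, by positivity, fun δ hδ hδτ hδ1 => ?_⟩
  -- The accuracy of the approximation equals the width of the cutoff. As `p` vanishes above `τ`,
  -- the mass of `φ` there is then at most `δ²`.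
  obtain ⟨q, ⟨φ, hφ, hq⟩, hqp⟩ := Metric.mem_closure_iff.1 hp δ hδ
  rw [dist_comm, dist_eq_norm] at hqp
  obtain ⟨η, hη, hη1, hη2, hη3, hη4, hη5⟩ := hcut τ δ hδ
  have hqp1 : ‖q.1 - p.1‖ ≤ δ := (norm_fst_le (q - p)).trans hqp.le
  have hq2 : ‖q.2.1‖ ^ 2 ≤ N := by
    have e1 : ‖q‖ ≤ ‖p‖ + 1 := by
      have := norm_add_le (q - p) p
      rw [sub_add_cancel] at this
      linarith
    have e2 : ‖q.2.1‖ ≤ ‖p‖ + 1 := ((norm_fst_le q.2).trans (norm_snd_le q)).trans e1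
    rw [hN]
    gcongr
  -- the mass above the height `τ`
  have habove : ∫⁻ x in Ω ×ˢ Ici τ, ‖φ x‖ₑ ^ 2 ∂(cylMeasure Ω s ⊤) ≤ ENNReal.ofReal (δ ^ 2) := by
    have hle : ENNReal.ofReal (‖q.1 - p.1‖ ^ 2) ≤ ENNReal.ofReal (δ ^ 2) :=
      ENNReal.ofReal_le_ofReal (by gcongr)
    rw [ofReal_norm_sq_eq_lintegral] at hle
    refine le_trans ?_ hle
    rw [← lintegral_indicator (hΩ.measurableSet.prod measurableSet_Ici)]
    refine lintegral_mono_ae ?_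
    filter_upwards [h0, hq.1, Lp.coeFn_sub q.1 p.1] with x h1 h2 h3
    by_cases hx : x ∈ Ω ×ˢ Ici τ
    · have hx' : x ∉ cyl Ω τ := fun h => by
        have h4 : x.2 < τ := by exact_mod_cast h.2.2
        exact absurd hx.2 (not_le.2 h4)
      rw [indicator_of_mem hx, h3, Pi.sub_apply, h1 hx', h2, sub_zero]
    · rw [indicator_of_notMem hx]
      exact zero_le
  have hgrad : ∫⁻ x, ‖fderiv ℝ φ x‖ₑ ^ 2 ∂(cylMeasure Ω s ⊤) ≤ ENNReal.ofReal N := by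
    have e1 : ∫⁻ x, ‖fderiv ℝ φ x‖ₑ ^ 2 ∂(cylMeasure Ω s ⊤) = ENNReal.ofReal (‖q.2.1‖ ^ 2) := by
      rw [ofReal_norm_sq_eq_lintegral]
      refine lintegral_congr_ae ?_
      filter_upwards [hq.2.1] with x hx
      rw [hx]
    rw [e1]
    exact ENNReal.ofReal_le_ofReal hq2
  have hstrip : ∫⁻ x in Ω ×ˢ Ico (τ - 2 * δ) τ, ‖φ x‖ₑ ^ 2 ∂(cylMeasure Ω s ⊤)
      ≤ ENNReal.ofReal (M / m * (2 + 8 * N) * δ ^ 2) := by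
    refine (strip_bound hΩ hδ hδτ hm hM hw (hφ.1.of_le (by norm_num))).trans ?_
    have e1 : ENNReal.ofReal (M / m * (2 + 8 * N) * δ ^ 2) = ENNReal.ofReal (M / m) *
        (2 * ENNReal.ofReal (δ ^ 2) + 2 * ENNReal.ofReal ((2 * δ) ^ 2) * ENNReal.ofReal N) := by
      have e2 : (2 : ℝ≥0∞) * ENNReal.ofReal (δ ^ 2) = ENNReal.ofReal (2 * δ ^ 2) := by
        rw [ENNReal.ofReal_mul (by norm_num), ENNReal.ofReal_ofNat]
      have e3 : 2 * ENNReal.ofReal ((2 * δ) ^ 2) * ENNReal.ofReal N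
          = ENNReal.ofReal (2 * (2 * δ) ^ 2 * N) := by
        rw [ENNReal.ofReal_mul (by positivity), ENNReal.ofReal_mul (by norm_num),
          ENNReal.ofReal_ofNat]
      rw [e2, e3, ← ENNReal.ofReal_add (by positivity) (by positivity),
        ← ENNReal.ofReal_mul (by positivity)]
      congr 1
      ring
    rw [e1]
    gcongr
  -- the part of the function near the top
  have hTm : MeasurableSet (Ω ×ˢ Ici (τ - 2 * δ)) := hΩ.measurableSet.prod measurableSet_Ici
  have := (isWeight_cyl hΩ hs.2 ⊤).fin
  have hu : ∃ u : L2C Ω s ⊤, u =ᵐ[cylMeasure Ω s ⊤] (Ω ×ˢ Ici (τ - 2 * δ)).indicator φ :=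
    ⟨_, (((hφ.memLp 2).indicator hTm : MemLp _ 2 (cylMeasure Ω s ⊤))).coeFn_toLp⟩
  obtain ⟨u, hu⟩ := hu
  have hnormu : ‖u‖ ^ 2 ≤ B₀ * δ ^ 2 := by
    refine norm_sq_le_ofReal u (by positivity) ?_
    have e1 : ∫⁻ x, ‖u x‖ₑ ^ 2 ∂(cylMeasure Ω s ⊤)
        = ∫⁻ x in Ω ×ˢ Ici (τ - 2 * δ), ‖φ x‖ₑ ^ 2 ∂(cylMeasure Ω s ⊤) := by
      rw [← lintegral_indicator hTm]
      refine lintegral_congr_ae ?_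
      filter_upwards [hu] with x hx
      rw [hx]
      by_cases hxm : x ∈ Ω ×ˢ Ici (τ - 2 * δ)
      · rw [indicator_of_mem hxm, indicator_of_mem hxm]
      · rw [indicator_of_notMem hxm, indicator_of_notMem hxm]
        simp
    have e2 : Ω ×ˢ Ici (τ - 2 * δ) ⊆ Ω ×ˢ Ico (τ - 2 * δ) τ ∪ Ω ×ˢ Ici τ := by
      rintro ⟨x, y⟩ ⟨hx, hy⟩
      rcases lt_or_ge y τ with h | h
      · exact Or.inl ⟨hx, hy, h⟩
      · exact Or.inr ⟨hx, h⟩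
    rw [e1]
    refine (lintegral_mono_set e2).trans ((lintegral_union_le _ _ _).trans
      ((add_le_add hstrip habove).trans_eq ?_))
    rw [← ENNReal.ofReal_add (by positivity) (by positivity), hB₀]
    congr 1
    ring
  have hnormu' : ‖u‖ ≤ Real.sqrt B₀ * δ := by
    refine (sq_le_sq₀ (norm_nonneg _) (by positivity)).1 ?_
    rwa [mul_pow, Real.sq_sqrt hB₀pos]
  -- the cut off function
  have hψ : IsTest (cylLow Ω τ) fun x => η x.2 * φ x := by
    refine ⟨(hη.comp contDiff_snd).mul hφ.1, hφ.2.1.mul_left, ?_⟩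
    intro x hx
    have e1 : x ∈ tsupport φ := by
      have := tsupport_mul_subset_right (f := fun x : EuclideanSpace ℝ (Fin n) × ℝ => η x.2)
        (g := φ)
      exact this hx
    have e2 : x.2 ≤ τ - δ := by
      have hcl : IsClosed {x : EuclideanSpace ℝ (Fin n) × ℝ | x.2 ≤ τ - δ} :=
        isClosed_le continuous_snd continuous_const
      refine closure_minimal (s := Function.support fun x : EuclideanSpace ℝ (Fin n) × ℝ =>
        η x.2 * φ x) (fun z hz => ?_) hcl hx
      by_contra hlt
      refine hz ?_
      simp [hη4 z.2 (le_of_lt (not_le.1 hlt))]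
    refine ⟨(hφ.2.2 e1).1, ?_⟩
    have : x.2 < τ := by linarith
    exact_mod_cast this
  obtain ⟨r, hrm, hr⟩ := exists_isTriple (Ω := Ω) (s := s) hΩ hs.2 ⊤ hψ
  refine ⟨r, hrm, ?_, ?_⟩
  · have e1 : ‖r.1 - q.1‖ ≤ ‖u‖ := by
      refine Lp.norm_le_norm_of_ae_le ?_
      filter_upwards [hr.1, hq.1, hu, Lp.coeFn_sub r.1 q.1, ae_mem_cyl hΩ ⊤] with x h1 h2 h3 h4 h5
      rw [h4, Pi.sub_apply, h1, h2, h3]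
      have e2 : η x.2 * φ x - φ x = -((1 - η x.2) * φ x) := by ring
      rw [e2, norm_neg, norm_mul]
      rcases lt_or_ge x.2 (τ - 2 * δ) with h | h
      · rw [hη3 _ h.le]
        simp
      · rw [indicator_of_mem (show x ∈ Ω ×ˢ Ici (τ - 2 * δ) from ⟨h5.1, h⟩)]
        exact mul_le_of_le_one_left (norm_nonneg _) (hη2 _)
    have e2 : ‖r.1 - p.1‖ ≤ ‖r.1 - q.1‖ + ‖q.1 - p.1‖ := norm_sub_le_norm_sub_add_norm_sub _ _ _
    have e3 : 0 ≤ 2 * N + 2 * Cη ^ 2 * B₀ := by positivity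
    have e4 : (1 + Real.sqrt B₀) * δ ≤ B * δ := by
      gcongr
      linarith
    linarith
  -- The gradient of the cutoff is of size `1 / δ`, but it lives where `φ` has norm of order `δ`.
  -- The factors cancel, and the gradient stays bounded, though it need not converge.
  · have e1 : ‖r.2.1‖ ^ 2 ≤ 2 * ‖q.2.1‖ ^ 2 + 2 * (Cη / δ) ^ 2 * ‖u‖ ^ 2 := by
      rw [norm_sq_eq_integral, norm_sq_eq_integral, norm_sq_eq_integral, ← integral_const_mul,
        ← integral_const_mul, ← integral_add ((integrable_norm_sq (Lp.memLp _)).const_mul _)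
        ((integrable_norm_sq (Lp.memLp _)).const_mul _)]
      refine integral_mono_ae (integrable_norm_sq (Lp.memLp _))
        (((integrable_norm_sq (Lp.memLp _)).const_mul _).add
          ((integrable_norm_sq (Lp.memLp _)).const_mul _)) ?_
      filter_upwards [hr.2.1, hq.2.1, hu, ae_mem_cyl hΩ ⊤] with x h1 h2 h3 h5
      rw [h1, h2, h3]
      have hd : HasFDerivAt (fun x : EuclideanSpace ℝ (Fin n) × ℝ => η x.2 * φ x)
          (η x.2 • fderiv ℝ φ x + φ x • (deriv η x.2 •
            ContinuousLinearMap.snd ℝ (EuclideanSpace ℝ (Fin n)) ℝ)) x := by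
        have hd1 : HasFDerivAt (fun x : EuclideanSpace ℝ (Fin n) × ℝ => η x.2)
            (deriv η x.2 • ContinuousLinearMap.snd ℝ (EuclideanSpace ℝ (Fin n)) ℝ) x :=
          ((hη.differentiable (by simp) x.2).hasDerivAt).comp_hasFDerivAt x hasFDerivAt_snd
        exact hd1.mul (hφ.differentiable x).hasFDerivAt
      rw [hd.fderiv]
      have t1 : ‖η x.2 • fderiv ℝ φ x + φ x • (deriv η x.2 •
            ContinuousLinearMap.snd ℝ (EuclideanSpace ℝ (Fin n)) ℝ)‖
          ≤ ‖fderiv ℝ φ x‖ + Cη / δ * ‖(Ω ×ˢ Ici (τ - 2 * δ)).indicator φ x‖ := by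
        refine (norm_add_le _ _).trans (add_le_add ?_ ?_)
        · rw [norm_smul]
          exact mul_le_of_le_one_left (norm_nonneg _) (hη1 _)
        · rcases lt_or_ge x.2 (τ - 2 * δ) with h | h
          · have hz : deriv η x.2 = 0 := by
              have : η =ᶠ[𝓝 x.2] fun _ => 1 := by
                filter_upwards [Iio_mem_nhds h] with y hy
                exact hη3 y (le_of_lt hy)
              rw [this.deriv_eq]
              simp
            rw [hz, zero_smul, smul_zero, norm_zero]
            positivity
          · rw [indicator_of_mem (show x ∈ Ω ×ˢ Ici (τ - 2 * δ) from ⟨h5.1, h⟩), norm_smul,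
              norm_smul, mul_comm]
            gcongr
            have t2 := ContinuousLinearMap.norm_snd_le ℝ (EuclideanSpace ℝ (Fin n)) ℝ
            calc _ ≤ Cη / δ * 1 := mul_le_mul (hη5 _) t2 (norm_nonneg _) (by positivity)
              _ = _ := mul_one _
      have t3 := pow_le_pow_left₀ (norm_nonneg _) t1 2
      refine t3.trans ?_
      nlinarith [sq_nonneg (‖fderiv ℝ φ x‖ - Cη / δ * ‖(Ω ×ˢ Ici (τ - 2 * δ)).indicator φ x‖)]
    have e2 : (Cη / δ) ^ 2 * ‖u‖ ^ 2 ≤ Cη ^ 2 * B₀ := by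
      calc (Cη / δ) ^ 2 * ‖u‖ ^ 2 ≤ (Cη / δ) ^ 2 * (B₀ * δ ^ 2) := by gcongr
        _ = _ := by field_simp
    have e3 : 0 ≤ Real.sqrt B₀ := Real.sqrt_nonneg _
    rw [hB]
    linarith

/-- A Sobolev function which vanishes above the height `τ` is a limit of test functions supported
below `τ`. -/
lemma mem_sobolevTriples_of_vanish (hA : IsCoeff (volume.restrict Ω) A c C) (hΩ : IsOpen Ω)
    (hs : s ∈ Ioo (0 : ℝ) 1) {κ : ℝ} (hκ : 0 < κ)
    (hco : ∀ p ∈ sobolevTriples s Ω (cylLow Ω ⊤) ⊤, κ * ‖p‖ ^ 2 ≤ tripleForm hA s ⊤ p p)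
    {τ : ℝ} (hτ : 0 < τ) {p : Triple Ω s ⊤} (hp : p ∈ sobolevTriples s Ω (cylLow Ω ⊤) ⊤)
    (h0 : ∀ᵐ x ∂(cylMeasure Ω s ⊤), x ∉ cyl Ω τ → p.1 x = 0) :
    p ∈ sobolevTriples s Ω (cylLow Ω τ) ⊤ := by
  obtain ⟨B, hB, happ⟩ := exists_cutoff_approx hΩ hs hτ hp h0
  set δ : ℕ → ℝ := fun k => min (τ / 4) 1 * (1 / ((k : ℝ) + 1)) with hδ
  have hmin : 0 < min (τ / 4) 1 := lt_min (by positivity) one_pos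
  have hδpos : ∀ k, 0 < δ k := fun k => mul_pos hmin Nat.one_div_pos_of_nat
  have hδle : ∀ k, δ k ≤ min (τ / 4) 1 := fun k =>
    mul_le_of_le_one_right hmin.le (by
      rw [div_le_one (by positivity)]
      linarith [Nat.cast_nonneg (α := ℝ) k])
  have hδlim : Tendsto δ atTop (𝓝 0) := by
    have h := (tendsto_one_div_add_atTop_nhds_zero_nat (𝕜 := ℝ)).const_mul (min (τ / 4) 1)
    rwa [mul_zero] at h
  choose r hrm hr1 hr2 using fun k => happ (δ k) (hδpos k)
    (by linarith [(hδle k).trans (min_le_left _ _)]) ((hδle k).trans (min_le_right _ _))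
  have hb := isBddSymm_tripleForm hA hs ⊤
  have hd := dConst_pos hs
  have hlim : Tendsto (fun k => (r k).1) atTop (𝓝 p.1) := by
    rw [tendsto_iff_norm_sub_tendsto_zero]
    refine squeeze_zero (fun _ => norm_nonneg _) hr1 ?_
    simpa using hδlim.const_mul B
  have hbound : ∀ k, tripleForm hA s ⊤ (r k) (r k)
      ≤ 1 / dConst s * (((n ^ 2 * C + 1) * 1 ^ 2 + C) * ((‖p.1‖ + B) ^ 2 + B)) := by
    intro k
    have hC := hA.nonneg
    rw [tripleForm_apply]
    refine mul_le_mul_of_nonneg_left ?_ (by positivity)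
    refine (energy_le (hA.cyl s ⊤) horiz (0, 1) norm_horiz_le norm_vertical.le _).trans ?_
    refine mul_le_mul_of_nonneg_left (add_le_add ?_ (hr2 k)) (by positivity)
    have h1 : ‖(r k).1‖ ≤ ‖p.1‖ + B := by
      have h2 := norm_add_le ((r k).1 - p.1) p.1
      rw [sub_add_cancel] at h2
      have h3 : B * δ k ≤ B := mul_le_of_le_one_right hB ((hδle k).trans (min_le_right _ _))
      linarith [hr1 k]
    exact pow_le_pow_left₀ (norm_nonneg _) h1 2
  -- The weak limit of the cut off functions lies in the closure of the test functions supported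
  -- below `τ` and has the first entry of `p`; by uniqueness of triples it is `p`.
  obtain ⟨z, hz, hTz, -⟩ := hb.exists_weak_limit hκ isClosed_sobolevTriples
    (fun q hq => hco q (sobolevTriples_le_top hq)) (ContinuousLinearMap.fst ℝ _ _)
    (fun k => Submodule.le_topologicalClosure _ (hrm k)) tendsto_const_nhds hbound hlim
  rwa [sobolevTriples_ext hΩ hs hp (sobolevTriples_le_top hz) hTz.symm]

end Strip

/-! ### Traces lie in the spectral space -/

/-- Bessel's inequality for a nonnegative symmetric bilinear form. -/
lemma sum_mul_sq_le_of_orthogonal {V : Type*} [AddCommGroup V] [Module ℝ V]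
    (Q : V →ₗ[ℝ] V →ₗ[ℝ] ℝ) (hsymm : ∀ p q, Q p q = Q q p) (hnonneg : ∀ p, 0 ≤ Q p p)
    {P : ℕ → V} {ev : ℕ → ℝ} (hP : ∀ j k, Q (P j) (P k) = if j = k then ev j else 0)
    {q : V} {b : ℕ → ℝ} (hq : ∀ k, Q (P k) q = ev k * b k) (F : Finset ℕ) :
    ∑ k ∈ F, ev k * b k ^ 2 ≤ Q q q := by
  have h1 : Q (∑ k ∈ F, b k • P k) q = ∑ k ∈ F, ev k * b k ^ 2 := by
    rw [map_sum, LinearMap.sum_apply]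
    refine Finset.sum_congr rfl fun k _ => ?_
    rw [map_smul, LinearMap.smul_apply, hq, smul_eq_mul]
    ring
  have h2 : Q (∑ k ∈ F, b k • P k) (∑ k ∈ F, b k • P k) = ∑ k ∈ F, ev k * b k ^ 2 := by
    rw [map_sum]
    refine Finset.sum_congr rfl fun k hk => ?_
    rw [map_smul, hsymm, map_sum, Finset.sum_eq_single k]
    · rw [map_smul, hP, if_pos rfl, smul_eq_mul, smul_eq_mul]
      ring
    · intro j _ hj
      rw [map_smul, hP, if_neg hj.symm, smul_zero]
    · exact fun h => absurd hk h
  -- The energy of the remainder is non-negative. No division by `ev k` occurs, so eigenvalues may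
  -- vanish.
  have h3 := hnonneg (q - ∑ k ∈ F, b k • P k)
  rw [LinearMap.map_sub₂, map_sub, map_sub, hsymm q (∑ k ∈ F, b k • P k), h1, h2] at h3
  linarith

lemma eLpNorm_sub_toLp {α F : Type*} [MeasurableSpace α] {μ : Measure α} [NormedAddCommGroup F]
    {p : ENNReal} {f : α → F} (hf : MemLp f p μ) : eLpNorm (f - ⇑(hf.toLp f)) p μ = 0 := by
  rw [eLpNorm_congr_ae ((EventuallyEq.refl _ f).sub hf.coeFn_toLp), sub_self, eLpNorm_zero]

section SpectralTrace

open scoped ENNReal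

variable {n : ℕ} {Ω : Set (EuclideanSpace ℝ (Fin n))} {s : ℝ}
  {A : EuclideanSpace ℝ (Fin n) → Matrix (Fin n) (Fin n) ℝ}
  {c : EuclideanSpace ℝ (Fin n) → ℝ} {C : ℝ}

lemma inner_eq_setIntegral (u v : L2 Ω) : inner ℝ u v = ∫ x in Ω, u x * v x := by
  rw [L2.inner_def]
  refine integral_congr_ae (.of_forall fun x => ?_)
  simp [mul_comm]

/-- The energy form on `Ω`. -/
abbrev baseEnergy (hA : IsCoeff (volume.restrict Ω) A c C) :=
  energy hA (fun i => (EuclideanSpace.single i 1 : EuclideanSpace ℝ (Fin n))) 0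

/-- The extra direction in `baseEnergy` is `0`, so the vertical term of the density disappears. -/
lemma ellipticForm_eq_energy (hA : IsCoeff (volume.restrict Ω) A c C)
    {p q : L2 Ω × Lp (EuclideanSpace ℝ (Fin n) →L[ℝ] ℝ) 2 (volume.restrict Ω)}
    (hp : weakFDeriv Ω p.1 =ᵐ[volume.restrict Ω] p.2)
    (hq : weakFDeriv Ω q.1 =ᵐ[volume.restrict Ω] q.2) :
    ellipticForm Ω A c p.1 q.1 = baseEnergy hA p q := by
  rw [energy_apply]
  refine integral_congr_ae ?_
  filter_upwards [hp, hq] with x h1 h2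
  simp [density, pderiv, h1, h2]

lemma exists_pair_of_mem_H10 {v : L2 Ω} (hv : v ∈ H10 Ω) :
    ∃ p : L2 Ω × Lp (EuclideanSpace ℝ (Fin n) →L[ℝ] ℝ) 2 (volume.restrict Ω),
      p.1 = v ∧ weakFDeriv Ω p.1 =ᵐ[volume.restrict Ω] p.2 :=
  ⟨(v, hv.1.2.toLp _), rfl, hv.1.2.coeFn_toLp.symm⟩

/-- A test function on `Ω` as an element of `H¹₀(Ω)`. -/
lemma IsTest.exists_pair (hΩ : IsOpen Ω) {ψ : EuclideanSpace ℝ (Fin n) → ℝ} (hψ : IsTest Ω ψ) :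
    ∃ p : L2 Ω × Lp (EuclideanSpace ℝ (Fin n) →L[ℝ] ℝ) 2 (volume.restrict Ω),
      p.1 ∈ H10 Ω ∧ weakFDeriv Ω p.1 =ᵐ[volume.restrict Ω] p.2 ∧
        p.1 =ᵐ[volume.restrict Ω] ψ ∧ p.2 =ᵐ[volume.restrict Ω] fderiv ℝ ψ := by
  have hw := isWeight_restrict hΩ
  have := hw.fin
  have h1 : MemLp ψ 2 (volume.restrict Ω) := hψ.memLp 2
  have h2 : MemLp (fderiv ℝ ψ) 2 (volume.restrict Ω) := hψ.memLp_fderiv 2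
  have h3 : TendstoPair (volume.restrict Ω) (fun _ : ℕ => ψ) (h1.toLp ψ) (h2.toLp _) := by
    constructor
    · exact tendsto_const_nhds.congr fun _ => (eLpNorm_sub_toLp h1).symm
    · exact tendsto_const_nhds.congr fun _ => (eLpNorm_sub_toLp h2).symm
  exact ⟨(h1.toLp ψ, h2.toLp _), h3.mem_h1Closure hw fun _ => hψ,
    h3.weakFDeriv_ae_eq hw fun _ => hψ, h1.coeFn_toLp, h2.coeFn_toLp⟩

/-- The Gram matrix of the eigenfunctions with respect to the energy form. -/
lemma IsEigenbasis.exists_pairs (hA : IsCoeff (volume.restrict Ω) A c C) {φ : ℕ → L2 Ω}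
    {ev : ℕ → ℝ} (h : IsEigenbasis Ω A c φ ev) :
    ∃ P : ℕ → L2 Ω × Lp (EuclideanSpace ℝ (Fin n) →L[ℝ] ℝ) 2 (volume.restrict Ω),
      (∀ j k, baseEnergy hA (P j) (P k) = if j = k then ev j else 0) ∧
      ∀ q : L2 Ω × Lp (EuclideanSpace ℝ (Fin n) →L[ℝ] ℝ) 2 (volume.restrict Ω), q.1 ∈ H10 Ω →
        weakFDeriv Ω q.1 =ᵐ[volume.restrict Ω] q.2 →
        ∀ k, baseEnergy hA (P k) q = ev k * inner ℝ (φ k) q.1 := by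
  choose P hP1 hP2 using fun k => exists_pair_of_mem_H10 (h.2.2 k).1
  have key : ∀ q : L2 Ω × Lp (EuclideanSpace ℝ (Fin n) →L[ℝ] ℝ) 2 (volume.restrict Ω),
      q.1 ∈ H10 Ω → weakFDeriv Ω q.1 =ᵐ[volume.restrict Ω] q.2 →
      ∀ k, baseEnergy hA (P k) q = ev k * inner ℝ (φ k) q.1 := by
    intro q hq hq' k
    rw [← ellipticForm_eq_energy hA (hP2 k) hq', hP1, (h.2.2 k).2 _ hq, inner_eq_setIntegral]
  refine ⟨P, fun j k => ?_, key⟩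
  rw [key _ (by rw [hP1]; exact (h.2.2 k).1) (hP2 k), hP1, orthonormal_iff_ite.1 h.1 j k]
  split_ifs <;> simp

/-- An eigenvalue is the energy of its normalised eigenfunction. -/
lemma IsEigenbasis.nonneg (hA : IsCoeff (volume.restrict Ω) A c C) {φ : ℕ → L2 Ω}
    {ev : ℕ → ℝ} (h : IsEigenbasis Ω A c φ ev) (k : ℕ) : 0 ≤ ev k := by
  obtain ⟨P, hP, -⟩ := h.exists_pairs hA
  have := energy_nonneg hA (fun i => (EuclideanSpace.single i 1 : EuclideanSpace ℝ (Fin n))) 0 (P k)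
  rwa [hP k k, if_pos rfl] at this

lemma isTest_slice {φ : EuclideanSpace ℝ (Fin n) × ℝ → ℝ} (hφ : IsTest (cylLow Ω ⊤) φ) (y : ℝ) :
    IsTest Ω fun x => φ (x, y) := by
  refine ⟨hφ.1.comp (by fun_prop), hasCompactSupport_slice hφ.2.1 y, fun x hx => ?_⟩
  have hcl : IsClosed {x : EuclideanSpace ℝ (Fin n) | (x, y) ∈ tsupport φ} :=
    (isClosed_tsupport φ).preimage (by fun_prop)
  have hsub : tsupport (fun x => φ (x, y)) ⊆ {x | (x, y) ∈ tsupport φ} :=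
    closure_minimal (fun x hx => subset_tsupport φ hx) hcl
  exact (hφ.2.2 (hsub hx)).1

lemma norm_fderiv_slice_le {U} {φ : EuclideanSpace ℝ (Fin n) × ℝ → ℝ} (hφ : IsTest U φ)
    (x : EuclideanSpace ℝ (Fin n)) (y : ℝ) :
    ‖fderiv ℝ (fun x => φ (x, y)) x‖ ≤ ‖fderiv ℝ φ (x, y)‖ := by
  have h1 : HasFDerivAt (fun x : EuclideanSpace ℝ (Fin n) => (x, y))
      (ContinuousLinearMap.inl ℝ (EuclideanSpace ℝ (Fin n)) ℝ) x := hasFDerivAt_prodMk_left x y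
  have h2 := (hφ.differentiable (x, y)).hasFDerivAt.comp x h1
  have h3 : fderiv ℝ (fun x => φ (x, y)) x = (fderiv ℝ φ (x, y)).comp
      (ContinuousLinearMap.inl ℝ (EuclideanSpace ℝ (Fin n)) ℝ) := h2.fderiv
  rw [h3]
  refine ContinuousLinearMap.opNorm_le_bound _ (norm_nonneg _) fun v => ?_
  refine ((fderiv ℝ φ (x, y)).le_opNorm _).trans ?_
  refine le_of_eq ?_
  simp [Prod.norm_def]

lemma integrable_slice_mul {μ : Measure (EuclideanSpace ℝ (Fin n))}
    {u : EuclideanSpace ℝ (Fin n) × ℝ → ℝ} (hu : Continuous u) (huc : HasCompactSupport u)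
    {e : EuclideanSpace ℝ (Fin n) → ℝ} (he : Integrable e μ) (y : ℝ) :
    Integrable (fun x => u (x, y) * e x) μ := by
  obtain ⟨M, hM⟩ := hu.bounded_above_of_compact_support huc
  exact he.bdd_mul (continuous_slice_zero hu y).aestronglyMeasurable (.of_forall fun x => hM (x, y))

lemma continuous_integral_slice_mul {μ : Measure (EuclideanSpace ℝ (Fin n))}
    {u : EuclideanSpace ℝ (Fin n) × ℝ → ℝ} (hu : Continuous u) (huc : HasCompactSupport u)
    {e : EuclideanSpace ℝ (Fin n) → ℝ} (he : Integrable e μ) :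
    Continuous fun y => ∫ x, u (x, y) * e x ∂μ := by
  obtain ⟨M, hM⟩ := hu.bounded_above_of_compact_support huc
  refine continuous_of_dominated (bound := fun x => M * ‖e x‖)
    (fun y => (integrable_slice_mul hu huc he y).aestronglyMeasurable)
    (fun y => .of_forall fun x => ?_) (he.norm.const_mul M) (.of_forall fun x => ?_)
  · rw [norm_mul]
    exact mul_le_mul_of_nonneg_right (hM _) (norm_nonneg _)
  · exact (hu.comp (by fun_prop)).mul continuous_const

lemma hasCompactSupport_integral_slice_mul {μ : Measure (EuclideanSpace ℝ (Fin n))}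
    {u : EuclideanSpace ℝ (Fin n) × ℝ → ℝ} (huc : HasCompactSupport u)
    (e : EuclideanSpace ℝ (Fin n) → ℝ) :
    HasCompactSupport fun y => ∫ x, u (x, y) * e x ∂μ := by
  refine HasCompactSupport.intro (huc.isCompact.image continuous_snd) fun y hy => ?_
  have h0 : ∀ x, u (x, y) = 0 := fun x => image_eq_zero_of_notMem_tsupport fun h => hy ⟨_, h, rfl⟩
  simp only [h0, zero_mul, integral_zero]

lemma hasDerivAt_integral_slice_mul {μ : Measure (EuclideanSpace ℝ (Fin n))}
    {u u' : EuclideanSpace ℝ (Fin n) × ℝ → ℝ} (hu : Continuous u) (huc : HasCompactSupport u)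
    (hu' : Continuous u') (huc' : HasCompactSupport u')
    (hd : ∀ x y, HasDerivAt (fun t => u (x, t)) (u' (x, y)) y)
    {e : EuclideanSpace ℝ (Fin n) → ℝ} (he : Integrable e μ) (y : ℝ) :
    HasDerivAt (fun y => ∫ x, u (x, y) * e x ∂μ) (∫ x, u' (x, y) * e x ∂μ) y := by
  obtain ⟨M, hM⟩ := hu'.bounded_above_of_compact_support huc'
  refine (hasDerivAt_integral_of_dominated_loc_of_deriv_le (s := univ)
    (F := fun y x => u (x, y) * e x) (F' := fun y x => u' (x, y) * e x)
    (bound := fun x => M * ‖e x‖) univ_mem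
    (.of_forall fun t => (integrable_slice_mul hu huc he t).aestronglyMeasurable)
    (integrable_slice_mul hu huc he y) (integrable_slice_mul hu' huc' he y).aestronglyMeasurable
    (.of_forall fun x t _ => ?_) (he.norm.const_mul M)
    (.of_forall fun x t _ => (hd x t).mul_const _)).2
  rw [norm_mul]
  exact mul_le_mul_of_nonneg_right (hM _) (norm_nonneg _)

lemma integrable_of_isBounded (hΩb : Bornology.IsBounded Ω) (e : L2 Ω) :
    Integrable e (volume.restrict Ω) := by
  have : IsFiniteMeasure ((volume : Measure (EuclideanSpace ℝ (Fin n))).restrict Ω) :=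
    ⟨by rw [Measure.restrict_apply_univ]; exact hΩb.measure_lt_top⟩
  exact (Lp.memLp e).integrable (by norm_num)

/-- Bessel's inequality on a slice of a test function. -/
lemma IsEigenbasis.sum_slice_le (hA : IsCoeff (volume.restrict Ω) A c C) (hΩ : IsOpen Ω)
    {e : ℕ → L2 Ω} {ev : ℕ → ℝ} (h : IsEigenbasis Ω A c e ev)
    {φ : EuclideanSpace ℝ (Fin n) × ℝ → ℝ} (hφ : IsTest (cylLow Ω ⊤) φ) (y : ℝ) (N : ℕ) :
    ∑ k ∈ Finset.range N, (ev k * (∫ x in Ω, φ (x, y) * e k x) ^ 2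
        + (∫ x in Ω, fderiv ℝ φ (x, y) (0, 1) * e k x) ^ 2)
      ≤ (((n ^ 2 * C + 1) * 1 ^ 2 + C) + 1) * ∫ x in Ω, (φ (x, y) ^ 2 + ‖fderiv ℝ φ (x, y)‖ ^ 2) := by
  have hC := hA.nonneg
  set B : ℝ := (n ^ 2 * C + 1) * 1 ^ 2 + C with hB
  have hB0 : 0 ≤ B := by positivity
  have hcd : Continuous fun q => fderiv ℝ φ q (0, 1) :=
    hφ.continuous_fderiv.clm_apply continuous_const
  have hcdc : HasCompactSupport fun q => fderiv ℝ φ q (0, 1) :=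
    (hφ.2.1.fderiv ℝ).comp_left
      (g := fun L : EuclideanSpace ℝ (Fin n) × ℝ →L[ℝ] ℝ => L (0, 1)) (by simp)
  have hi1 : Integrable (fun x => φ (x, y) ^ 2) (volume.restrict Ω) := by
    simpa using integrable_norm_sq (memLp_slice (Ω := Ω) hφ.continuous hφ.2.1 y 2)
  have hi2 : Integrable (fun x => ‖fderiv ℝ φ (x, y)‖ ^ 2) (volume.restrict Ω) := by
    refine integrable_norm_sq (MemLp.restrict Ω ?_)
    exact (hφ.continuous_fderiv.comp (by fun_prop)).memLp_of_hasCompactSupport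
      (hasCompactSupport_slice (hφ.2.1.fderiv ℝ) y)
  rw [Finset.sum_add_distrib, integral_add hi1 hi2]
  -- Bessel's inequality for the energy form, applied to the slice, which is a test function on `Ω`.
  have h1 : ∑ k ∈ Finset.range N, ev k * (∫ x in Ω, φ (x, y) * e k x) ^ 2
      ≤ B * ((∫ x in Ω, φ (x, y) ^ 2) + ∫ x in Ω, ‖fderiv ℝ φ (x, y)‖ ^ 2) := by
    obtain ⟨P, hP, hPq⟩ := h.exists_pairs hA
    obtain ⟨q, hq, hq', hq1, hq2⟩ := (isTest_slice hφ y).exists_pair hΩ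
    have hb : ∀ k, ∫ x in Ω, φ (x, y) * e k x = inner ℝ (e k) q.1 := fun k => by
      rw [inner_eq_setIntegral]
      refine integral_congr_ae ?_
      filter_upwards [hq1] with x hx
      rw [hx, mul_comm]
    simp_rw [hb]
    refine (sum_mul_sq_le_of_orthogonal _ (energy_symm hA _ 0) (energy_nonneg hA _ 0) hP
      (hPq q hq hq') _).trans ?_
    refine (energy_le hA _ 0 (B := 1) (fun i => by simp) (by simp) q).trans ?_
    refine mul_le_mul_of_nonneg_left (add_le_add (le_of_eq ?_) ?_) hB0
    · rw [norm_sq_eq_integral]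
      refine integral_congr_ae ?_
      filter_upwards [hq1] with x hx
      rw [hx, Real.norm_eq_abs, sq_abs]
    · rw [norm_sq_eq_integral]
      refine integral_mono_ae (integrable_norm_sq (Lp.memLp _)) hi2 ?_
      filter_upwards [hq2] with x hx
      rw [hx]
      exact pow_le_pow_left₀ (norm_nonneg _) (norm_fderiv_slice_le hφ x y) 2
  -- Bessel's inequality in `L²(Ω)` for the vertical derivative.
  have h2 : ∑ k ∈ Finset.range N, (∫ x in Ω, fderiv ℝ φ (x, y) (0, 1) * e k x) ^ 2
      ≤ ∫ x in Ω, ‖fderiv ℝ φ (x, y)‖ ^ 2 := by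
    have hm := memLp_slice (Ω := Ω) hcd hcdc y 2
    have hb : ∀ k, (∫ x in Ω, fderiv ℝ φ (x, y) (0, 1) * e k x) ^ 2
        = ‖inner ℝ (e k) (hm.toLp _)‖ ^ 2 := fun k => by
      rw [inner_eq_setIntegral, Real.norm_eq_abs, sq_abs]
      congr 1
      refine integral_congr_ae ?_
      filter_upwards [hm.coeFn_toLp] with x hx
      rw [hx, mul_comm]
    simp_rw [hb]
    refine (h.1.sum_inner_products_le _).trans ?_
    rw [norm_sq_eq_integral]
    refine integral_mono_ae (integrable_norm_sq (Lp.memLp _)) hi2 ?_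
    filter_upwards [hm.coeFn_toLp] with x hx
    rw [hx]
    refine pow_le_pow_left₀ (norm_nonneg _) ?_ 2
    have := (fderiv ℝ φ (x, y)).le_opNorm (0, 1)
    rwa [norm_vertical, mul_one] at this
  have h3 : 0 ≤ ∫ x in Ω, φ (x, y) ^ 2 := integral_nonneg fun x => sq_nonneg _
  linarith

/-- The trace inequality in the spectral norm, for test functions. -/
lemma IsEigenbasis.exists_spectral_bound (hA : IsCoeff (volume.restrict Ω) A c C) (hΩ : IsOpen Ω)
    (hΩb : Bornology.IsBounded Ω) (hs : s ∈ Ioo (0 : ℝ) 1)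
    {e : ℕ → L2 Ω} {ev : ℕ → ℝ} (h : IsEigenbasis Ω A c e ev) :
    ∃ B : ℝ, ∀ p ∈ sobolevTriples s Ω (cylLow Ω ⊤) ⊤, ∀ N : ℕ,
      ∑ k ∈ Finset.range N, ev k ^ s * (inner ℝ p.2.2 (e k)) ^ 2
        ≤ B * (‖p.1‖ ^ 2 + ‖p.2.1‖ ^ 2) := by
  obtain ⟨K, hK, hbound⟩ := rpow_mul_trace_sq_le hs
  set B : ℝ := ((n ^ 2 * C + 1) * 1 ^ 2 + C) + 1 with hB
  refine ⟨K * B, fun p hp N => ?_⟩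
  refine sobolevTriples_induction
    (Q := fun p => ∑ k ∈ Finset.range N, ev k ^ s * (inner ℝ p.2.2 (e k)) ^ 2
      ≤ K * B * (‖p.1‖ ^ 2 + ‖p.2.1‖ ^ 2))
    (isClosed_le (by fun_prop) (by fun_prop)) ?_ hp
  intro q φ hφ hq
  have := isFiniteMeasureOnCompacts_yMeasure hs.2
  -- The Fourier coefficients of the slices as functions of the height; `g'` is the derivative of
  -- `g`, by differentiation under the integral.
  set g : ℕ → ℝ → ℝ := fun k y => ∫ x in Ω, φ (x, y) * e k x with hg
  set g' : ℕ → ℝ → ℝ := fun k y => ∫ x in Ω, fderiv ℝ φ (x, y) (0, 1) * e k x with hg'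
  have hcd : Continuous fun q => fderiv ℝ φ q (0, 1) :=
    hφ.continuous_fderiv.clm_apply continuous_const
  have hcdc : HasCompactSupport fun q => fderiv ℝ φ q (0, 1) :=
    (hφ.2.1.fderiv ℝ).comp_left
      (g := fun L : EuclideanSpace ℝ (Fin n) × ℝ →L[ℝ] ℝ => L (0, 1)) (by simp)
  have hei := fun k => integrable_of_isBounded hΩb (e k)
  have hgc : ∀ k, Continuous (g k) := fun k =>
    continuous_integral_slice_mul hφ.continuous hφ.2.1 (hei k)
  have hgc' : ∀ k, Continuous (g' k) := fun k => continuous_integral_slice_mul hcd hcdc (hei k)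
  have hgs : ∀ k, HasCompactSupport (g k) := fun k =>
    hasCompactSupport_integral_slice_mul hφ.2.1 (e k)
  have hgs' : ∀ k, HasCompactSupport (g' k) := fun k =>
    hasCompactSupport_integral_slice_mul hcdc (e k)
  have hsqc : ∀ {u : ℝ → ℝ}, HasCompactSupport u → HasCompactSupport fun y => u y ^ 2 := fun hu =>
    hu.comp_left (g := fun x : ℝ => x ^ 2) (by simp)
  have hik : ∀ k, Integrable (fun y => ev k * g k y ^ 2 + g' k y ^ 2) (yMeasure s) := fun k =>
    ((((hgc k).pow 2).integrable_of_hasCompactSupport (hsqc (hgs k))).const_mul _).add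
      (((hgc' k).pow 2).integrable_of_hasCompactSupport (hsqc (hgs' k)))
  have h1 : ∀ k, ev k ^ s * (inner ℝ q.2.2 (e k)) ^ 2
      ≤ K * ∫ y, (ev k * g k y ^ 2 + g' k y ^ 2) ∂(yMeasure s) := by
    intro k
    have e1 : inner ℝ q.2.2 (e k) = g k 0 := by
      rw [inner_eq_setIntegral]
      refine integral_congr_ae ?_
      filter_upwards [hq.2.2] with x hx
      rw [hx]
    rw [e1, integral_yMeasure]
    -- The parameter `l` is the eigenvalue, which is where the power `ev k ^ s` arises.
    exact hbound (g k) (g' k) (hasDerivAt_integral_slice_mul hφ.continuous hφ.2.1 hcd hcdc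
      (hasDerivAt_vertical hφ) (hei k)) (hgc' k) (hgs k) (hgs' k) _ (h.nonneg hA k)
  have hi : Integrable (fun p => φ p ^ 2 + ‖fderiv ℝ φ p‖ ^ 2)
      ((volume.restrict Ω).prod (yMeasure s)) := by
    rw [← cylMeasure_top]
    refine integrable_cyl hΩ hs.2 ⊤ ((hφ.continuous.pow 2).add (hφ.continuous_fderiv.norm.pow 2)) ?_
    exact (hφ.2.1.comp_left (g := fun x : ℝ => x ^ 2) (by simp)).add
      ((hφ.2.1.fderiv ℝ).comp_left
        (g := fun L : EuclideanSpace ℝ (Fin n) × ℝ →L[ℝ] ℝ => ‖L‖ ^ 2) (by simp))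
  calc ∑ k ∈ Finset.range N, ev k ^ s * (inner ℝ q.2.2 (e k)) ^ 2
      ≤ ∑ k ∈ Finset.range N, K * ∫ y, (ev k * g k y ^ 2 + g' k y ^ 2) ∂(yMeasure s) :=
        Finset.sum_le_sum fun k _ => h1 k
    _ = K * ∫ y, ∑ k ∈ Finset.range N, (ev k * g k y ^ 2 + g' k y ^ 2) ∂(yMeasure s) := by
        rw [← Finset.mul_sum, integral_finsetSum _ fun k _ => hik k]
    _ ≤ K * ∫ y, B * (∫ x in Ω, (φ (x, y) ^ 2 + ‖fderiv ℝ φ (x, y)‖ ^ 2)) ∂(yMeasure s) := by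
        refine mul_le_mul_of_nonneg_left (integral_mono (integrable_finsetSum _ fun k _ => hik k)
          (hi.integral_prod_right.const_mul B) fun y => ?_) hK
        exact h.sum_slice_le hA hΩ hφ y N
    _ = K * B * ∫ p, (φ p ^ 2 + ‖fderiv ℝ φ p‖ ^ 2) ∂((volume.restrict Ω).prod (yMeasure s)) := by
        rw [integral_const_mul, ← mul_assoc, integral_prod_symm _ hi]
    _ = K * B * (‖q.1‖ ^ 2 + ‖q.2.1‖ ^ 2) := by
        rw [← cylMeasure_top, norm_sq_eq_integral, norm_sq_eq_integral,
          ← integral_add (integrable_norm_sq (Lp.memLp _)) (integrable_norm_sq (Lp.memLp _))]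
        congr 1
        refine integral_congr_ae ?_
        filter_upwards [hq.1, hq.2.1] with x h2 h3
        rw [h2, h3, Real.norm_eq_abs, sq_abs]

/-- The trace of a Sobolev function lies in the spectral space. -/
lemma tr_mem_Hs (hA : IsCoeff (volume.restrict Ω) A c C) (hΩ : IsOpen Ω)
    (hΩb : Bornology.IsBounded Ω) (hs : s ∈ Ioo (0 : ℝ) 1) {p : Triple Ω s ⊤}
    (hp : p ∈ sobolevTriples s Ω (cylLow Ω ⊤) ⊤) : p.2.2 ∈ Hs Ω A c s := by
  intro e ev h
  obtain ⟨B, hB⟩ := h.exists_spectral_bound hA hΩ hΩb hs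
  simp_rw [← inner_eq_setIntegral]
  exact summable_of_sum_range_le
    (fun k => mul_nonneg (Real.rpow_nonneg (h.nonneg hA k) _) (sq_nonneg _)) (hB p hp)

end SpectralTrace

/-! ### Coefficients -/

section Coefficients

variable {n : ℕ} {Ω : Set (EuclideanSpace ℝ (Fin n))}
  {A : EuclideanSpace ℝ (Fin n) → Matrix (Fin n) (Fin n) ℝ}
  {c : EuclideanSpace ℝ (Fin n) → ℝ}

/-- Polarisation: evaluate the quadratic form at the sum of two unit vectors, whose norm is at most
`2`, and remove the diagonal entries. -/
lemma abs_entry_le {m : Matrix (Fin n) (Fin n) ℝ} (hm : ∀ i j, m i j = m j i) {L : ℝ} (hL : 0 ≤ L)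
    (h : ∀ ξ : EuclideanSpace ℝ (Fin n), 0 ≤ ∑ i, ∑ j, m i j * ξ j * ξ i ∧
      ∑ i, ∑ j, m i j * ξ j * ξ i ≤ L * ‖ξ‖ ^ 2) (a b : Fin n) : |m a b| ≤ 2 * L := by
  have h1 : ∀ a b : Fin n, ∑ i, ∑ j, m i j * (EuclideanSpace.single a (1 : ℝ)
      + EuclideanSpace.single b 1 : EuclideanSpace ℝ (Fin n)) j *
      (EuclideanSpace.single a (1 : ℝ) + EuclideanSpace.single b 1 : EuclideanSpace ℝ (Fin n)) i
      = m a a + m b b + 2 * m a b := by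
    intro a b
    simp only [PiLp.add_apply, PiLp.single_apply, mul_add, Finset.sum_add_distrib,
      mul_ite, mul_one, mul_zero, Finset.sum_ite_eq',
      Finset.sum_ite_irrel, Finset.sum_const_zero, Finset.mem_univ, if_true]
    rw [hm b a]
    ring
  have h2 : ∀ a : Fin n, 0 ≤ m a a ∧ m a a ≤ L := by
    intro a
    have := h (EuclideanSpace.single a 1)
    simpa [PiLp.single_apply] using this
  have h3 := h (EuclideanSpace.single a (1 : ℝ) + EuclideanSpace.single b 1)
  rw [h1] at h3
  have h4 : ‖(EuclideanSpace.single a (1 : ℝ) + EuclideanSpace.single b 1 :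
      EuclideanSpace ℝ (Fin n))‖ ≤ 2 := by
    refine (norm_add_le _ _).trans ?_
    simp
    norm_num
  have h5 : L * ‖(EuclideanSpace.single a (1 : ℝ) + EuclideanSpace.single b 1 :
      EuclideanSpace ℝ (Fin n))‖ ^ 2 ≤ L * 2 ^ 2 := by gcongr
  rw [abs_le]
  constructor <;> linarith [h2 a, h2 b, h3.1, h3.2]

lemma exists_isCoeff (hAm : ∀ i j, AEMeasurable (fun x => A x i j) (volume.restrict Ω))
    (hAs : ∀ᵐ x ∂(volume.restrict Ω), ∀ i j, A x i j = A x j i)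
    {Λ₁ Λ₂ : ℝ} (hΛ₁ : 0 < Λ₁) (hΛ : Λ₁ ≤ Λ₂)
    (hA : ∀ᵐ x ∂(volume.restrict Ω), ∀ ξ : EuclideanSpace ℝ (Fin n),
      Λ₁ * ‖ξ‖ ^ 2 ≤ ∑ i, ∑ j, A x i j * ξ j * ξ i ∧
        ∑ i, ∑ j, A x i j * ξ j * ξ i ≤ Λ₂ * ‖ξ‖ ^ 2)
    (hc : MemLp c ⊤ (volume.restrict Ω)) (hc0 : ∀ᵐ x ∂(volume.restrict Ω), 0 ≤ c x) :
    ∃ C, IsCoeff (volume.restrict Ω) A c C := by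
  have hΛ₂ : 0 ≤ Λ₂ := (hΛ₁.trans_le hΛ).le
  obtain ⟨B, hB⟩ : ∃ B : ℝ, ∀ᵐ x ∂(volume.restrict Ω), ‖c x‖ ≤ B := by
    refine ⟨(eLpNormEssSup c (volume.restrict Ω)).toReal, ?_⟩
    have htop : eLpNormEssSup c (volume.restrict Ω) ≠ ⊤ := by
      simpa [eLpNorm_exponent_top] using hc.2.ne
    filter_upwards [enorm_ae_le_eLpNormEssSup c (volume.restrict Ω)] with x hx
    have := ENNReal.toReal_mono htop hx
    rwa [toReal_enorm] at this
  have hpos : ∀ᵐ x ∂(volume.restrict Ω), ∀ ξ : EuclideanSpace ℝ (Fin n),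
      0 ≤ ∑ i, ∑ j, A x i j * ξ j * ξ i ∧
        ∑ i, ∑ j, A x i j * ξ j * ξ i ≤ Λ₂ * ‖ξ‖ ^ 2 := by
    filter_upwards [hA] with x hx ξ
    exact ⟨le_trans (by positivity) (hx ξ).1, (hx ξ).2⟩
  refine ⟨max (2 * Λ₂) B, le_max_of_le_left (by positivity),
    fun i j => (hAm i j).aestronglyMeasurable, ?_, hAs, ?_, hc.1,
    hB.mono fun x hx => hx.trans (le_max_right _ _), hc0⟩
  · filter_upwards [hpos, hAs] with x h1 h2 i j
    exact (abs_entry_le h2 hΛ₂ h1 i j).trans (le_max_left _ _)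
  · filter_upwards [hpos] with x hx ξ
    exact (hx (WithLp.toLp 2 ξ)).1

end Coefficients

/-! ### The variational inequality on triples -/

/-- An `L²` convergent sequence has an almost everywhere convergent subsequence. No measurability of
`Q` or `ψ` is needed. -/
lemma isClosed_ae_le {α : Type*} [MeasurableSpace α] {μ : Measure α} (Q : α → Prop) (ψ : α → ℝ) :
    IsClosed {g : Lp ℝ 2 μ | ∀ᵐ x ∂μ, Q x → g x ≤ ψ x} := by
  refine isClosed_of_closure_subset fun g hg => ?_
  obtain ⟨u, hu, hlim⟩ := mem_closure_iff_seq_limit.1 hg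
  obtain ⟨k, -, hk⟩ := (tendstoInMeasure_of_tendsto_Lp hlim).exists_seq_tendsto_ae
  have hall : ∀ᵐ x ∂μ, ∀ i, Q x → u (k i) x ≤ ψ x := ae_all_iff.2 fun i => hu (k i)
  filter_upwards [hk, hall] with x h1 h2 hQ
  exact le_of_tendsto' h1 fun i => h2 i hQ

lemma convex_ae_le {α : Type*} [MeasurableSpace α] {μ : Measure α} (Q : α → Prop) (ψ : α → ℝ) :
    Convex ℝ {g : Lp ℝ 2 μ | ∀ᵐ x ∂μ, Q x → g x ≤ ψ x} := by
  intro g hg g' hg' a b ha hb hab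
  filter_upwards [hg, hg', Lp.coeFn_add (a • g) (b • g'), Lp.coeFn_smul a g,
    Lp.coeFn_smul b g'] with x h1 h2 h3 h4 h5 hQ
  rw [h3, Pi.add_apply, h4, h5, Pi.smul_apply, Pi.smul_apply, smul_eq_mul, smul_eq_mul]
  have e1 := mul_le_mul_of_nonneg_left (h1 hQ) ha
  have e2 := mul_le_mul_of_nonneg_left (h2 hQ) hb
  have e3 : a * ψ x + b * ψ x = ψ x := by rw [← add_mul, hab, one_mul]
  linarith

/-- Expand: `a (p - q) (p - q) = a p p - 2 a p q + a q q ≤ 2 a p (p - q)`. -/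
lemma IsBddSymm.sub_sub_nonpos {V : Type*} [NormedAddCommGroup V] [NormedSpace ℝ V]
    {a : V →ₗ[ℝ] V →ₗ[ℝ] ℝ} {M : ℝ} (ha : IsBddSymm a M) {p q : V} (hle : a q q ≤ a p p)
    (h : a p (p - q) ≤ 0) : a (p - q) (p - q) ≤ 0 := by
  rw [map_sub] at h
  rw [LinearMap.map_sub₂, map_sub, map_sub, ha.symm q p]
  linarith

section Inequality

variable {n : ℕ} {Ω : Set (EuclideanSpace ℝ (Fin n))} {s : ℝ}
  {A : EuclideanSpace ℝ (Fin n) → Matrix (Fin n) (Fin n) ℝ}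
  {c f : EuclideanSpace ℝ (Fin n) → ℝ} {C κ τ : ℝ} {F : L2 Ω}
  {Ψ : L2 Ω → EuclideanSpace ℝ (Fin n) → ℝ}

/-- The variational inequality for the pair `p`, `q` of solution and competitor. -/
def TestIneq (hA : IsCoeff (volume.restrict Ω) A c C) (F : L2 Ω) {h : EReal}
    (p q : Triple Ω s h) : Prop :=
  tripleForm hA s h p (p - q) ≤ inner ℝ F (p.2.2 - q.2.2)

/-- Every element of `HL` underlies a triple, so the inequality can be tested on triples, where form
and trace are linear. -/
lemma solvesVI_iff (hA : IsCoeff (volume.restrict Ω) A c C) (hΩ : IsOpen Ω)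
    (hs : s ∈ Ioo (0 : ℝ) 1) (hF : F =ᵐ[volume.restrict Ω] f) {h : EReal} {M : Set (L2C Ω s h)}
    (hM : M ⊆ HL Ω s h) {p : Triple Ω s h} (hp : p ∈ sobolevTriples s Ω (cylLow Ω h) h) :
    SolvesVI Ω s A c f h M p.1 ↔ p.1 ∈ M ∧
      ∀ q ∈ sobolevTriples s Ω (cylLow Ω h) h, q.1 ∈ M → TestIneq hA F p q := by
  have key : ∀ q ∈ sobolevTriples s Ω (cylLow Ω h) h,
      (form Ω s A c h p.1 (p.1 - q.1) ≤ ∫ x in Ω, f x * tr Ω s h (p.1 - q.1) x)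
        ↔ TestIneq hA F p q := by
    intro q hq
    have hpq := Submodule.sub_mem _ hp hq
    have h1 := form_eq_tripleForm hA hΩ hs.2 hp hpq
    have h2 := tr_eq_of_mem hΩ hs hpq
    have h3 : inner ℝ F (p - q).2.2 = ∫ x in Ω, f x * (p - q).2.2 x := by
      rw [inner_eq_setIntegral]
      refine integral_congr_ae ?_
      filter_upwards [hF] with x hx
      rw [hx]
    rw [Prod.fst_sub] at h1 h2
    rw [h1, h2, ← h3]
    rfl
  refine and_congr_right fun _ => ⟨fun hv q hq hqM => (key q hq).1 (hv _ hqM), fun hv v hvM => ?_⟩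
  obtain ⟨q, hq, rfl⟩ := exists_triple_of_mem_HL hΩ hs (hM hvM)
  exact (key q hq).2 (hv q hq hvM)

lemma mem_K_iff (hΩ : IsOpen Ω) (hs : s ∈ Ioo (0 : ℝ) 1) {h : EReal} {w : L2C Ω s h} {g : L2 Ω}
    (hg : tr Ω s h w = g) {p : Triple Ω s h} (hp : p ∈ sobolevTriples s Ω (cylLow Ω h) h) :
    p.1 ∈ K Ω s Ψ h w ↔ ∀ᵐ x ∂(volume.restrict Ω), p.2.2 x ≤ Ψ g x := by
  rw [← tr_eq_of_mem hΩ hs hp, ← hg]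
  exact ⟨fun h => h.2, fun h => ⟨mem_HL_of_mem hΩ hs.2 hp, h⟩⟩

lemma mem_Ktau_iff (hΩ : IsOpen Ω) (hs : s ∈ Ioo (0 : ℝ) 1) (hτ : 0 < τ) {w : L2C Ω s ⊤} {g : L2 Ω}
    (hg : tr Ω s ⊤ w = g) {p : Triple Ω s ⊤} (hp : p ∈ sobolevTriples s Ω (cylLow Ω ⊤) ⊤) :
    p.1 ∈ Ktau Ω s Ψ τ w ↔ (∀ᵐ x ∂(volume.restrict Ω), p.2.2 x ≤ Ψ g x) ∧
      ∀ᵐ x ∂(cylMeasure Ω s ⊤), x ∉ cyl Ω τ → p.1 x ≤ 0 := by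
  rw [← mem_K_iff hΩ hs hg hp, ← ae_above_iff hΩ hτ]
  rfl

lemma K_subset_HL {h : EReal} (w : L2C Ω s h) : K Ω s Ψ h w ⊆ HL Ω s h := fun _ h => h.1

lemma Ktau_subset_HL (w : L2C Ω s ⊤) : Ktau Ω s Ψ τ w ⊆ HL Ω s ⊤ := fun _ h => h.1.1

lemma eq_of_form_sub_le (hκ : 0 < κ)
    (hA : IsCoeff (volume.restrict Ω) A c C)
    (hco : ∀ p ∈ sobolevTriples s Ω (cylLow Ω ⊤) ⊤, κ * ‖p‖ ^ 2 ≤ tripleForm hA s ⊤ p p)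
    {p q : Triple Ω s ⊤} (hp : p ∈ sobolevTriples s Ω (cylLow Ω ⊤) ⊤)
    (hq : q ∈ sobolevTriples s Ω (cylLow Ω ⊤) ⊤) (h : tripleForm hA s ⊤ (p - q) (p - q) ≤ 0) :
    p = q := by
  have h1 := (hco _ (Submodule.sub_mem _ hp hq)).trans h
  have h2 : ‖p - q‖ ^ 2 ≤ 0 := by
    by_contra! hlt
    linarith [mul_pos hκ hlt]
  exact sub_eq_zero.1 (norm_eq_zero.1 (pow_eq_zero_iff two_ne_zero |>.1
    (le_antisymm h2 (sq_nonneg _))))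

/-- Two elements that satisfy the variational inequality against each other coincide. -/
lemma TestIneq.antisymm (hκ : 0 < κ) (hA : IsCoeff (volume.restrict Ω) A c C)
    (hco : ∀ p ∈ sobolevTriples s Ω (cylLow Ω ⊤) ⊤, κ * ‖p‖ ^ 2 ≤ tripleForm hA s ⊤ p p)
    {p q : Triple Ω s ⊤} (hp : p ∈ sobolevTriples s Ω (cylLow Ω ⊤) ⊤)
    (hq : q ∈ sobolevTriples s Ω (cylLow Ω ⊤) ⊤) (hpq : TestIneq hA F p q)
    (hqp : TestIneq hA F q p) : p = q := by
  refine eq_of_form_sub_le hκ hA hco hp hq ?_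
  unfold TestIneq at hpq hqp
  rw [← neg_sub p q, ← neg_sub p.2.2 q.2.2, map_neg, inner_neg_right] at hqp
  rw [LinearMap.map_sub₂]
  linarith

/-- The solution of the variational inequality on the full cylinder vanishes above `τ`. -/
lemma exists_solution_vanish (hA : IsCoeff (volume.restrict Ω) A c C) (hΩ : IsOpen Ω)
    (hs : s ∈ Ioo (0 : ℝ) 1) (hκ : 0 < κ)
    (hco : ∀ p ∈ sobolevTriples s Ω (cylLow Ω ⊤) ⊤, κ * ‖p‖ ^ 2 ≤ tripleForm hA s ⊤ p p)
    (hF : 0 ≤ᵐ[volume.restrict Ω] F) (hτ : 0 < τ) {ψ : EuclideanSpace ℝ (Fin n) → ℝ}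
    (hψ : ∀ᵐ x ∂(volume.restrict Ω), 0 ≤ ψ x) :
    ∃ p ∈ sobolevTriples s Ω (cylLow Ω τ) ⊤,
      (∀ᵐ x ∂(volume.restrict Ω), p.2.2 x ≤ ψ x) ∧
      (∀ᵐ x ∂(cylMeasure Ω s ⊤), x ∉ cyl Ω τ → p.1 x = 0) ∧
      ∀ q ∈ sobolevTriples s Ω (cylLow Ω ⊤) ⊤, (∀ᵐ x ∂(volume.restrict Ω), q.2.2 x ≤ ψ x) →
        (∀ᵐ x ∂(cylMeasure Ω s ⊤), x ∉ cyl Ω τ → q.1 x ≤ 0) → TestIneq hA F p q := by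
  set T₁ : Set (L2 Ω) := {g | ∀ᵐ x ∂(volume.restrict Ω), True → g x ≤ ψ x} with hT₁
  set T₂ : Set (L2C Ω s ⊤) := {w | ∀ᵐ x ∂(cylMeasure Ω s ⊤), x ∉ cyl Ω τ → w x ≤ 0}
  have hT₁iff : ∀ g, g ∈ T₁ ↔ ∀ᵐ x ∂(volume.restrict Ω), g x ≤ ψ x := by simp [hT₁]
  set L₁ : Triple Ω s ⊤ →L[ℝ] L2 Ω :=
    (ContinuousLinearMap.snd ℝ _ _).comp (ContinuousLinearMap.snd ℝ _ _)
  set L₂ : Triple Ω s ⊤ →L[ℝ] L2C Ω s ⊤ := ContinuousLinearMap.fst ℝ _ _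
  set T : Set (Triple Ω s ⊤) :=
    (sobolevTriples s Ω (cylLow Ω ⊤) ⊤ : Set (Triple Ω s ⊤)) ∩ (L₁ ⁻¹' T₁ ∩ L₂ ⁻¹' T₂) with hT
  have hclosed : IsClosed T := isClosed_sobolevTriples.inter
    (((isClosed_ae_le _ _).preimage L₁.continuous).inter
      ((isClosed_ae_le _ fun _ => 0).preimage L₂.continuous))
  have hconv : Convex ℝ T := (Submodule.convex _).inter
    (((convex_ae_le _ _).linear_preimage L₁.toLinearMap).inter
      ((convex_ae_le _ fun _ => 0).linear_preimage L₂.toLinearMap))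
  have hzero : (0 : Triple Ω s ⊤) ∈ T := by
    refine ⟨Submodule.zero_mem _, ?_, ?_⟩
    · rw [mem_preimage, map_zero, hT₁iff]
      filter_upwards [hψ, Lp.coeFn_zero ℝ 2 ((volume : Measure (EuclideanSpace ℝ (Fin n))).restrict Ω)]
        with x h1 h2
      rw [h2]
      exact h1
    · rw [mem_preimage, map_zero]
      filter_upwards [Lp.coeFn_zero ℝ 2 (cylMeasure Ω s ⊤)] with x hx _
      rw [hx]
      exact le_rfl
  obtain ⟨p, hpT, hp⟩ := (isBddSymm_tripleForm hA hs ⊤).exists_solution hκ hco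
    ((innerSL ℝ F).comp L₁) hclosed hconv ⟨0, hzero⟩ fun _ h => h.1
  have hpT₁ := (hT₁iff _).1 hpT.2.1
  have hpT₂ : ∀ᵐ x ∂(cylMeasure Ω s ⊤), x ∉ cyl Ω τ → p.1 x ≤ 0 := hpT.2.2
  -- The competitor is the positive part of `p`, admissible because `ψ ≥ 0` and because it is zero
  -- wherever `p ≤ 0`.
  obtain ⟨q, hq, hq1, hq2, hle⟩ := exists_posPart hA hs hΩ hκ hco hpT.1
  have hqT : q ∈ T := by
    refine ⟨hq, ?_, ?_⟩
    · refine (hT₁iff _).2 ?_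
      change ∀ᵐ x ∂(volume.restrict Ω), q.2.2 x ≤ ψ x
      rw [hq2]
      filter_upwards [hψ, hpT₁, Lp.coeFn_sup p.2.2 0, Lp.coeFn_zero ℝ 2
        ((volume : Measure (EuclideanSpace ℝ (Fin n))).restrict Ω)] with x h1 h2 h3 h4
      rw [h3, Pi.sup_apply, h4]
      exact sup_le h2 h1
    · change ∀ᵐ x ∂(cylMeasure Ω s ⊤), x ∉ cyl Ω τ → q.1 x ≤ 0
      rw [hq1]
      filter_upwards [hpT₂, Lp.coeFn_sup p.1 0, Lp.coeFn_zero ℝ 2 (cylMeasure Ω s ⊤)]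
        with x h1 h2 h3 hx
      rw [h2, Pi.sup_apply, h3]
      exact sup_le (h1 hx) le_rfl
  -- The load favours the positive part since `F ≥ 0`. Together with the energy comparison this
  -- leaves only `p = q`.
  have hFq : inner ℝ F (p.2.2 - q.2.2) ≤ 0 := by
    rw [inner_eq_setIntegral, hq2]
    refine integral_nonpos_of_ae ?_
    filter_upwards [hF, Lp.coeFn_sub p.2.2 (p.2.2 ⊔ 0), Lp.coeFn_sup p.2.2 0] with x h1 h2 h3
    rw [h2, Pi.sub_apply, h3, Pi.sup_apply]
    exact mul_nonpos_of_nonneg_of_nonpos h1 (sub_nonpos.2 le_sup_left)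
  have hpq : p = q := by
    exact eq_of_form_sub_le hκ hA hco hpT.1 hq
      ((isBddSymm_tripleForm hA hs ⊤).sub_sub_nonpos hle ((hp q hqT).trans hFq))
  have hvan : ∀ᵐ x ∂(cylMeasure Ω s ⊤), x ∉ cyl Ω τ → p.1 x = 0 := by
    have h0 : p.1 = p.1 ⊔ 0 := by
      conv_lhs => rw [hpq]
      exact hq1
    have h1 : p.1 =ᵐ[cylMeasure Ω s ⊤] ⇑(p.1 ⊔ 0) := EventuallyEq.of_eq (by rw [← h0])
    filter_upwards [hpT₂, h1, Lp.coeFn_sup p.1 0, Lp.coeFn_zero ℝ 2 (cylMeasure Ω s ⊤)]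
      with x h1 h2 h3 h4 hx
    refine le_antisymm (h1 hx) ?_
    rw [h2, h3, Pi.sup_apply, h4]
    exact le_sup_right
  exact ⟨p, mem_sobolevTriples_of_vanish hA hΩ hs hκ hco hτ hpT.1 hvan, hpT₁, hvan,
    fun q hq h1 h2 => hp q ⟨hq, (hT₁iff _).2 h1, h2⟩⟩

/-- The solution of the variational inequality over `Ktau w`. -/
lemma exists_solvesVI_Ktau (hA : IsCoeff (volume.restrict Ω) A c C) (hΩ : IsOpen Ω)
    (hs : s ∈ Ioo (0 : ℝ) 1) (hκ : 0 < κ)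
    (hco : ∀ p ∈ sobolevTriples s Ω (cylLow Ω ⊤) ⊤, κ * ‖p‖ ^ 2 ≤ tripleForm hA s ⊤ p p)
    (hFf : F =ᵐ[volume.restrict Ω] f)
    (hF : 0 ≤ᵐ[volume.restrict Ω] F) (hτ : 0 < τ) {w : L2C Ω s ⊤}
    (hψ : ∀ᵐ x ∂(volume.restrict Ω), 0 ≤ Ψ (tr Ω s ⊤ w) x) :
    ∃ p ∈ sobolevTriples s Ω (cylLow Ω τ) ⊤,
      (∀ᵐ x ∂(cylMeasure Ω s ⊤), x ∉ cyl Ω τ → p.1 x = 0) ∧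
      SolvesVI Ω s A c f ⊤ (Ktau Ω s Ψ τ w) p.1 ∧
      ∀ u, SolvesVI Ω s A c f ⊤ (Ktau Ω s Ψ τ w) u → u = p.1 := by
  obtain ⟨p, hp, hp1, hp2, hpq⟩ := exists_solution_vanish hA hΩ hs hκ hco hF hτ hψ
  have hp' := sobolevTriples_le_top hp
  have hsol : SolvesVI Ω s A c f ⊤ (Ktau Ω s Ψ τ w) p.1 := by
    rw [solvesVI_iff hA hΩ hs hFf (Ktau_subset_HL w) hp', mem_Ktau_iff hΩ hs hτ rfl hp']
    refine ⟨⟨hp1, hp2.mono fun x h hx => (h hx).le⟩, fun q hq hqM => ?_⟩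
    rw [mem_Ktau_iff hΩ hs hτ rfl hq] at hqM
    exact hpq q hq hqM.1 hqM.2
  refine ⟨p, hp, hp2, hsol, fun u hu => ?_⟩
  obtain ⟨q, hq, rfl⟩ := exists_triple_of_mem_HL hΩ hs (Ktau_subset_HL w hu.1)
  rw [solvesVI_iff hA hΩ hs hFf (Ktau_subset_HL w) hq] at hu
  rw [solvesVI_iff hA hΩ hs hFf (Ktau_subset_HL w) hp'] at hsol
  rw [TestIneq.antisymm hκ hA hco hq hp' (hu.2 p hp' hsol.1) (hsol.2 q hq hu.1)]

lemma S_eq {M : Set (L2C Ω s ⊤)} {u : L2C Ω s ⊤} (hu : SolvesVI Ω s A c f ⊤ M u)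
    (huniq : ∀ v, SolvesVI Ω s A c f ⊤ M v → v = u) : S Ω s A c f M = u := by
  have hex : ∃ u, SolvesVI Ω s A c f ⊤ M u := ⟨u, hu⟩
  unfold S
  rw [dif_pos hex]
  exact huniq _ hex.choose_spec

/-! ### Transfer between the cylinders -/

/-- Triples are determined by their first entry, so any triple over the zero extension has the
zero-extended gradient and the same trace. -/
lemma extend_spec (hΩ : IsOpen Ω) (hs : s ∈ Ioo (0 : ℝ) 1) {h : EReal} {p : Triple Ω s h}
    (hp : p ∈ sobolevTriples s Ω (cylLow Ω h) h) {p' : Triple Ω s ⊤}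
    (hp' : p' ∈ sobolevTriples s Ω (cylLow Ω h) ⊤) (hpE : p'.1 = E hΩ p.1) :
    p'.2.1 =ᵐ[cylMeasure Ω s ⊤] (cyl Ω h).indicator p.2.1 ∧ p'.2.2 = p.2.2 := by
  obtain ⟨q, hq, hq1, hq2⟩ := exists_extend hΩ hs.2 hp
  rw [sobolevTriples_ext hΩ hs (sobolevTriples_le_top hp') (sobolevTriples_le_top hq)
    (hpE.trans hq1.symm)]
  exact hq2

lemma testIneq_extend (hA : IsCoeff (volume.restrict Ω) A c C) (hΩ : IsOpen Ω)
    (hs : s ∈ Ioo (0 : ℝ) 1) {h : EReal} {p q : Triple Ω s h}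
    (hp : p ∈ sobolevTriples s Ω (cylLow Ω h) h) (hq : q ∈ sobolevTriples s Ω (cylLow Ω h) h)
    {p' q' : Triple Ω s ⊤} (hp' : p' ∈ sobolevTriples s Ω (cylLow Ω h) ⊤)
    (hq' : q' ∈ sobolevTriples s Ω (cylLow Ω h) ⊤) (hpE : p'.1 = E hΩ p.1)
    (hqE : q'.1 = E hΩ q.1) : TestIneq hA F p' q' ↔ TestIneq hA F p q := by
  obtain ⟨h1, h2⟩ := extend_spec hΩ hs hp hp' hpE
  obtain ⟨h3, h4⟩ := extend_spec hΩ hs hq hq' hqE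
  unfold TestIneq
  rw [map_sub, map_sub, tripleForm_extend hA hΩ hpE h1 hpE h1,
    tripleForm_extend hA hΩ hpE h1 hqE h3, h2, h4]

/-- A solution of the truncated problem extends to a solution on the full cylinder. -/
lemma solvesVI_E (hA : IsCoeff (volume.restrict Ω) A c C) (hΩ : IsOpen Ω)
    (hs : s ∈ Ioo (0 : ℝ) 1) (hκ : 0 < κ)
    (hco : ∀ p ∈ sobolevTriples s Ω (cylLow Ω ⊤) ⊤, κ * ‖p‖ ^ 2 ≤ tripleForm hA s ⊤ p p)
    (hFf : F =ᵐ[volume.restrict Ω] f) (hτ : 0 < τ) {u : L2C Ω s τ} (hu : u ∈ HL Ω s τ)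
    (hsol : SolvesQVI Ω s A c f Ψ τ u) {z : Triple Ω s ⊤}
    (hz : z ∈ sobolevTriples s Ω (cylLow Ω τ) ⊤)
    (hz0 : ∀ᵐ x ∂(cylMeasure Ω s ⊤), x ∉ cyl Ω τ → z.1 x = 0)
    (hzsol : SolvesVI Ω s A c f ⊤ (Ktau Ω s Ψ τ (E hΩ u)) z.1) : z.1 = E hΩ u := by
  obtain ⟨p, hp, rfl⟩ := exists_triple_of_mem_HL hΩ hs hu
  obtain ⟨p', hp', hpE, -, hptr⟩ := exists_extend hΩ hs.2 hp
  obtain ⟨r, hr, hr1, hrtr⟩ := exists_restrict hΩ hs.2 hz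
  have hzE : z.1 = E hΩ r.1 := by rw [hr1, E_restr hΩ hz0]
  have hz' := sobolevTriples_le_top hz
  have hp'' := sobolevTriples_le_top hp'
  have htr : tr Ω s τ p.1 = p.2.2 := tr_eq_of_mem hΩ hs hp
  have htr' : tr Ω s ⊤ (E hΩ p.1) = p.2.2 := by
    rw [← hpE, tr_eq_of_mem hΩ hs hp'', hptr]
  obtain ⟨g, hg⟩ : ∃ g, g = p.2.2 := ⟨_, rfl⟩
  rw [← hg] at htr htr' hptr
  unfold SolvesQVI at hsol
  rw [solvesVI_iff hA hΩ hs hFf (K_subset_HL _) hp, mem_K_iff hΩ hs htr hp, ← hg] at hsol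
  rw [solvesVI_iff hA hΩ hs hFf (Ktau_subset_HL _) hz', mem_Ktau_iff hΩ hs hτ htr' hz'] at hzsol
  -- Each solution is tested with the other: `r`, the restriction of `z`, is admissible for `p`, and
  -- the extension `p'` is admissible for `z`, because both problems have the same obstacle.
  have h1 : TestIneq hA F p r := by
    refine hsol.2 r hr ((mem_K_iff hΩ hs htr hr).2 ?_)
    rw [hrtr]
    exact hzsol.1.1
  have h2 : TestIneq hA F z p' := by
    refine hzsol.2 p' hp'' ((mem_Ktau_iff hΩ hs hτ htr' hp'').2 ⟨?_, ?_⟩)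
    · rw [hptr]
      exact hsol.1
    · rw [hpE]
      filter_upwards [coeFn_E hΩ p.1] with x hx hxn
      rw [hx, indicator_of_notMem hxn]
  rw [← testIneq_extend hA hΩ hs hp hr hp' hz hpE hzE] at h1
  rw [← hpE, TestIneq.antisymm hκ hA hco hz' hp'' h2 h1]

/-- A fixed point restricts to a solution of the truncated problem. -/
lemma solvesQVI_restr (hA : IsCoeff (volume.restrict Ω) A c C) (hΩ : IsOpen Ω)
    (hs : s ∈ Ioo (0 : ℝ) 1) (hFf : F =ᵐ[volume.restrict Ω] f) (hτ : 0 < τ) {z : Triple Ω s ⊤}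
    (hz : z ∈ sobolevTriples s Ω (cylLow Ω τ) ⊤)
    (hz0 : ∀ᵐ x ∂(cylMeasure Ω s ⊤), x ∉ cyl Ω τ → z.1 x = 0)
    (hzsol : SolvesVI Ω s A c f ⊤ (Ktau Ω s Ψ τ z.1) z.1) :
    restr (τ : EReal) z.1 ∈ HL Ω s τ ∧ SolvesQVI Ω s A c f Ψ τ (restr (τ : EReal) z.1) := by
  obtain ⟨r, hr, hr1, hrtr⟩ := exists_restrict hΩ hs.2 hz
  have hzE : z.1 = E hΩ r.1 := by rw [hr1, E_restr hΩ hz0]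
  have hz' := sobolevTriples_le_top hz
  have htr : tr Ω s τ r.1 = r.2.2 := tr_eq_of_mem hΩ hs hr
  have htr' : tr Ω s ⊤ z.1 = z.2.2 := tr_eq_of_mem hΩ hs hz'
  obtain ⟨g, hg⟩ : ∃ g, g = z.2.2 := ⟨_, rfl⟩
  rw [← hg] at htr' hrtr
  rw [hrtr] at htr
  rw [solvesVI_iff hA hΩ hs hFf (Ktau_subset_HL _) hz', mem_Ktau_iff hΩ hs hτ htr' hz', ← hg]
    at hzsol
  rw [← hr1]
  refine ⟨mem_HL_of_mem hΩ hs.2 hr, ?_⟩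
  unfold SolvesQVI
  rw [solvesVI_iff hA hΩ hs hFf (K_subset_HL _) hr, mem_K_iff hΩ hs htr hr, hrtr]
  refine ⟨hzsol.1.1, fun q hq hqK => ?_⟩
  rw [mem_K_iff hΩ hs htr hq] at hqK
  -- The extended competitor is zero above `τ`, hence admissible, and `testIneq_extend` carries the
  -- inequality back to the truncated cylinder.
  obtain ⟨q', hq', hqE, -, hqtr⟩ := exists_extend hΩ hs.2 hq
  have hq'' := sobolevTriples_le_top hq'
  rw [← testIneq_extend hA hΩ hs hr hq hz hq' hzE hqE]
  refine hzsol.2 q' hq'' ((mem_Ktau_iff hΩ hs hτ htr' hq'').2 ⟨?_, ?_⟩)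
  · rw [hqtr]
    exact hqK
  · rw [hqE]
    filter_upwards [coeFn_E hΩ q.1] with x hx hxn
    rw [hx, indicator_of_notMem hxn]

end Inequality

end FracQVI

end

/-! ### Proof of the theorem. -/

theorem proposition4p1 {n : ℕ} (hn : 1 ≤ n)
    (Ω : Set (EuclideanSpace ℝ (Fin n))) (hΩ : IsOpen Ω) (hΩb : Bornology.IsBounded Ω)
    (s : ℝ) (hs : s ∈ Set.Ioo (0 : ℝ) 1)
    -- the coefficients of the elliptic operator
    (A : EuclideanSpace ℝ (Fin n) → Matrix (Fin n) (Fin n) ℝ)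
    (hAm : ∀ i j, AEMeasurable (fun x => A x i j) (volume.restrict Ω))
    (hAs : ∀ᵐ x ∂(volume.restrict Ω), ∀ i j, A x i j = A x j i)
    (Λ₁ Λ₂ : ℝ) (hΛ₁ : 0 < Λ₁) (hΛ : Λ₁ ≤ Λ₂)
    (hA : ∀ᵐ x ∂(volume.restrict Ω), ∀ ξ : EuclideanSpace ℝ (Fin n),
      Λ₁ * ‖ξ‖ ^ 2 ≤ ∑ i, ∑ j, A x i j * ξ j * ξ i ∧
        ∑ i, ∑ j, A x i j * ξ j * ξ i ≤ Λ₂ * ‖ξ‖ ^ 2)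
    (c : EuclideanSpace ℝ (Fin n) → ℝ) (hc : MemLp c ⊤ (volume.restrict Ω))
    (hc0 : ∀ᵐ x ∂(volume.restrict Ω), 0 ≤ c x)
    -- the right-hand side
    (f : EuclideanSpace ℝ (Fin n) → ℝ) (hf : MemLp f ⊤ (volume.restrict Ω))
    (hf0 : ∀ᵐ x ∂(volume.restrict Ω), 0 ≤ f x)
    -- the obstacle map, which matters only on `ℍ^s(Ω)`
    (Ψ : FracQVI.L2 Ω → EuclideanSpace ℝ (Fin n) → ℝ)
    (hΨm : ∀ u ∈ FracQVI.Hs Ω A c s, AEMeasurable (Ψ u) (volume.restrict Ω))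
    (hΨ0 : ∀ u ∈ FracQVI.Hs Ω A c s, ∀ᵐ x ∂(volume.restrict Ω), 0 ≤ Ψ u x)
    (τ : ℝ) (hτ : 0 < τ) :
    -- `S^τ` is well defined on `H¹_L(y^α, 𝒞)`
    (∀ w ∈ FracQVI.HL Ω s ⊤,
      ∃! u, FracQVI.SolvesVI Ω s A c f ⊤ (FracQVI.Ktau Ω s Ψ τ w) u) ∧
    -- extension by zero maps `H¹_L(y^α, 𝒞_τ)` into `H¹_L(y^α, 𝒞)`
    (∀ u ∈ FracQVI.HL Ω s (τ : EReal), FracQVI.E hΩ u ∈ FracQVI.HL Ω s ⊤) ∧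
    -- extensions by zero of solutions are fixed points
    (∀ u ∈ FracQVI.HL Ω s (τ : EReal), FracQVI.SolvesQVI Ω s A c f Ψ (τ : EReal) u →
      Function.IsFixedPt (FracQVI.Stau Ω s A c f Ψ τ) (FracQVI.E hΩ u)) ∧
    -- restrictions of fixed points are solutions
    (∀ u ∈ FracQVI.HL Ω s ⊤, Function.IsFixedPt (FracQVI.Stau Ω s A c f Ψ τ) u →
      FracQVI.restr (τ : EReal) u ∈ FracQVI.HL Ω s (τ : EReal) ∧
        FracQVI.SolvesQVI Ω s A c f Ψ (τ : EReal) (FracQVI.restr (τ : EReal) u)) := by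
  obtain ⟨C, hC⟩ := FracQVI.exists_isCoeff hAm hAs hΛ₁ hΛ hA hc hc0
  have hell : ∀ᵐ x ∂(volume.restrict Ω), ∀ ξ : Fin n → ℝ,
      Λ₁ * ∑ i, ξ i ^ 2 ≤ ∑ i, ∑ j, A x i j * ξ j * ξ i := by
    filter_upwards [hA] with x hx ξ
    have := (hx (WithLp.toLp 2 ξ)).1
    simpa [EuclideanSpace.norm_sq_eq] using this
  obtain ⟨κ, hκ, hco⟩ := FracQVI.exists_coercive hC hΛ₁ hell hs hn hΩ hΩb
  have hfin : IsFiniteMeasure ((volume : Measure (EuclideanSpace ℝ (Fin n))).restrict Ω) :=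
    ⟨by rw [Measure.restrict_apply_univ]; exact hΩb.measure_lt_top⟩
  -- The set `Ω` has finite measure, so `f` acts on traces as an element of `L²(Ω)`.
  have hf2 : MemLp f 2 (volume.restrict Ω) := hf.mono_exponent le_top
  have hFf := hf2.coeFn_toLp
  have hF : 0 ≤ᵐ[volume.restrict Ω] hf2.toLp f := by
    filter_upwards [hFf, hf0] with x h1 h2
    rw [h1]
    exact h2
  have hΨ : ∀ w ∈ FracQVI.HL Ω s ⊤,
      ∀ᵐ x ∂(volume.restrict Ω), 0 ≤ Ψ (FracQVI.tr Ω s ⊤ w) x := by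
    intro w hw
    obtain ⟨p, hp, rfl⟩ := FracQVI.exists_triple_of_mem_HL hΩ hs hw
    -- The sign of the obstacle is given only on `Hs`, so the trace of `w` has to be placed there.
    refine hΨ0 _ ?_
    rw [FracQVI.tr_eq_of_mem hΩ hs hp]
    exact FracQVI.tr_mem_Hs hC hΩ hΩb hs hp
  have hE : ∀ u ∈ FracQVI.HL Ω s (τ : EReal), FracQVI.E hΩ u ∈ FracQVI.HL Ω s ⊤ := by
    intro u hu
    obtain ⟨p, hp, rfl⟩ := FracQVI.exists_triple_of_mem_HL hΩ hs hu
    obtain ⟨p', hp', hpE, -⟩ := FracQVI.exists_extend hΩ hs.2 hp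
    rw [← hpE]
    exact FracQVI.mem_HL_of_mem hΩ hs.2 (FracQVI.sobolevTriples_le_top hp')
  refine ⟨fun w hw => ?_, hE, fun u hu hsol => ?_, fun u hu hfix => ?_⟩
  · obtain ⟨p, -, -, hp, huniq⟩ :=
      FracQVI.exists_solvesVI_Ktau hC hΩ hs hκ hco hFf hF hτ (hΨ w hw)
    exact ⟨p.1, hp, huniq⟩
  · obtain ⟨p, hpm, hp0, hp, huniq⟩ :=
      FracQVI.exists_solvesVI_Ktau hC hΩ hs hκ hco hFf hF hτ (hΨ _ (hE u hu))
    exact (FracQVI.S_eq hp huniq).trans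
      (FracQVI.solvesVI_E hC hΩ hs hκ hco hFf hτ hu hsol hpm hp0 hp)
  · obtain ⟨p, hpm, hp0, hp, huniq⟩ :=
      FracQVI.exists_solvesVI_Ktau hC hΩ hs hκ hco hFf hF hτ (hΨ u hu)
    -- A fixed point is the solution over its own constraint set, and so it inherits the vanishing
    -- above `τ`.
    obtain rfl : p.1 = u := (FracQVI.S_eq hp huniq).symm.trans hfix
    exact FracQVI.solvesQVI_restr hC hΩ hs hFf hτ hpm hp0 hp
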